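/- **Setting.** Let $1<q\le p<2$ and let $E$ be a real Banach space of martingale type $p$: there is $L>0$ such that every finite $E$-valued martingale $M_0,\dots,M_N$ on any probability space satisfies $\sup_{n\le N}\mathbb E|M_n|^p\le L\sum_{n=0}^N\mathbb E|M_n-M_{n-1}|^p$, where $M_{-1}=0$. Let $(S,\mathcal S)$ be a measurable space with a non-negative measure $\nu$, let $(\Omega,\mathcal F,(\mathcal F_t)_{t\ge0},\mathbb P)$ be a filtered probability space, and let $\lambda$ be Lebesgue measure. Let $\eta$ be a time homogeneous Poisson random measure on $S\times[0,\infty)$ with intensity $\nu$, i.e. a random $\{0,1,\dots,\infty\}$-valued measure such that (i) $\eta(B)$ is Poisson with parameter $\mathbb E\eta(B)$ for each measurable $B\subseteq S\times[0,\infty)$ ($\eta(B)=\infty$ a.s. if $\mathbb E\eta(B)=\infty$); (ii) $\eta(B_1),\dots,\eta(B_n)$ are pairwise independent for pairwise disjoint $B_1,\dots,B_n$; (iii) $\mathbb E\eta(U\times I)=\nu(U)\lambda(I)$; (iv) for each $U\in\mathcal S$, $\eta(U\times(0,t])$ is $\mathcal F_t$-measurable for all $t$, and $\eta(U\times(s,t])$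 is independent of $\mathcal F_s$ for $s<t$. Put $\tilde\eta(B)=\eta(B)-\mathbb E\eta(B)$ when $\mathbb E\eta(B)<\infty$. Let $\mathcal M^p_{\rm loc}$ be the set of (strongly) predictable processes $\xi:[0,\infty)\times\Omega\to L^p(S,\nu;E)$ with $\mathbb E\int_0^T\int_S|\xi(r,x)|^p\,\nu(dx)\,dr<\infty$ for all $T>0$, and let $\mathcal M^p$ be the set of those for which this is also finite with $T=\infty$. For elementary integrands $e=\sum_{i=1}^n1_{(s_i,t_i]}1_{A_i}1_{B_i}c_i$ with $s_i\le t_i$, $A_i\in\mathcal F_{s_i}$, $B_i\in\mathcal S$, $\nu(B_i)<\infty$, $c_i\in E$, put $I(e)=\sum_i1_{A_i}\tilde\eta(B_i\times(s_i,t_i])\,c_i$, and let $I:\mathcal M^p\to L^p(\Omega;E)$ be the continuous linear extension. The stochastic integral $\int_0^t\int_S\xi(r,x)\,\tilde\eta(dx,dr)$, $t\ge0$, of $\xi\in\mathcal M^p_{\rm loc}$ is the càdlàg modification of the process $I(1_{(0,t]}\xi)$, $t\ge 0$. **Corollary.** There is a constant $C>0$, depending only on $E,p,q$, such that for all $S,\nu,\Omega,\mathbb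 P,(\mathcal F_t),\eta$ as above and every $\xi\in\mathcal M^p_{\rm loc}$, the stochastic integral exists as an adapted process with almost surely càdlàg paths, and (for every version of it with almost surely càdlàg paths) for every $T>0$ $$\mathbb E\sup_{t\in[0,T]}\Big|\int_0^t\!\!\int_S\xi(r,x)\,\tilde\eta(dx,dr)\Big|^q\le C\,\mathbb E\Big(\int_0^T\!\!\int_S|\xi(r,x)|^p\,\nu(dx)\,dr\Big)^{q/p}.$$ -/

import Mathlib

open MeasureTheory ProbabilityTheory Filter Topology
open scoped NNReal ENNReal

universe u v w

noncomputable section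

/-- A real Banach space `E` is of martingale type `p` if there is a constant `L > 0` such that
`sup_{n ≤ N} 𝔼 |M_n|^p ≤ L ∑_{k = 0}^N 𝔼 |M_k - M_{k-1}|^p` (with `M_{-1} = 0`) for every finite
`E`-valued martingale `M_0, …, M_N` on any probability space.  A finite martingale is regarded as
an initial segment of a martingale indexed by `ℕ` (continue it by the constant `M_N`).  The first
summand is `𝔼 |M_0|^p`.  Expectations are taken in `[0, ∞]`. -/
def HasMartingaleType (E : Type u) [NormedAddCommGroup E] [NormedSpace ℝ E]
    [CompleteSpace E] (p : ℝ) : Prop :=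
  ∃ L : ℝ≥0, 0 < L ∧
    ∀ (Ω : Type w) (mΩ : MeasurableSpace Ω) (P : Measure Ω) (_ : IsProbabilityMeasure P)
      (𝓖 : Filtration ℕ mΩ) (M : ℕ → Ω → E), Martingale M 𝓖 P →
      ∀ N : ℕ, ∀ n ≤ N,
        ∫⁻ ω, ‖M n ω‖ₑ ^ p ∂P ≤
          L * (∫⁻ ω, ‖M 0 ω‖ₑ ^ p ∂P +
            ∑ k ∈ Finset.range N, ∫⁻ ω, ‖M (k + 1) ω - M k ω‖ₑ ^ p ∂P)

/-- Lebesgue measure on the time axis `[0, ∞)`. -/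
def lebesgueNN : Measure ℝ≥0 := (volume : Measure ℝ).comap ((↑) : ℝ≥0 → ℝ)

/-- The Poisson distribution with parameter `m ∈ [0, ∞]`, as a measure on `[0, ∞]`;
for `m = ∞` it is the Dirac mass at `∞`. -/
def extPoisson (m : ℝ≥0∞) : Measure ℝ≥0∞ :=
  if m = ∞ then Measure.dirac ∞
  else (poissonMeasure m.toNNReal).map (fun n : ℕ => (n : ℝ≥0∞))

section

variable {S : Type*} [MeasurableSpace S] {Ω : Type*} [mΩ : MeasurableSpace Ω]

/-- `η` is a time homogeneous Poisson random measure on `S × [0, ∞)` with intensity measure `ν`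
over the filtered probability space `(Ω, 𝓕, P)`.  Independent scattering is only required in the
form "the values on two disjoint sets are independent". -/
structure IsPoissonRandomMeasure (𝓕 : Filtration ℝ≥0 mΩ) (P : Measure Ω) (ν : Measure S)
    (η : Ω → Measure (S × ℝ≥0)) : Prop where
  /-- `η` takes values in the measures with values in `{0, 1, 2, …, ∞}` -/
  integerValued : ∀ ω, ∀ B : Set (S × ℝ≥0), MeasurableSet B → ∃ n : ℕ∞, η ω B = (n : ℝ≥0∞)
  /-- `η` is a measurable map into the space of measures with the evaluation `σ`-algebra -/
  measurable_eval : ∀ B : Set (S × ℝ≥0), MeasurableSet B → Measurable (fun ω => η ω B)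
  /-- `η(B)` has the Poisson distribution with parameter `𝔼 η(B)` -/
  law : ∀ B : Set (S × ℝ≥0), MeasurableSet B →
    P.map (fun ω => η ω B) = extPoisson (∫⁻ ω, η ω B ∂P)
  /-- `η` is independently scattered -/
  scattered : ∀ B₁ B₂ : Set (S × ℝ≥0), MeasurableSet B₁ → MeasurableSet B₂ → Disjoint B₁ B₂ →
    IndepFun (fun ω => η ω B₁) (fun ω => η ω B₂) P
  /-- the intensity is `ν ⊗ Lebesgue` on measurable rectangles -/
  intensity : ∀ (U : Set S) (I : Set ℝ≥0), MeasurableSet U → MeasurableSet I →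
    ∫⁻ ω, η ω (U ×ˢ I) ∂P = ν U * lebesgueNN I
  /-- `N(t, U) = η(U × (0, t])` is adapted -/
  adapted : ∀ U : Set S, MeasurableSet U → ∀ t : ℝ≥0,
    Measurable[𝓕 t] (fun ω => η ω (U ×ˢ Set.Ioc 0 t))
  /-- the increments of `N(·, U)` are independent of the past -/
  indep_past : ∀ U : Set S, MeasurableSet U → ∀ s t : ℝ≥0, s < t →
    Indep (MeasurableSpace.comap (fun ω => η ω (U ×ˢ Set.Ioc s t)) inferInstance) (𝓕 s) P

/-- The compensated random measure `η̃(B) = η(B) - 𝔼 η(B)`; used for sets with `𝔼 η(B) < ∞`. -/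
def compensated (P : Measure Ω) (η : Ω → Measure (S × ℝ≥0)) (B : Set (S × ℝ≥0)) (ω : Ω) : ℝ :=
  (η ω B).toReal - (∫⁻ ω', η ω' B ∂P).toReal

variable {E : Type*} [NormedAddCommGroup E] [NormedSpace ℝ E]

/-- The data of an elementary integrand `∑ᵢ 1_{(lᵢ, hᵢ]}(r) 1_{Aᵢ}(ω) 1_{Bᵢ}(x) cᵢ`, where
`Aᵢ ∈ 𝓕_{lᵢ}`, `Bᵢ ⊆ S` is measurable with `ν(Bᵢ) < ∞`, and `cᵢ ∈ E`. -/
structure ElementaryIntegrand (E : Type*) (𝓕 : Filtration ℝ≥0 mΩ) (ν : Measure S) where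
  n : ℕ
  lo : Fin n → ℝ≥0
  hi : Fin n → ℝ≥0
  lo_le_hi : ∀ i, lo i ≤ hi i
  A : Fin n → Set Ω
  measurable_A : ∀ i, MeasurableSet[𝓕 (lo i)] (A i)
  B : Fin n → Set S
  measurable_B : ∀ i, MeasurableSet (B i)
  finite_B : ∀ i, ν (B i) ≠ ∞
  c : Fin n → E

/-- The elementary integrand as a process with values in `L^p(S, ν; E)`. -/
def ElementaryIntegrand.toIntegrand {𝓕 : Filtration ℝ≥0 mΩ} {ν : Measure S}
    (e : ElementaryIntegrand E 𝓕 ν) (p : ℝ≥0∞) (r : ℝ≥0) (ω : Ω) : Lp E p ν :=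
  ∑ i, (Set.Ioc (e.lo i) (e.hi i) ×ˢ e.A i).indicator
    (fun _ => indicatorConstLp p (e.measurable_B i) (e.finite_B i) (e.c i)) (r, ω)

/-- The integral `∑ᵢ 1_{Aᵢ} η̃(Bᵢ × (lᵢ, hᵢ]) cᵢ` of an elementary integrand. -/
def ElementaryIntegrand.integral {𝓕 : Filtration ℝ≥0 mΩ} {ν : Measure S}
    (e : ElementaryIntegrand E 𝓕 ν) (P : Measure Ω) (η : Ω → Measure (S × ℝ≥0)) (ω : Ω) : E :=
  ∑ i, (e.A i).indicator
    (fun ω' => compensated P η (e.B i ×ˢ Set.Ioc (e.lo i) (e.hi i)) ω' • e.c i) ω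

/-- The space `𝓜^p_loc(0, ∞; L^p(S, ν; E))`: predictable (strongly measurable with respect to the
predictable `σ`-algebra) processes `ξ` with values in `L^p(S, ν; E)` such that
`𝔼 ∫_0^T ∫_S |ξ(r, x)|^p ν(dx) dr < ∞` for all `T`. -/
structure IsMpLoc (p : ℝ≥0) [Fact (1 ≤ (p : ℝ≥0∞))] (𝓕 : Filtration ℝ≥0 mΩ) (P : Measure Ω)
    (ν : Measure S) (ξ : ℝ≥0 → Ω → Lp E (p : ℝ≥0∞) ν) : Prop where
  predictable : IsStronglyPredictable 𝓕 ξ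
  moment : ∀ T : ℝ≥0,
    ∫⁻ ω, ∫⁻ r in Set.Ioc 0 T, ∫⁻ x, ‖ξ r ω x‖ₑ ^ (p : ℝ) ∂ν ∂lebesgueNN ∂P < ∞

/-- `Y = I(ζ)`, where `I : 𝓜^p(0, ∞; L^p(S, ν; E)) → L^p(Ω; E)` is the continuous extension of the
integral of elementary integrands: there are elementary integrands `eₘ` with
`𝔼 ∫_0^∞ ∫_S |eₘ - ζ|^p dν dr → 0` and `I(eₘ) → Y` in `L^p(Ω; E)`. -/
def IsPoissonIntegral (p : ℝ≥0) (𝓕 : Filtration ℝ≥0 mΩ) (P : Measure Ω)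
    (ν : Measure S) (η : Ω → Measure (S × ℝ≥0)) (ζ : ℝ≥0 → Ω → Lp E (p : ℝ≥0∞) ν)
    (Y : Ω → E) : Prop :=
  MemLp Y p P ∧ ∃ e : ℕ → ElementaryIntegrand E 𝓕 ν,
    Tendsto (fun m => ∫⁻ ω, ∫⁻ r, ∫⁻ x,
      ‖((e m).toIntegrand (p : ℝ≥0∞) r ω - ζ r ω : Lp E (p : ℝ≥0∞) ν) x‖ₑ ^ (p : ℝ)
        ∂ν ∂lebesgueNN ∂P) atTop (𝓝 0) ∧
    Tendsto (fun m => eLpNorm ((e m).integral P η - Y) p P) atTop (𝓝 0)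

/-- Right-continuous functions with left limits. -/
def IsCadlagPath {E : Type*} [TopologicalSpace E] (f : ℝ≥0 → E) : Prop :=
  ∀ t, ContinuousWithinAt f (Set.Ici t) t ∧ ∃ l, Tendsto f (𝓝[<] t) (𝓝 l)

/-- `X` is (a version of) the stochastic integral process `t ↦ ∫_0^t ∫_S ξ(r, x) η̃(dx, dr)`:
a process with almost surely càdlàg paths such that `X_t = I(1_{(0, t]} ξ)` for every `t`. -/
structure IsStochIntegral (p : ℝ≥0) (𝓕 : Filtration ℝ≥0 mΩ) (P : Measure Ω)
    (ν : Measure S) (η : Ω → Measure (S × ℝ≥0)) (ξ : ℝ≥0 → Ω → Lp E (p : ℝ≥0∞) ν)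
    (X : ℝ≥0 → Ω → E) : Prop where
  cadlag : ∀ᵐ ω ∂P, IsCadlagPath (fun t => X t ω)
  eq_integral : ∀ t, IsPoissonIntegral p 𝓕 P ν η
    (fun r ω => (Set.Ioc 0 t).indicator (fun r' => ξ r' ω) r) (X t)

end

end

/-!
For elementary integrands the inequality is a statement about discrete martingales, and everything
else is approximation.

On a time grid an elementary integrand is a simple step process, constant on the atoms of finitely
many sets, and its integral is a martingale with respect to the filtration sampled on the grid.
Martingale type `p`, together with Doob's inequality
(`MeasureTheory.Martingale.lintegral_sup_enorm_rpow_le`), reduces the maximal inequality with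
exponent `p` to a bound for the `p`-th moment of one increment.  The values of the random measure on
several disjoint sets are only known to be independent in pairs, so the increment is not treated as
a sum of independent terms.  Instead, the weights `η(B × (s, t])` are integers: if at most one point
falls into the relevant set, the `p`-th power of the norm of the uncompensated increment is exactly
additive (`enorm_sum_natCast_smul_rpow_le`), and the error is governed by the second factorial
moment of a Poisson variable, which is of order `(t - s) ^ 2`.  Cutting `(s, t]` into small pieces
and applying martingale type once more removes all terms of higher order
(`IsPoissonRandomMeasure.lintegral_simpleIncrement_rpow_le`).

For `q < p` the integrand is divided by the power `β = (p - q) / p ^ 2` of its accumulated energy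
`A + ε`.  The weighted integrand has energy at most a multiple of `(A + ε) ^ (q / p)`, so the case
of exponent `p` applies to it; Abel summation bounds the original maximal function by
`2 (A + ε) ^ β` times the weighted one, and Hölder's inequality gives the claim
(`IsPoissonRandomMeasure.lintegral_sup_sum_simpleIncrement_rpow_le_of_lt`).

Elementary integrands are dense in the predictable `p`-integrable processes
(`IsMpLoc.exists_elementaryIntegrand`), by a `π`-`λ` argument on the generators of the predictable
`σ`-algebra.  Approximating `ξ` on `[0, k]` up to `2⁻ᵏ`, the maximal inequality makes the integral
processes converge uniformly on bounded intervals, almost surely, and the limit is the integral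
process (`IsMpLoc.exists_stochIntegral`).  Conversely every version of the integral is a limit in
`L^p`, at each time, of integrals of elementary integrands, so the inequality holds for suprema over
finite sets of times; right-continuity replaces these by the whole interval
(`IsStochIntegral.lintegral_iSup_rpow_le`).
-/

/-! ### Doob's `L^p` inequality and discrete martingales -/

section Discrete

variable {E : Type*} [NormedAddCommGroup E] [NormedSpace ℝ E] [CompleteSpace E]
  {Ω : Type*} {mΩ : MeasurableSpace Ω} {P : Measure Ω} {𝓖 : Filtration ℕ mΩ}

theorem MeasureTheory.Martingale.norm_submartingale {M : ℕ → Ω → E} (hM : Martingale M 𝓖 P) :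
    Submartingale (fun k ω => ‖M k ω‖) 𝓖 P := by
  refine ⟨fun k => (hM.1 k).norm, fun i j hij => ?_, fun k => (hM.integrable k).norm⟩
  filter_upwards [hM.2 i j hij, norm_condExp_le (μ := P) (m := 𝓖 i) (M j)] with ω h1 h2
  rw [← h1]
  exact h2

/-- **Doob's `L^p` inequality** for a Banach space valued martingale. -/
theorem MeasureTheory.Martingale.lintegral_sup_enorm_rpow_le [IsFiniteMeasure P]
    {M : ℕ → Ω → E} (hM : Martingale M 𝓖 P) {p : ℝ} (hp : 1 < p) (n : ℕ)
    (hfin : ∀ k ≤ n, ∫⁻ ω, ‖M k ω‖ₑ ^ p ∂P < ∞) :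
    ∫⁻ ω, ((Finset.range (n + 1)).sup fun k => ‖M k ω‖ₑ) ^ p ∂P ≤
      ENNReal.ofReal (p / (p - 1)) ^ p * ∫⁻ ω, ‖M n ω‖ₑ ^ p ∂P := by
  have hp0 : 0 < p := by linarith
  have hsub := hM.norm_submartingale
  set S : Ω → ℝ := fun ω => (Finset.range (n + 1)).sup' Finset.nonempty_range_add_one
    fun k => ‖M k ω‖ with hS
  have hmeas : ∀ k, Measurable fun ω => ‖M k ω‖ := fun k =>
    ((hM.1 k).mono (𝓖.le k)).norm.measurable
  have hSm : Measurable S := by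
    have := Finset.measurable_sup' (s := Finset.range (n + 1)) Finset.nonempty_range_add_one
      (f := fun k ω => ‖M k ω‖) (fun k _ => hmeas k)
    convert this using 1
    ext ω
    simp [hS, Finset.sup'_apply]
  have hS0 : ∀ ω, 0 ≤ S ω := fun ω => (norm_nonneg (M 0 ω)).trans
    (Finset.le_sup' (fun k => ‖M k ω‖) (by simp))
  have hSe : ∀ ω, ((Finset.range (n + 1)).sup fun k => ‖M k ω‖ₑ) = ENNReal.ofReal (S ω) := by
    intro ω
    refine le_antisymm (Finset.sup_le fun k hk => ?_) ?_
    · rw [← ofReal_norm]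
      exact ENNReal.ofReal_le_ofReal (Finset.le_sup' (fun k => ‖M k ω‖) hk)
    · obtain ⟨k, hk, hk'⟩ := Finset.exists_mem_eq_sup' Finset.nonempty_range_add_one
        (s := Finset.range (n + 1)) (fun k => ‖M k ω‖)
      simp only [hS]
      rw [hk', ofReal_norm]
      exact Finset.le_sup (f := fun k => ‖M k ω‖ₑ) hk
  simp_rw [hSe]
  set X := ∫⁻ ω, ENNReal.ofReal (S ω) ^ p ∂P with hX
  set Y := ∫⁻ ω, ‖M n ω‖ₑ ^ p ∂P with hY
  have hXfin : X < ∞ := by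
    calc X ≤ ∫⁻ ω, ∑ k ∈ Finset.range (n + 1), ‖M k ω‖ₑ ^ p ∂P := by
          refine lintegral_mono fun ω => ?_
          obtain ⟨k, hk, hk'⟩ := Finset.exists_mem_eq_sup' Finset.nonempty_range_add_one
            (s := Finset.range (n + 1)) (fun k => ‖M k ω‖)
          simp only [hS]
          rw [hk', ofReal_norm]
          exact Finset.single_le_sum (f := fun k => ‖M k ω‖ₑ ^ p) (fun _ _ => zero_le) hk
      _ = ∑ k ∈ Finset.range (n + 1), ∫⁻ ω, ‖M k ω‖ₑ ^ p ∂P := by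
          refine lintegral_finsetSum _ fun k _ => ?_
          exact (((hM.1 k).mono (𝓖.le k)).enorm).pow_const p
      _ < ∞ := by
          refine ENNReal.sum_lt_top.2 fun k hk => hfin k ?_
          simpa [Nat.lt_succ_iff] using hk
  -- the weak type bound, with the right-hand side seen as a measure of `{t ≤ S}`
  set Q := P.withDensity fun ω => ‖M n ω‖ₑ with hQ
  have hweak : ∀ t : ℝ, 0 < t → P {ω | t ≤ S ω} * ENNReal.ofReal t ≤ Q {ω | t ≤ S ω} := by
    intro t ht
    have h := maximal_ineq hsub (fun k ω => norm_nonneg _) (ε := t.toNNReal) n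
    rw [Real.coe_toNNReal t ht.le] at h
    rw [mul_comm, hQ, withDensity_apply _ (measurableSet_le measurable_const hSm)]
    refine h.trans_eq ?_
    rw [ofReal_integral_eq_lintegral_ofReal (hM.integrable n).norm.integrableOn
      (ae_of_all _ fun ω => norm_nonneg _)]
    simp_rw [ofReal_norm]
    rfl
  have hmain : X ≤ ENNReal.ofReal (p / (p - 1)) *
      ∫⁻ ω, ENNReal.ofReal (S ω) ^ (p - 1) * ‖M n ω‖ₑ ∂P := by
    have e1 : X = ∫⁻ ω, ENNReal.ofReal (S ω ^ p) ∂P := by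
      simp_rw [hX, ENNReal.ofReal_rpow_of_nonneg (hS0 _) hp0.le]
    have e2 : ∫⁻ ω, ENNReal.ofReal (S ω) ^ (p - 1) * ‖M n ω‖ₑ ∂P
        = ∫⁻ ω, ENNReal.ofReal (S ω ^ (p - 1)) ∂Q := by
      rw [hQ, lintegral_withDensity_eq_lintegral_mul _ ((hM.1 n).mono (𝓖.le n)).enorm
        (by fun_prop)]
      refine lintegral_congr fun ω => ?_
      rw [Pi.mul_apply, mul_comm, ENNReal.ofReal_rpow_of_nonneg (hS0 _) (by linarith)]
    rw [e1, e2, lintegral_rpow_eq_lintegral_meas_le_mul P (ae_of_all _ hS0) hSm.aemeasurable hp0,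
      lintegral_rpow_eq_lintegral_meas_le_mul Q (ae_of_all _ hS0) hSm.aemeasurable
        (by linarith : 0 < p - 1), ← mul_assoc, ← ENNReal.ofReal_mul (by
          have : 0 < p - 1 := by linarith
          positivity), div_mul_cancel₀ _ (by linarith : p - 1 ≠ 0)]
    refine mul_le_mul' le_rfl ?_
    refine setLIntegral_mono' measurableSet_Ioi fun t ht => ?_
    have ht : 0 < t := ht
    calc P {ω | t ≤ S ω} * ENNReal.ofReal (t ^ (p - 1))
        = P {ω | t ≤ S ω} * ENNReal.ofReal t * ENNReal.ofReal (t ^ (p - 1 - 1)) := by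
          rw [mul_assoc, ← ENNReal.ofReal_mul ht.le]
          congr 2
          rw [Real.rpow_sub_one ht.ne' (p - 1)]
          field_simp
      _ ≤ _ := by gcongr; exact hweak t ht
  have hconj : (p / (p - 1)).HolderConjugate p := (Real.HolderConjugate.conjExponent hp).symm
  have hH := ENNReal.lintegral_mul_le_Lp_mul_Lq P hconj
    (f := fun ω => ENNReal.ofReal (S ω) ^ (p - 1)) (g := fun ω => ‖M n ω‖ₑ)
    (by fun_prop) ((hM.1 n).mono (𝓖.le n)).enorm.aemeasurable
  have hp1 : p - 1 ≠ 0 := by linarith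
  have e3 : ∀ ω, (ENNReal.ofReal (S ω) ^ (p - 1)) ^ (p / (p - 1)) = ENNReal.ofReal (S ω) ^ p := by
    intro ω
    rw [← ENNReal.rpow_mul]
    congr 1
    field_simp
  simp_rw [e3] at hH
  have hfinal : X ≤ ENNReal.ofReal (p / (p - 1)) * (X ^ (1 / (p / (p - 1))) * Y ^ (1 / p)) :=
    hmain.trans (by gcongr; exact hH)
  -- divide by `X ^ (1 / p')`, where `p'` is the conjugate exponent; here `X < ∞` is needed
  rcases eq_or_ne X 0 with h0 | h0
  · rw [h0]; exact zero_le
  have e4 : X = X ^ (1 / p) * X ^ (1 / (p / (p - 1))) := by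
    rw [← ENNReal.rpow_add _ _ h0 hXfin.ne]
    have : 1 / p + 1 / (p / (p - 1)) = 1 := by field_simp; ring
    rw [this, ENNReal.rpow_one]
  have hne0 : X ^ (1 / (p / (p - 1))) ≠ 0 := by
    simp [ENNReal.rpow_eq_zero_iff, h0, hXfin.ne]
  have hnet : X ^ (1 / (p / (p - 1))) ≠ ∞ :=
    ENNReal.rpow_ne_top_of_nonneg (by have : 0 < p - 1 := by linarith
                                      positivity) hXfin.ne
  have h5 : X ^ (1 / p) ≤ ENNReal.ofReal (p / (p - 1)) * Y ^ (1 / p) := by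
    rw [← ENNReal.mul_le_mul_iff_left hne0 hnet]
    calc X ^ (1 / p) * X ^ (1 / (p / (p - 1))) = X := e4.symm
      _ ≤ _ := hfinal
      _ = _ := by ring
  calc X = (X ^ (1 / p)) ^ p := by
        rw [← ENNReal.rpow_mul, one_div, inv_mul_cancel₀ hp0.ne', ENNReal.rpow_one]
    _ ≤ (ENNReal.ofReal (p / (p - 1)) * Y ^ (1 / p)) ^ p := by gcongr
    _ = _ := by
        rw [ENNReal.mul_rpow_of_nonneg _ _ hp0.le, ← ENNReal.rpow_mul, one_div,
          inv_mul_cancel₀ hp0.ne', ENNReal.rpow_one]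

/-- Partial sums of a sequence of adapted increments with vanishing conditional expectations form
a martingale. -/
theorem martingale_sum_range [IsFiniteMeasure P] {D : ℕ → Ω → E}
    (hD : ∀ k, StronglyMeasurable[𝓖 (k + 1)] (D k)) (hint : ∀ k, Integrable (D k) P)
    (h0 : ∀ k, P[D k | 𝓖 k] =ᵐ[P] 0) :
    Martingale (fun n ω => ∑ k ∈ Finset.range n, D k ω) 𝓖 P := by
  refine martingale_of_condExp_sub_eq_zero_nat (fun n => ?_) (fun n => ?_) fun n => ?_
  · refine Finset.stronglyMeasurable_fun_sum _ fun k hk => (hD k).mono (𝓖.mono ?_)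
    exact Finset.mem_range.1 hk
  · exact integrable_finsetSum _ fun k _ => hint k
  · have : ((fun n ω => ∑ k ∈ Finset.range n, D k ω) : ℕ → Ω → E) (n + 1) -
        (fun n ω => ∑ k ∈ Finset.range n, D k ω : ℕ → Ω → E) n = D n := by
      ext ω
      simp [Finset.sum_range_succ]
    rw [this]
    exact h0 n

end Discrete

/-- `L` is a constant for which every `E`-valued martingale `∑_{k < n} D k` starting at `0`
satisfies `𝔼 |∑_{k < n} D k|^p ≤ L ∑_{k < n} 𝔼 |D k|^p`. -/
def MartingaleIncrementBound (E : Type u) [NormedAddCommGroup E] [NormedSpace ℝ E]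
    [CompleteSpace E] (p : ℝ) (L : ℝ≥0) : Prop :=
  ∀ (Ω : Type w) [mΩ : MeasurableSpace Ω] (P : Measure Ω) [IsProbabilityMeasure P]
    (𝓖 : Filtration ℕ mΩ) (D : ℕ → Ω → E),
    (∀ k, StronglyMeasurable[𝓖 (k + 1)] (D k)) → (∀ k, Integrable (D k) P) →
    (∀ k, P[D k | 𝓖 k] =ᵐ[P] 0) → ∀ n,
    ∫⁻ ω, ‖∑ k ∈ Finset.range n, D k ω‖ₑ ^ p ∂P ≤
      L * ∑ k ∈ Finset.range n, ∫⁻ ω, ‖D k ω‖ₑ ^ p ∂P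

/-- Martingales that start at `0` need no term for their initial value. -/
theorem HasMartingaleType.exists_martingaleIncrementBound {E : Type u} [NormedAddCommGroup E]
    [NormedSpace ℝ E] [CompleteSpace E] {p : ℝ} (hp : 0 < p) (hE : HasMartingaleType.{u, w} E p) :
    ∃ L : ℝ≥0, MartingaleIncrementBound.{u, w} E p L := by
  obtain ⟨L, hL, h⟩ := hE
  refine ⟨L, fun Ω mΩ P hP 𝓖 D hD hint h0 n => ?_⟩
  have := h Ω mΩ P hP 𝓖 _ (martingale_sum_range hD hint h0) n n le_rfl
  simpa [Finset.sum_range_succ, ENNReal.zero_rpow_of_pos hp] using this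

/-! ### Poisson random measures of product sets -/

theorem measurableEmbedding_nnreal_coe : MeasurableEmbedding ((↑) : ℝ≥0 → ℝ) :=
  MeasurableEmbedding.subtype_coe measurableSet_Ici

theorem lebesgueNN_Ioc (s t : ℝ≥0) : lebesgueNN (Set.Ioc s t) = ((t - s : ℝ≥0) : ℝ≥0∞) := by
  rw [lebesgueNN, measurableEmbedding_nnreal_coe.comap_apply]
  have : ((↑) : ℝ≥0 → ℝ) '' Set.Ioc s t = Set.Ioc (s : ℝ) t := by
    ext x
    constructor
    · rintro ⟨y, hy, rfl⟩
      exact ⟨NNReal.coe_lt_coe.2 hy.1, NNReal.coe_le_coe.2 hy.2⟩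
    · intro hx
      exact ⟨⟨x, s.2.trans hx.1.le⟩, ⟨hx.1, hx.2⟩, rfl⟩
  rw [this, Real.volume_Ioc, ENNReal.ofReal, NNReal.sub_def]

instance : SigmaFinite lebesgueNN := by
  refine ⟨⟨⟨fun n : ℕ => Set.Iic n, fun n => trivial, fun n => ?_, ?_⟩⟩⟩
  · have h : Set.Iic (n : ℝ≥0) ⊆ ((↑) : ℝ≥0 → ℝ) ⁻¹' Set.Icc 0 n := fun x hx =>
      ⟨x.2, by exact_mod_cast hx⟩
    refine (measure_mono h).trans_lt ?_
    rw [lebesgueNN, measurableEmbedding_nnreal_coe.comap_apply]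
    refine (measure_mono (Set.image_preimage_subset _ _)).trans_lt ?_
    simp
  · refine Set.eq_univ_of_forall fun x => Set.mem_iUnion.2 ?_
    exact exists_nat_ge x

/-- The second factorial moment of the Poisson distribution. -/
theorem lintegral_extPoisson_factorial (m : ℝ≥0) :
    ∫⁻ x, x * (x - 1) ∂(extPoisson m) = (m : ℝ≥0∞) ^ 2 := by
  have hmeas : Measurable fun x : ℝ≥0∞ => x * (x - 1) := by fun_prop
  rw [extPoisson, if_neg ENNReal.coe_ne_top, lintegral_map hmeas .of_discrete,
    ENNReal.toNNReal_coe, lintegral_countable']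
  rw [tsum_eq_zero_add' ENNReal.summable, tsum_eq_zero_add' ENNReal.summable]
  simp only [poissonMeasure_singleton]
  have key : ∀ n : ℕ, ((n + 1 + 1 : ℕ) : ℝ≥0∞) * (((n + 1 + 1 : ℕ) : ℝ≥0∞) - 1) *
      ENNReal.ofReal (Real.exp (-m) * (m : ℝ) ^ (n + 1 + 1) / (n + 1 + 1).factorial) =
      (m : ℝ≥0∞) ^ 2 * ENNReal.ofReal (Real.exp (-m) * (m : ℝ) ^ n / n.factorial) := by
    intro n
    have e1 : (((n + 1 + 1 : ℕ) : ℝ≥0∞) - 1) = ((n + 1 : ℕ) : ℝ≥0∞) := by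
      push_cast
      exact ENNReal.add_sub_cancel_right ENNReal.one_ne_top
    rw [e1, ← ENNReal.ofReal_natCast, ← ENNReal.ofReal_natCast, ← ENNReal.ofReal_coe_nnreal,
      ← ENNReal.ofReal_pow (by positivity), ← ENNReal.ofReal_mul (by positivity),
      ← ENNReal.ofReal_mul (by positivity), ← ENNReal.ofReal_mul (by positivity)]
    congr 1
    rw [Nat.factorial_succ, Nat.factorial_succ]
    push_cast
    field_simp
    ring
  rw [tsum_congr key, ENNReal.tsum_mul_left]
  rw [← ENNReal.ofReal_tsum_of_nonneg (fun n => by positivity)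
    (hasSum_one_poissonMeasure m).summable, (hasSum_one_poissonMeasure m).tsum_eq]
  simp

section

variable {S : Type*} [MeasurableSpace S] {Ω : Type*} [mΩ : MeasurableSpace Ω]

/-- The compensated Poisson process `t ↦ η(B × (0, t]) - t ν(B)` of a set `B` with `ν(B) < ∞`. -/
noncomputable def compPoisson (ν : Measure S) (η : Ω → Measure (S × ℝ≥0)) (B : Set S) (t : ℝ≥0)
    (ω : Ω) : ℝ :=
  (η ω (B ×ˢ Set.Ioc 0 t)).toReal - t * (ν B).toReal

namespace IsPoissonRandomMeasure

variable {𝓕 : Filtration ℝ≥0 mΩ} {P : Measure Ω} {ν : Measure S}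
  {η : Ω → Measure (S × ℝ≥0)} {B : Set S}

theorem lintegral_Ioc (H : IsPoissonRandomMeasure 𝓕 P ν η) (hB : MeasurableSet B) (s t : ℝ≥0) :
    ∫⁻ ω, η ω (B ×ˢ Set.Ioc s t) ∂P = ν B * ((t - s : ℝ≥0) : ℝ≥0∞) := by
  rw [H.intensity B _ hB measurableSet_Ioc, lebesgueNN_Ioc]

theorem measurable_Ioc (H : IsPoissonRandomMeasure 𝓕 P ν η) (hB : MeasurableSet B) (s t : ℝ≥0) :
    Measurable fun ω => η ω (B ×ˢ Set.Ioc s t) :=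
  H.measurable_eval _ (hB.prod measurableSet_Ioc)

theorem ae_lt_top (H : IsPoissonRandomMeasure 𝓕 P ν η) (hB : MeasurableSet B) (hν : ν B ≠ ∞) :
    ∀ᵐ ω ∂P, ∀ t : ℝ≥0, η ω (B ×ˢ Set.Ioc 0 t) < ∞ := by
  have : ∀ n : ℕ, ∀ᵐ ω ∂P, η ω (B ×ˢ Set.Ioc 0 (n : ℝ≥0)) < ∞ := fun n => by
    refine MeasureTheory.ae_lt_top (H.measurable_Ioc hB _ _) ?_
    rw [H.lintegral_Ioc hB]
    exact ENNReal.mul_ne_top hν ENNReal.coe_ne_top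
  filter_upwards [ae_all_iff.2 this] with ω hω t
  obtain ⟨n, hn⟩ := exists_nat_ge t
  exact (measure_mono (Set.prod_mono_right (Set.Ioc_subset_Ioc_right hn))).trans_lt (hω n)

/-- Outside a null set, increments of compensated Poisson processes are compensated values of `η`.
On the null set where `η(B × (0, t])` may be infinite, `toReal` gives meaningless values. -/
theorem compPoisson_sub_ae (H : IsPoissonRandomMeasure 𝓕 P ν η) (hB : MeasurableSet B)
    (hν : ν B ≠ ∞) : ∀ᵐ ω ∂P, ∀ s t : ℝ≥0, s ≤ t →
    compPoisson ν η B t ω - compPoisson ν η B s ω =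
      (η ω (B ×ˢ Set.Ioc s t)).toReal - (t - s) * (ν B).toReal := by
  filter_upwards [H.ae_lt_top hB hν] with ω hω s t hst
  have hu : B ×ˢ Set.Ioc 0 t = B ×ˢ Set.Ioc 0 s ∪ B ×ˢ Set.Ioc s t := by
    rw [← Set.prod_union, Set.Ioc_union_Ioc_eq_Ioc zero_le hst]
  have hd : Disjoint (B ×ˢ Set.Ioc 0 s) (B ×ˢ Set.Ioc s t) :=
    Set.disjoint_prod.2 (Or.inr (Set.Ioc_disjoint_Ioc_of_le le_rfl))
  have hfin : η ω (B ×ˢ Set.Ioc s t) ≠ ∞ :=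
    ((measure_mono (Set.prod_mono_right (Set.Ioc_subset_Ioc_left zero_le))).trans_lt (hω t)).ne
  rw [compPoisson, compPoisson, hu, measure_union hd (hB.prod measurableSet_Ioc),
    ENNReal.toReal_add (hω s).ne hfin]
  ring

theorem measurable_compPoisson (H : IsPoissonRandomMeasure 𝓕 P ν η) (hB : MeasurableSet B)
    (t : ℝ≥0) : Measurable[𝓕 t] (compPoisson ν η B t) :=
  (H.adapted B hB t).ennreal_toReal.sub_const _

theorem integrable_Ioc (H : IsPoissonRandomMeasure 𝓕 P ν η) (hB : MeasurableSet B)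
    (hν : ν B ≠ ∞) (s t : ℝ≥0) :
    Integrable (fun ω => (η ω (B ×ˢ Set.Ioc s t)).toReal) P := by
  refine integrable_toReal_of_lintegral_ne_top (H.measurable_Ioc hB s t).aemeasurable ?_
  rw [H.lintegral_Ioc hB]
  exact ENNReal.mul_ne_top hν ENNReal.coe_ne_top

theorem integrable_compPoisson [IsProbabilityMeasure P]
    (H : IsPoissonRandomMeasure 𝓕 P ν η) (hB : MeasurableSet B)
    (hν : ν B ≠ ∞) (t : ℝ≥0) : Integrable (compPoisson ν η B t) P :=
  (H.integrable_Ioc hB hν 0 t).sub (integrable_const _)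

/-- The compensated Poisson process has centred increments, given the past. -/
theorem condExp_compPoisson_sub [IsProbabilityMeasure P]
    (H : IsPoissonRandomMeasure 𝓕 P ν η) (hB : MeasurableSet B)
    (hν : ν B ≠ ∞) {s t : ℝ≥0} (hst : s ≤ t) :
    P[fun ω => compPoisson ν η B t ω - compPoisson ν η B s ω | 𝓕 s] =ᵐ[P] 0 := by
  rcases hst.eq_or_lt with rfl | hlt
  · simp only [sub_self]
    exact (condExp_zero).eventuallyEq
  have h1 : (fun ω => compPoisson ν η B t ω - compPoisson ν η B s ω) =ᵐ[P]
      (fun ω => (η ω (B ×ˢ Set.Ioc s t)).toReal) - fun _ => (t - s) * (ν B).toReal := by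
    filter_upwards [H.compPoisson_sub_ae hB hν] with ω hω using hω s t hst
  have h2 : P[fun ω => (η ω (B ×ˢ Set.Ioc s t)).toReal | 𝓕 s] =ᵐ[P]
      fun _ => ∫ ω, (η ω (B ×ˢ Set.Ioc s t)).toReal ∂P := by
    refine condExp_indep_eq (H.measurable_Ioc hB s t).comap_le (𝓕.le s) ?_
      (H.indep_past B hB s t hlt)
    exact (Measurable.ennreal_toReal (comap_measurable _)).stronglyMeasurable
  have h3 : ∫ ω, (η ω (B ×ˢ Set.Ioc s t)).toReal ∂P = (t - s) * (ν B).toReal := by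
    rw [integral_toReal (H.measurable_Ioc hB s t).aemeasurable, H.lintegral_Ioc hB,
      ENNReal.toReal_mul, ENNReal.coe_toReal, NNReal.coe_sub hst, mul_comm]
    filter_upwards [H.ae_lt_top hB hν] with ω hω
    exact (measure_mono (Set.prod_mono_right (Set.Ioc_subset_Ioc_left zero_le))).trans_lt (hω t)
  refine (condExp_congr_ae h1).trans ((condExp_sub (H.integrable_Ioc hB hν s t)
    (integrable_const _) _).trans ?_)
  filter_upwards [h2] with ω hω
  rw [Pi.sub_apply, hω, condExp_const (𝓕.le s), h3]
  simp

/-- Independence of the past, for nonnegative integrands. -/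
theorem lintegral_mul_Ioc (H : IsPoissonRandomMeasure 𝓕 P ν η) (hB : MeasurableSet B)
    {s t : ℝ≥0} (hst : s ≤ t) {g : Ω → ℝ≥0∞} (hg : Measurable[𝓕 s] g) :
    ∫⁻ ω, η ω (B ×ˢ Set.Ioc s t) * g ω ∂P =
      ν B * ((t - s : ℝ≥0) : ℝ≥0∞) * ∫⁻ ω, g ω ∂P := by
  rcases hst.eq_or_lt with rfl | hlt
  · simp
  rw [← H.lintegral_Ioc hB]
  exact lintegral_mul_eq_lintegral_mul_lintegral_of_independent_measurableSpace
    (H.measurable_Ioc hB s t).comap_le (𝓕.le s) (H.indep_past B hB s t hlt)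
    (comap_measurable _) hg

/-- The second factorial moment of `η(B × (s, t])` is of second order in `t - s`. -/
theorem lintegral_factorial_Ioc (H : IsPoissonRandomMeasure 𝓕 P ν η) (hB : MeasurableSet B)
    (hν : ν B ≠ ∞) (s t : ℝ≥0) :
    ∫⁻ ω, η ω (B ×ˢ Set.Ioc s t) * (η ω (B ×ˢ Set.Ioc s t) - 1) ∂P =
      (ν B * ((t - s : ℝ≥0) : ℝ≥0∞)) ^ 2 := by
  have hl := H.law _ (hB.prod (measurableSet_Ioc (a := s) (b := t)))
  rw [H.lintegral_Ioc hB] at hl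
  obtain ⟨m, hm⟩ : ∃ m : ℝ≥0, (m : ℝ≥0∞) = ν B * ((t - s : ℝ≥0) : ℝ≥0∞) :=
    ⟨_, ENNReal.coe_toNNReal (ENNReal.mul_ne_top hν ENNReal.coe_ne_top)⟩
  rw [← hm] at hl ⊢
  rw [← lintegral_extPoisson_factorial, ← hl,
    lintegral_map (by fun_prop) (H.measurable_Ioc hB s t)]

theorem ae_isCadlagPath_compPoisson (H : IsPoissonRandomMeasure 𝓕 P ν η) (hB : MeasurableSet B)
    (hν : ν B ≠ ∞) : ∀ᵐ ω ∂P, IsCadlagPath fun t => compPoisson ν η B t ω := by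
  filter_upwards [H.ae_lt_top hB hν] with ω hω t
  have hlin : Continuous fun t : ℝ≥0 => (t : ℝ) * (ν B).toReal := by fun_prop
  constructor
  · refine ContinuousWithinAt.sub ?_ hlin.continuousWithinAt
    rw [← continuousWithinAt_Ioi_iff_Ici]
    have h := tendsto_measure_biInter_gt (μ := η ω) (s := fun r : ℝ≥0 => B ×ˢ Set.Ioc 0 r) (a := t)
      (fun r _ => (hB.prod measurableSet_Ioc).nullMeasurableSet)
      (fun i j _ hij => Set.prod_mono_right (Set.Ioc_subset_Ioc_right hij))
      ⟨t + 1, by simp, (hω _).ne⟩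
    have hI : ⋂ r, ⋂ (_ : r > t), B ×ˢ Set.Ioc 0 r = B ×ˢ Set.Ioc 0 t := by
      ext ⟨x, r⟩
      simp only [Set.mem_iInter, Set.mem_prod, Set.mem_Ioc]
      constructor
      · intro hr
        refine ⟨(hr (t + 1) (by simp)).1, (hr (t + 1) (by simp)).2.1, ?_⟩
        exact le_of_forall_gt_imp_ge_of_dense fun a ha => (hr a ha).2.2
      · intro hr a ha
        exact ⟨hr.1, hr.2.1, hr.2.2.trans (le_of_lt ha)⟩
    rw [hI] at h
    exact (ENNReal.tendsto_toReal (hω t).ne).comp h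
  · have hmono : Monotone fun t : ℝ≥0 => (η ω (B ×ˢ Set.Ioc 0 t)).toReal := fun s t hst =>
      ENNReal.toReal_mono (hω t).ne
        (measure_mono (Set.prod_mono_right (Set.Ioc_subset_Ioc_right hst)))
    exact ⟨_, (hmono.tendsto_leftLim t).sub (hlin.continuousWithinAt.tendsto)⟩

end IsPoissonRandomMeasure

end

/-! ### One increment of the integral of a simple function -/

/-- For integer weights the inequality `‖∑ n b • x b‖ ^ p ≤ ∑ n b * ‖x b‖ ^ p` can fail only if the
total weight `N` is at least two; the error is then controlled by `N (N - 1)`, whose mean is of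
second order for Poisson variables.  No independence of the weights enters. -/
theorem enorm_sum_natCast_smul_rpow_le {E ι : Type*} [NormedAddCommGroup E] [NormedSpace ℝ E]
    [Fintype ι] (n : ι → ℕ) (x : ι → E) {K : ℝ≥0∞} (hx : ∀ b, ‖x b‖ₑ ≤ K) {p : ℝ} (hp : 1 ≤ p)
    (hp2 : p ≤ 2) :
    ‖∑ b, (n b : ℝ) • x b‖ₑ ^ p ≤ ∑ b, (n b : ℝ≥0∞) * ‖x b‖ₑ ^ p +
      K ^ p * (2 * ((∑ b, (n b : ℝ≥0∞)) * (∑ b, (n b : ℝ≥0∞) - 1))) := by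
  have hp0 : 0 < p := by linarith
  have hN : ∑ b, (n b : ℝ≥0∞) = ((∑ b, n b : ℕ) : ℝ≥0∞) := by push_cast; rfl
  rw [hN]
  obtain h0 | h1 | h2 : ∑ b, n b = 0 ∨ ∑ b, n b = 1 ∨ 2 ≤ ∑ b, n b := by lia
  · have : ∀ b, n b = 0 := by simpa using h0
    simp [this, ENNReal.zero_rpow_of_pos hp0]
  · classical
    obtain ⟨b, hb, hb'⟩ : ∃ b, n b = 1 ∧ ∀ c ∈ Finset.univ, b ≠ c → n c = 0 := by
      obtain ⟨b, -, hb⟩ := Finset.exists_ne_zero_of_sum_ne_zero (by lia : ∑ b, n b ≠ 0)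
      have h2 := Finset.add_sum_erase Finset.univ n (Finset.mem_univ b)
      refine ⟨b, by lia, fun c hc hbc => ?_⟩
      have h3 := Finset.single_le_sum (f := n) (fun _ _ => Nat.zero_le _)
        (Finset.mem_erase.2 ⟨hbc.symm, hc⟩)
      lia
    refine le_trans (le_of_eq ?_) le_self_add
    rw [Finset.sum_eq_single b (fun c hc hcb => by simp [hb' c hc hcb.symm]) (by simp),
      Finset.sum_eq_single b (fun c hc hcb => by simp [hb' c hc hcb.symm]) (by simp), hb]
    simp
  · refine le_trans ?_ le_add_self
    obtain ⟨m, hm⟩ : ∃ m, ∑ b, n b = m + 1 := ⟨_, (Nat.sub_add_cancel (by lia)).symm⟩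
    calc ‖∑ b, (n b : ℝ) • x b‖ₑ ^ p ≤ (((∑ b, n b : ℕ) : ℝ≥0∞) * K) ^ p := by
          gcongr
          calc ‖∑ b, (n b : ℝ) • x b‖ₑ ≤ ∑ b, ‖(n b : ℝ) • x b‖ₑ := enorm_sum_le _ _
            _ ≤ ∑ b, (n b : ℝ≥0∞) * K := by
                gcongr with b
                rw [enorm_smul]
                gcongr
                · simp
                · exact hx b
            _ = _ := by rw [← Finset.sum_mul, hN]
      _ = K ^ p * ((∑ b, n b : ℕ) : ℝ≥0∞) ^ p := by
          rw [ENNReal.mul_rpow_of_nonneg _ _ hp0.le, mul_comm]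
      _ ≤ K ^ p * ((∑ b, n b : ℕ) : ℝ≥0∞) ^ (2 : ℝ) := by
          gcongr
          exact_mod_cast (by lia : 1 ≤ ∑ b, n b)
      _ ≤ _ := by
          gcongr
          rw [ENNReal.rpow_two, hm]
          have e1 : (((m + 1 : ℕ) : ℝ≥0∞) - 1) = (m : ℝ≥0∞) := by
            push_cast
            exact ENNReal.add_sub_cancel_right ENNReal.one_ne_top
          rw [e1]
          have : 1 ≤ m := by lia
          exact_mod_cast (by nlinarith : (m + 1) ^ 2 ≤ 2 * ((m + 1) * m))

section

variable {S : Type*} [MeasurableSpace S] {Ω : Type*} [mΩ : MeasurableSpace Ω]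
  {E : Type*} [NormedAddCommGroup E] [NormedSpace ℝ E] {ι : Type*} [Fintype ι]

/-- The increment over `(s, t]` of the compensated integral of the simple function
`∑ b, 1_{B b} f b` on `S` with random coefficients. -/
noncomputable def simpleIncrement (ν : Measure S) (η : Ω → Measure (S × ℝ≥0)) (B : ι → Set S)
    (f : ι → Ω → E) (s t : ℝ≥0) (ω : Ω) : E :=
  ∑ b, (compPoisson ν η (B b) t ω - compPoisson ν η (B b) s ω) • f b ω

namespace IsPoissonRandomMeasure

variable {𝓕 : Filtration ℝ≥0 mΩ} {P : Measure Ω} {ν : Measure S}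
  {η : Ω → Measure (S × ℝ≥0)} {B : ι → Set S} {f : ι → Ω → E} {r s t : ℝ≥0}

theorem stronglyMeasurable_simpleIncrement (H : IsPoissonRandomMeasure 𝓕 P ν η)
    (hB : ∀ b, MeasurableSet (B b)) (hst : s ≤ t) (hf : ∀ b, StronglyMeasurable[𝓕 t] (f b)) :
    StronglyMeasurable[𝓕 t] (simpleIncrement ν η B f s t) := by
  refine Finset.stronglyMeasurable_fun_sum _ fun b _ => StronglyMeasurable.smul ?_ (hf b)
  exact ((H.measurable_compPoisson (hB b) t).sub
    ((H.measurable_compPoisson (hB b) s).mono (𝓕.mono hst) le_rfl)).stronglyMeasurable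

theorem integrable_simpleIncrement [IsProbabilityMeasure P] (H : IsPoissonRandomMeasure 𝓕 P ν η)
    (hB : ∀ b, MeasurableSet (B b)) (hν : ∀ b, ν (B b) ≠ ∞)
    (hf : ∀ b, AEStronglyMeasurable (f b) P) {K : ℝ≥0} (hK : ∀ b ω, ‖f b ω‖ ≤ K) (s t : ℝ≥0) :
    Integrable (simpleIncrement ν η B f s t) P := by
  refine integrable_finsetSum _ fun b _ => ?_
  exact ((H.integrable_compPoisson (hB b) (hν b) t).sub
    (H.integrable_compPoisson (hB b) (hν b) s)).smul_bdd (K : ℝ) (hf b) (ae_of_all _ (hK b))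

theorem condExp_simpleIncrement [CompleteSpace E] [IsProbabilityMeasure P]
    (H : IsPoissonRandomMeasure 𝓕 P ν η)
    (hB : ∀ b, MeasurableSet (B b)) (hν : ∀ b, ν (B b) ≠ ∞) (hst : s ≤ t)
    (hf : ∀ b, StronglyMeasurable[𝓕 s] (f b)) {K : ℝ≥0} (hK : ∀ b ω, ‖f b ω‖ ≤ K) :
    P[simpleIncrement ν η B f s t | 𝓕 s] =ᵐ[P] 0 := by
  have hint : ∀ b, Integrable (fun ω => compPoisson ν η (B b) t ω - compPoisson ν η (B b) s ω) P :=
    fun b => (H.integrable_compPoisson (hB b) (hν b) t).sub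
      (H.integrable_compPoisson (hB b) (hν b) s)
  have hint' : ∀ b, Integrable
      ((fun ω => compPoisson ν η (B b) t ω - compPoisson ν η (B b) s ω) • f b) P := fun b =>
    (hint b).smul_bdd (K : ℝ) ((hf b).mono (𝓕.le s)).aestronglyMeasurable (ae_of_all _ (hK b))
  have e : simpleIncrement ν η B f s t =
      ∑ b, (fun ω => compPoisson ν η (B b) t ω - compPoisson ν η (B b) s ω) • f b := by
    ext ω
    simp [simpleIncrement]
  rw [e]
  refine (condExp_finsetSum (fun b _ => hint' b) _).trans ?_
  have hb : ∀ b, P[(fun ω => compPoisson ν η (B b) t ω - compPoisson ν η (B b) s ω) • f b | 𝓕 s]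
      =ᵐ[P] 0 := fun b => by
    refine (condExp_smul_of_aestronglyMeasurable_right (hint b) (hint' b)
      (hf b).aestronglyMeasurable).trans ?_
    filter_upwards [H.condExp_compPoisson_sub (hB b) (hν b) hst] with ω hω
    simp [hω]
  filter_upwards [ae_all_iff.2 hb] with ω hω
  simp [hω]

/-- A bound for the `p`-th moment of one increment, sharp up to terms of higher order in the
length `t - s` of the time interval. -/
theorem lintegral_simpleIncrement_rpow_le_add (H : IsPoissonRandomMeasure 𝓕 P ν η)
    [IsProbabilityMeasure P]
    (hB : ∀ b, MeasurableSet (B b)) (hν : ∀ b, ν (B b) ≠ ∞)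
    (hd : Pairwise (Function.onFun Disjoint B))
    (hst : s ≤ t) (hf : ∀ b, StronglyMeasurable[𝓕 s] (f b)) {K : ℝ≥0} (hK : ∀ b ω, ‖f b ω‖ ≤ K)
    {p : ℝ} (hp : 1 ≤ p) (hp2 : p ≤ 2) :
    ∫⁻ ω, ‖simpleIncrement ν η B f s t ω‖ₑ ^ p ∂P ≤ 2 ^ (p - 1) *
      (((t - s : ℝ≥0) : ℝ≥0∞) * ∑ b, ν (B b) * ∫⁻ ω, ‖f b ω‖ₑ ^ p ∂P +
        (K : ℝ≥0∞) ^ p * (2 * ((∑ b, ν (B b)) * ((t - s : ℝ≥0) : ℝ≥0∞)) ^ 2) +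
        (K * (∑ b, ν (B b)) * ((t - s : ℝ≥0) : ℝ≥0∞)) ^ p) := by
  have hp0 : 0 < p := by linarith
  have hKe : ∀ b ω, ‖f b ω‖ₑ ≤ K := fun b ω => by
    rw [enorm_eq_nnnorm]; exact_mod_cast hK b ω
  set N : Ω → ℝ≥0∞ := fun ω => η ω ((⋃ b, B b) ×ˢ Set.Ioc s t) with hN
  have hU : ν (⋃ b, B b) = ∑ b, ν (B b) := by rw [measure_iUnion hd hB, tsum_fintype]
  have hNs : ∀ ω, N ω = ∑ b, η ω (B b ×ˢ Set.Ioc s t) := fun ω => by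
    simp only [hN]
    rw [Set.iUnion_prod_const, measure_iUnion _ (fun b => (hB b).prod measurableSet_Ioc),
      tsum_fintype]
    intro a b hab
    exact Set.disjoint_prod.2 (Or.inl (hd hab))
  have hNm : Measurable N := H.measurable_Ioc (.iUnion hB) s t
  have hfm : ∀ b, Measurable[𝓕 s] fun ω => ‖f b ω‖ₑ ^ p := fun b => (hf b).enorm.pow_const p
  have hpt : ∀ᵐ ω ∂P, ‖simpleIncrement ν η B f s t ω‖ₑ ^ p ≤ 2 ^ (p - 1) *
      (∑ b, η ω (B b ×ˢ Set.Ioc s t) * ‖f b ω‖ₑ ^ p +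
        (K : ℝ≥0∞) ^ p * (2 * (N ω * (N ω - 1))) +
        (K * (∑ b, ν (B b)) * ((t - s : ℝ≥0) : ℝ≥0∞)) ^ p) := by
    filter_upwards [ae_all_iff.2 fun b => H.compPoisson_sub_ae (hB b) (hν b),
      ae_all_iff.2 fun b => H.ae_lt_top (hB b) (hν b)] with ω h1 h2
    have hn : ∀ b, ∃ n : ℕ, η ω (B b ×ˢ Set.Ioc s t) = n := fun b => by
      obtain ⟨n, hn⟩ := H.integerValued ω _ ((hB b).prod (measurableSet_Ioc (a := s) (b := t)))
      have hfin : η ω (B b ×ˢ Set.Ioc s t) < ∞ :=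
        (measure_mono (Set.prod_mono_right (Set.Ioc_subset_Ioc_left zero_le))).trans_lt (h2 b t)
      have hn' : n ≠ ⊤ := by
        rintro rfl
        rw [hn] at hfin
        exact absurd hfin (by simp)
      lift n to ℕ using hn'
      exact ⟨n, by simpa using hn⟩
    choose n hn using hn
    have hdec : simpleIncrement ν η B f s t ω = ∑ b, (n b : ℝ) • f b ω -
        ∑ b, ((t - s : ℝ≥0) * (ν (B b)).toReal) • f b ω := by
      rw [simpleIncrement, ← Finset.sum_sub_distrib]
      refine Finset.sum_congr rfl fun b _ => ?_
      rw [h1 b s t hst, hn b, NNReal.coe_sub hst, ← sub_smul]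
      simp
    have hcomp : ‖∑ b, ((t - s : ℝ≥0) * (ν (B b)).toReal) • f b ω‖ₑ ≤
        K * (∑ b, ν (B b)) * ((t - s : ℝ≥0) : ℝ≥0∞) := by
      calc ‖∑ b, ((t - s : ℝ≥0) * (ν (B b)).toReal) • f b ω‖ₑ
          ≤ ∑ b, ‖((t - s : ℝ≥0) * (ν (B b)).toReal) • f b ω‖ₑ := enorm_sum_le _ _
        _ ≤ ∑ b, ((t - s : ℝ≥0) : ℝ≥0∞) * ν (B b) * K := by
            gcongr with b
            rw [enorm_smul, enorm_mul]
            gcongr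
            · simp
            · rw [Real.enorm_of_nonneg ENNReal.toReal_nonneg, ENNReal.ofReal_toReal (hν b)]
            · exact hKe b ω
        _ = _ := by rw [← Finset.sum_mul, ← Finset.mul_sum]; ring
    rw [hdec]
    calc ‖∑ b, (n b : ℝ) • f b ω - ∑ b, ((t - s : ℝ≥0) * (ν (B b)).toReal) • f b ω‖ₑ ^ p
        ≤ (‖∑ b, (n b : ℝ) • f b ω‖ₑ +
            ‖∑ b, ((t - s : ℝ≥0) * (ν (B b)).toReal) • f b ω‖ₑ) ^ p := by
          gcongr
          exact enorm_sub_le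
      _ ≤ 2 ^ (p - 1) * (‖∑ b, (n b : ℝ) • f b ω‖ₑ ^ p +
            ‖∑ b, ((t - s : ℝ≥0) * (ν (B b)).toReal) • f b ω‖ₑ ^ p) :=
          ENNReal.rpow_add_le_mul_rpow_add_rpow _ _ hp
      _ ≤ _ := by
          gcongr
          rw [hNs]
          simp_rw [hn]
          exact enorm_sum_natCast_smul_rpow_le n _ (fun b => hKe b ω) hp hp2
  refine (lintegral_mono_ae hpt).trans (le_of_eq ?_)
  have hm1 : ∀ b, Measurable fun ω => η ω (B b ×ˢ Set.Ioc s t) * ‖f b ω‖ₑ ^ p := fun b =>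
    (H.measurable_Ioc (hB b) s t).mul ((hfm b).mono (𝓕.le s) le_rfl)
  have hm2 : Measurable fun ω => (K : ℝ≥0∞) ^ p * (2 * (N ω * (N ω - 1))) := by fun_prop
  rw [lintegral_const_mul _ (by fun_prop), lintegral_add_right _ measurable_const,
    lintegral_add_right _ hm2, lintegral_finsetSum _ fun b _ => hm1 b, lintegral_const,
    measure_univ, mul_one, lintegral_const_mul _ (by fun_prop), lintegral_const_mul _ (by fun_prop)]
  congr 4
  · rw [Finset.mul_sum]
    refine Finset.sum_congr rfl fun b _ => ?_
    rw [H.lintegral_mul_Ioc (hB b) hst (hfm b)]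
    ring
  · rw [← hU]
    congr 1
    refine H.lintegral_factorial_Ioc (.iUnion hB) ?_ s t
    rw [hU]
    exact ENNReal.sum_ne_top.2 fun b _ => hν b

end IsPoissonRandomMeasure

end

/-! ### Moments of the integrals of simple step processes -/

/-- The restriction of a filtration with time axis `[0, ∞)` to a sequence of times. -/
def MeasureTheory.Filtration.sample {Ω : Type*} {mΩ : MeasurableSpace Ω} (𝓕 : Filtration ℝ≥0 mΩ)
    {τ : ℕ → ℝ≥0} (hτ : Monotone τ) : Filtration ℕ mΩ where
  seq k := 𝓕 (τ k)
  mono' _ _ h := 𝓕.mono (hτ h)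
  le' k := 𝓕.le (τ k)

theorem tendsto_nat_succ_mul_div_rpow (c : ℝ≥0) {p : ℝ} (hp : 1 < p) :
    Tendsto (fun R : ℕ => ((R + 1 : ℝ≥0) : ℝ≥0∞) * ((c / (R + 1) : ℝ≥0) : ℝ≥0∞) ^ p) atTop
      (𝓝 0) := by
  have h1 : Tendsto (fun R : ℕ => (c : ℝ) ^ p * ((R : ℝ) + 1) ^ (-(p - 1))) atTop (𝓝 0) := by
    rw [show (0 : ℝ) = (c : ℝ) ^ p * 0 by simp]
    refine Tendsto.const_mul _ ((tendsto_rpow_neg_atTop (by linarith : 0 < p - 1)).comp ?_)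
    exact tendsto_atTop_add_const_right _ _ tendsto_natCast_atTop_atTop
  have h2 : Tendsto (fun R : ℕ => (R + 1 : ℝ≥0) * (c / (R + 1) : ℝ≥0) ^ p) atTop (𝓝 0) := by
    rw [← NNReal.tendsto_coe]
    refine h1.congr fun R => ?_
    have hR : (0 : ℝ) < (R : ℝ) + 1 := by positivity
    push_cast
    rw [Real.div_rpow c.coe_nonneg hR.le, Real.rpow_neg hR.le, Real.rpow_sub_one hR.ne']
    field_simp
  have h3 := (ENNReal.tendsto_coe.2 h2)
  refine h3.congr fun R => ?_
  rw [ENNReal.coe_mul, ENNReal.coe_rpow_of_nonneg _ (by linarith)]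

section

variable {S : Type v} [MeasurableSpace S] {Ω : Type w} [mΩ : MeasurableSpace Ω]
  {E : Type u} [NormedAddCommGroup E] [NormedSpace ℝ E] [CompleteSpace E] {ι : Type*} [Fintype ι]

/-- The energy `∫ |φ|^p dν (t - s)` of the integrand `φ = ∑ b, 1_{B b} f b` over an interval of
length `t - s`. -/
noncomputable def simpleEnergy (ν : Measure S) (B : ι → Set S) (p : ℝ) (f : ι → Ω → E)
    (s t : ℝ≥0) (ω : Ω) : ℝ≥0∞ :=
  ((t - s : ℝ≥0) : ℝ≥0∞) * ∑ b, ν (B b) * ‖f b ω‖ₑ ^ p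

namespace IsPoissonRandomMeasure

variable {𝓕 : Filtration ℝ≥0 mΩ} {P : Measure Ω} [IsProbabilityMeasure P] {ν : Measure S}
  {η : Ω → Measure (S × ℝ≥0)} {B : ι → Set S} {s t : ℝ≥0}

/-- The terms of higher order in `lintegral_simpleIncrement_rpow_le_add` disappear when `(s, t]` is
cut into `R + 1` equal pieces, to which the martingale type inequality applies, and `R → ∞`. -/
theorem lintegral_simpleIncrement_rpow_le {p : ℝ} (hp : 1 < p) (hp2 : p ≤ 2) {L : ℝ≥0}
    (hL : MartingaleIncrementBound.{u, w} E p L) (H : IsPoissonRandomMeasure 𝓕 P ν η)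
    (hB : ∀ b, MeasurableSet (B b)) (hν : ∀ b, ν (B b) ≠ ∞)
    (hd : Pairwise (Function.onFun Disjoint B))
    (hst : s ≤ t) {f : ι → Ω → E} (hf : ∀ b, StronglyMeasurable[𝓕 s] (f b)) {K : ℝ≥0}
    (hK : ∀ b ω, ‖f b ω‖ ≤ K) :
    ∫⁻ ω, ‖simpleIncrement ν η B f s t ω‖ₑ ^ p ∂P ≤ L * 2 ^ (p - 1) *
      (((t - s : ℝ≥0) : ℝ≥0∞) * ∑ b, ν (B b) * ∫⁻ ω, ‖f b ω‖ₑ ^ p ∂P) := by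
  set A : ℝ≥0∞ := ∑ b, ν (B b) * ∫⁻ ω, ‖f b ω‖ₑ ^ p ∂P
  obtain ⟨m, hm⟩ : ∃ m : ℝ≥0, (m : ℝ≥0∞) = ∑ b, ν (B b) :=
    ⟨_, ENNReal.coe_toNNReal (ENNReal.sum_ne_top.2 fun b _ => hν b)⟩
  have key : ∀ R : ℕ, ∫⁻ ω, ‖simpleIncrement ν η B f s t ω‖ₑ ^ p ∂P ≤ L * (2 ^ (p - 1) *
      (((t - s : ℝ≥0) : ℝ≥0∞) * A + (K : ℝ≥0∞) ^ p * (2 * (((R + 1 : ℝ≥0) : ℝ≥0∞) *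
        (((m * (t - s)) / (R + 1) : ℝ≥0) : ℝ≥0∞) ^ (2 : ℝ))) +
        ((R + 1 : ℝ≥0) : ℝ≥0∞) * (((K * m * (t - s)) / (R + 1) : ℝ≥0) : ℝ≥0∞) ^ p)) := by
    intro R
    set h : ℝ≥0 := (t - s) / (R + 1) with hh
    have hR : (R + 1 : ℝ≥0) ≠ 0 := by positivity
    have hRh : (R + 1 : ℝ≥0) * h = t - s := by rw [hh]; field_simp
    set τ : ℕ → ℝ≥0 := fun k => s + k * h with hτ
    have hmono : Monotone τ := fun i j hij => by
      simp only [hτ]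
      gcongr
    have hs : ∀ k, s ≤ τ k := fun k => le_self_add
    have hstep : ∀ k, τ (k + 1) - τ k = h := fun k => by
      simp only [hτ]
      push_cast
      rw [add_mul, one_mul, ← add_assoc, add_tsub_cancel_left]
    have hend : τ (R + 1) = t := by
      simp only [hτ]
      push_cast
      rw [hRh, add_tsub_cancel_of_le hst]
    have hfk : ∀ k b, StronglyMeasurable[𝓕 (τ k)] (f b) := fun k b =>
      (hf b).mono (𝓕.mono (hs k))
    have hsum : ∀ ω, simpleIncrement ν η B f s t ω =
        ∑ k ∈ Finset.range (R + 1), simpleIncrement ν η B f (τ k) (τ (k + 1)) ω := by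
      intro ω
      simp only [simpleIncrement]
      rw [Finset.sum_comm]
      refine Finset.sum_congr rfl fun b _ => ?_
      rw [← Finset.sum_smul, Finset.sum_range_sub (fun k => compPoisson ν η (B b) (τ k) ω), hend]
      simp [hτ]
    simp_rw [hsum]
    refine (hL Ω P (𝓕.sample hmono) _ (fun k => H.stronglyMeasurable_simpleIncrement hB
      (hmono k.le_succ) (hfk (k + 1))) (fun k => H.integrable_simpleIncrement hB hν
        (fun b => ((hf b).mono (𝓕.le s)).aestronglyMeasurable) hK _ _) (fun k =>
      H.condExp_simpleIncrement hB hν (hmono k.le_succ) (hfk k) hK) (R + 1)).trans ?_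
    gcongr
    refine (Finset.sum_le_sum fun k _ => H.lintegral_simpleIncrement_rpow_le_add hB hν hd
      (hmono k.le_succ) (hfk k) hK hp.le hp2).trans (le_of_eq ?_)
    simp_rw [hstep]
    rw [Finset.sum_const, Finset.card_range, nsmul_eq_mul, ← hm]
    have e0 : ((R + 1 : ℕ) : ℝ≥0∞) = ((R + 1 : ℝ≥0) : ℝ≥0∞) := by push_cast; rfl
    have e1 : m * (t - s) / (R + 1) = m * h := by rw [hh, mul_div_assoc]
    have e2 : K * m * (t - s) / (R + 1) = K * m * h := by rw [hh, mul_div_assoc]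
    rw [e0, e1, e2, ENNReal.rpow_two, ← hRh]
    simp only [ENNReal.coe_mul]
    ring
  have hlim : Tendsto (fun R : ℕ => (L : ℝ≥0∞) * (2 ^ (p - 1) *
      (((t - s : ℝ≥0) : ℝ≥0∞) * A + (K : ℝ≥0∞) ^ p * (2 * (((R + 1 : ℝ≥0) : ℝ≥0∞) *
        (((m * (t - s)) / (R + 1) : ℝ≥0) : ℝ≥0∞) ^ (2 : ℝ))) +
        ((R + 1 : ℝ≥0) : ℝ≥0∞) * (((K * m * (t - s)) / (R + 1) : ℝ≥0) : ℝ≥0∞) ^ p))) atTop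
      (𝓝 (L * (2 ^ (p - 1) * (((t - s : ℝ≥0) : ℝ≥0∞) * A + (K : ℝ≥0∞) ^ p * (2 * 0) + 0)))) := by
    refine ENNReal.Tendsto.const_mul (ENNReal.Tendsto.const_mul (Tendsto.add (Tendsto.add
      tendsto_const_nhds (ENNReal.Tendsto.const_mul (ENNReal.Tendsto.const_mul
        (tendsto_nat_succ_mul_div_rpow _ one_lt_two) (Or.inr (by simp))) (Or.inr ?_)))
        (tendsto_nat_succ_mul_div_rpow _ hp)) (Or.inr ?_)) (Or.inr (by simp))
    · exact ENNReal.rpow_ne_top_of_nonneg (by linarith) ENNReal.coe_ne_top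
    · exact ENNReal.rpow_ne_top_of_nonneg (by linarith) (by simp)
  refine (ge_of_tendsto' hlim key).trans (le_of_eq ?_)
  simp only [mul_zero, add_zero, mul_assoc]

/-- The maximal inequality with exponent `p`, for integrals of simple step processes. -/
theorem lintegral_sup_sum_simpleIncrement_rpow_le {p : ℝ} (hp : 1 < p) (hp2 : p ≤ 2) {L : ℝ≥0}
    (hL : MartingaleIncrementBound.{u, w} E p L) (H : IsPoissonRandomMeasure 𝓕 P ν η)
    (hB : ∀ b, MeasurableSet (B b)) (hν : ∀ b, ν (B b) ≠ ∞)
    (hd : Pairwise (Function.onFun Disjoint B)) {τ : ℕ → ℝ≥0} (hτ : Monotone τ)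
    {f : ℕ → ι → Ω → E} (hf : ∀ k b, StronglyMeasurable[𝓕 (τ k)] (f k b)) {K : ℝ≥0}
    (hK : ∀ k b ω, ‖f k b ω‖ ≤ K) (n : ℕ) :
    ∫⁻ ω, ((Finset.range (n + 1)).sup fun j => ‖∑ k ∈ Finset.range j,
        simpleIncrement ν η B (f k) (τ k) (τ (k + 1)) ω‖ₑ) ^ p ∂P ≤
      ENNReal.ofReal (p / (p - 1)) ^ p * (L * (L * 2 ^ (p - 1))) *
        ∫⁻ ω, ∑ k ∈ Finset.range n, simpleEnergy ν B p (f k) (τ k) (τ (k + 1)) ω ∂P := by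
  have hfae : ∀ k b, AEStronglyMeasurable (f k b) P := fun k b =>
    ((hf k b).mono (𝓕.le _)).aestronglyMeasurable
  have hf' : ∀ k b, Measurable fun ω => ‖f k b ω‖ₑ ^ p := fun k b =>
    ((hf k b).mono (𝓕.le _)).enorm.pow_const p
  have hEn : ∀ k, ∫⁻ ω, simpleEnergy ν B p (f k) (τ k) (τ (k + 1)) ω ∂P =
      ((τ (k + 1) - τ k : ℝ≥0) : ℝ≥0∞) * ∑ b, ν (B b) * ∫⁻ ω, ‖f k b ω‖ₑ ^ p ∂P := by
    intro k
    simp only [simpleEnergy]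
    rw [lintegral_const_mul _ (by fun_prop), lintegral_finsetSum _ (by fun_prop)]
    congr 1
    refine Finset.sum_congr rfl fun b _ => lintegral_const_mul _ (hf' k b)
  have hKe : ∀ k b ω, ‖f k b ω‖ₑ ≤ K := fun k b ω => by
    rw [enorm_eq_nnnorm]; exact_mod_cast hK k b ω
  have hfin : ∀ k, ∫⁻ ω, simpleEnergy ν B p (f k) (τ k) (τ (k + 1)) ω ∂P < ∞ := by
    intro k
    rw [hEn]
    refine ENNReal.mul_lt_top ENNReal.coe_lt_top (ENNReal.sum_lt_top.2 fun b _ =>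
      ENNReal.mul_lt_top (hν b).lt_top ?_)
    calc ∫⁻ ω, ‖f k b ω‖ₑ ^ p ∂P ≤ ∫⁻ _, (K : ℝ≥0∞) ^ p ∂P := by
          refine lintegral_mono fun ω => ?_
          gcongr
          exact hKe k b ω
      _ < ∞ := by
          simp only [lintegral_const, measure_univ, mul_one]
          exact ENNReal.rpow_lt_top_of_nonneg (by linarith) ENNReal.coe_ne_top
  have hm1 : ∀ k, StronglyMeasurable[𝓕 (τ (k + 1))]
      (simpleIncrement ν η B (f k) (τ k) (τ (k + 1))) := fun k =>
    H.stronglyMeasurable_simpleIncrement hB (hτ k.le_succ)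
      fun b => (hf k b).mono (𝓕.mono (hτ k.le_succ))
  have hm2 := fun k => H.integrable_simpleIncrement hB hν (hfae k) (hK k) (τ k) (τ (k + 1))
  have hm3 := fun k => H.condExp_simpleIncrement hB hν (hτ k.le_succ) (hf k) (hK k)
  have hmart : Martingale (fun n ω => ∑ k ∈ Finset.range n,
      simpleIncrement ν η B (f k) (τ k) (τ (k + 1)) ω) (𝓕.sample hτ) P :=
    martingale_sum_range hm1 hm2 hm3
  have hbd : ∀ j, ∫⁻ ω, ‖∑ k ∈ Finset.range j,
      simpleIncrement ν η B (f k) (τ k) (τ (k + 1)) ω‖ₑ ^ p ∂P ≤ (L * (L * 2 ^ (p - 1))) *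
        ∑ k ∈ Finset.range j, ∫⁻ ω, simpleEnergy ν B p (f k) (τ k) (τ (k + 1)) ω ∂P := by
    intro j
    refine (hL Ω P (𝓕.sample hτ) _ hm1 hm2 hm3 j).trans ?_
    rw [mul_assoc, Finset.mul_sum _ _ ((L : ℝ≥0∞) * 2 ^ (p - 1))]
    gcongr with k
    rw [hEn]
    exact H.lintegral_simpleIncrement_rpow_le hp hp2 hL hB hν hd (hτ k.le_succ) (hf k) (hK k)
  refine (hmart.lintegral_sup_enorm_rpow_le hp n fun j _ => (hbd j).trans_lt ?_).trans ?_
  · refine ENNReal.mul_lt_top (ENNReal.mul_lt_top (by simp) (ENNReal.mul_lt_top (by simp) ?_))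
      (ENNReal.sum_lt_top.2 fun k _ => hfin k)
    exact ENNReal.rpow_lt_top_of_nonneg (by linarith) (by simp)
  · rw [mul_assoc, lintegral_finsetSum]
    · gcongr
      exact hbd n
    · intro k _
      unfold simpleEnergy
      fun_prop

end IsPoissonRandomMeasure

end

/-! ### The maximal inequality with a smaller exponent -/

theorem measurable_finset_sup_apply {Ω κ : Type*} [MeasurableSpace Ω] (F : Finset κ)
    {g : κ → Ω → ℝ≥0∞} (hg : ∀ j ∈ F, Measurable (g j)) :
    Measurable fun ω => F.sup fun j => g j ω := by
  simp_rw [Finset.sup_eq_iSup]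
  exact Measurable.biSup _ F.countable_toSet hg

/-- Abel summation against nondecreasing weights. -/
theorem norm_sum_smul_le_of_monotone {E : Type*} [NormedAddCommGroup E] [NormedSpace ℝ E]
    {w : ℕ → ℝ} (hw : Monotone w) (hw0 : ∀ k, 0 ≤ w k) {D : ℕ → E} {R W : ℝ} {n : ℕ}
    (hR : ∀ j ≤ n, ‖∑ k ∈ Finset.range j, D k‖ ≤ R) (hW : ∀ k < n, w k ≤ W) (hW0 : 0 ≤ W) :
    ‖∑ k ∈ Finset.range n, w k • D k‖ ≤ 2 * W * R := by
  have hR0 : 0 ≤ R := (norm_nonneg _).trans (hR n le_rfl)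
  rcases n with _ | n
  · simpa using by positivity
  rw [Finset.sum_range_by_parts, Nat.add_sub_cancel]
  have h1 : ‖w n • ∑ i ∈ Finset.range (n + 1), D i‖ ≤ w n * R := by
    rw [norm_smul, Real.norm_of_nonneg (hw0 n)]
    exact mul_le_mul_of_nonneg_left (hR _ le_rfl) (hw0 n)
  have h2 : ‖∑ i ∈ Finset.range n, (w (i + 1) - w i) • ∑ i ∈ Finset.range (i + 1), D i‖ ≤
      (w n - w 0) * R := by
    refine (norm_sum_le _ _).trans ?_
    rw [← Finset.sum_range_sub, Finset.sum_mul]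
    refine Finset.sum_le_sum fun i hi => ?_
    have hi := Finset.mem_range.1 hi
    have h3 : 0 ≤ w (i + 1) - w i := sub_nonneg.2 (hw i.le_succ)
    rw [norm_smul, Real.norm_of_nonneg h3]
    exact mul_le_mul_of_nonneg_left (hR _ (by lia)) h3
  have h3 := hW n (by lia)
  refine (norm_sub_le _ _).trans ((add_le_add h1 h2).trans ?_)
  nlinarith [hw0 0, hw0 n, mul_nonneg (hw0 0) hR0, mul_le_mul_of_nonneg_right h3 hR0]

/-- The sum on the left is a lower Riemann sum for the integral of `x ^ (θ - 1)` from `ε` to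
`∑ j ∈ range n, a j + ε`. -/
theorem sum_mul_rpow_sub_one_le {a : ℕ → ℝ} (ha : ∀ k, 0 ≤ a k) {ε : ℝ} (hε : 0 < ε) {θ : ℝ}
    (hθ : 0 < θ) (hθ1 : θ ≤ 1) (n : ℕ) :
    ∑ k ∈ Finset.range n, a k * (∑ j ∈ Finset.range (k + 1), a j + ε) ^ (θ - 1) ≤
      θ⁻¹ * (∑ j ∈ Finset.range n, a j + ε) ^ θ := by
  induction n with
  | zero =>
    have : 0 < ε ^ θ := Real.rpow_pos_of_pos hε θ
    simpa using by positivity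
  | succ n ih =>
    rw [Finset.sum_range_succ]
    refine (add_le_add_left ih _).trans ?_
    set x := ∑ j ∈ Finset.range n, a j + ε with hx
    have hx0 : 0 < x := add_pos_of_nonneg_of_pos (Finset.sum_nonneg fun k _ => ha k) hε
    have hy : ∑ j ∈ Finset.range (n + 1), a j + ε = x + a n := by
      rw [Finset.sum_range_succ, hx]; ring
    rw [hy]
    set y := x + a n with hy'
    have hy0 : 0 < y := add_pos_of_pos_of_nonneg hx0 (ha n)
    -- concavity of `x ^ θ`
    have hb : (x / y) ^ θ ≤ 1 + θ * (x / y - 1) := by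
      have := rpow_one_add_le_one_add_mul_self (s := x / y - 1) (by
        have : 0 ≤ x / y := by positivity
        linarith) hθ.le hθ1
      simpa using this
    have hyy : y ^ θ = y ^ (θ - 1) * y := by
      rw [Real.rpow_sub_one hy0.ne']
      field_simp
    have hc : x ^ θ ≤ y ^ θ - θ * (a n * y ^ (θ - 1)) := by
      calc x ^ θ = y ^ θ * (x / y) ^ θ := by
            rw [← Real.mul_rpow hy0.le (by positivity), mul_div_cancel₀ _ hy0.ne']
        _ ≤ y ^ θ * (1 + θ * (x / y - 1)) := by gcongr
        _ = y ^ θ - θ * (a n * y ^ (θ - 1)) := by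
            rw [hyy, (by rw [hy']; ring : a n = y - x)]
            field_simp
            ring
    calc θ⁻¹ * x ^ θ + a n * y ^ (θ - 1)
        ≤ θ⁻¹ * (y ^ θ - θ * (a n * y ^ (θ - 1))) + a n * y ^ (θ - 1) := by gcongr
      _ = θ⁻¹ * y ^ θ := by field_simp; ring

/-- The constant in the maximal inequality with exponent `p`. -/
noncomputable def maximalConst (p : ℝ) (L : ℝ≥0) : ℝ≥0∞ :=
  ENNReal.ofReal (p / (p - 1)) ^ p * (L * (L * 2 ^ (p - 1)))

theorem maximalConst_lt_top {p : ℝ} (hp : 1 < p) (L : ℝ≥0) : maximalConst p L < ∞ := by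
  refine ENNReal.mul_lt_top (ENNReal.rpow_lt_top_of_nonneg (by linarith) ENNReal.ofReal_ne_top)
    (ENNReal.mul_lt_top (by simp) (ENNReal.mul_lt_top (by simp) ?_))
  exact ENNReal.rpow_lt_top_of_nonneg (by linarith) (by simp)

/-- A constant for the maximal inequality with exponent `q ≤ p`. -/
noncomputable def lowerMaximalConst (p q : ℝ) (L : ℝ≥0) : ℝ≥0∞ :=
  maximalConst p L + 2 ^ q * (maximalConst p L * ENNReal.ofReal (p / q)) ^ (q / p)

theorem lowerMaximalConst_lt_top {p q : ℝ} (hp : 1 < p) (hq : 0 < q) (L : ℝ≥0) :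
    lowerMaximalConst p q L < ∞ :=
  ENNReal.add_lt_top.2 ⟨maximalConst_lt_top hp L, ENNReal.mul_lt_top
    (ENNReal.rpow_lt_top_of_nonneg hq.le (by simp)) (ENNReal.rpow_lt_top_of_nonneg
      (div_nonneg hq.le (by linarith))
      (ENNReal.mul_ne_top (maximalConst_lt_top hp L).ne ENNReal.ofReal_ne_top))⟩

section

variable {S : Type v} [MeasurableSpace S] {Ω : Type w} [mΩ : MeasurableSpace Ω]
  {E : Type u} [NormedAddCommGroup E] [NormedSpace ℝ E] [CompleteSpace E] {ι : Type*} [Fintype ι]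

namespace IsPoissonRandomMeasure

variable {𝓕 : Filtration ℝ≥0 mΩ} {P : Measure Ω} [IsProbabilityMeasure P] {ν : Measure S}
  {η : Ω → Measure (S × ℝ≥0)} {B : ι → Set S} {s t : ℝ≥0}

/-- The maximal inequality with an exponent `q < p`.  The integrand is divided by a power of its
accumulated energy, which makes the exponent `p` available; Abel summation and Hölder's inequality
then undo the division. -/
theorem lintegral_sup_sum_simpleIncrement_rpow_le_of_lt {p q : ℝ} (hp : 1 < p) (hp2 : p ≤ 2)
    (hq : 0 < q) (hqp : q < p) {L : ℝ≥0}
    (hL : MartingaleIncrementBound.{u, w} E p L) (H : IsPoissonRandomMeasure 𝓕 P ν η)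
    (hB : ∀ b, MeasurableSet (B b)) (hν : ∀ b, ν (B b) ≠ ∞)
    (hd : Pairwise (Function.onFun Disjoint B)) {τ : ℕ → ℝ≥0} (hτ : Monotone τ)
    {f : ℕ → ι → Ω → E} (hf : ∀ k b, StronglyMeasurable[𝓕 (τ k)] (f k b)) {K : ℝ≥0}
    (hK : ∀ k b ω, ‖f k b ω‖ ≤ K) (n : ℕ) :
    ∫⁻ ω, ((Finset.range (n + 1)).sup fun j => ‖∑ k ∈ Finset.range j,
        simpleIncrement ν η B (f k) (τ k) (τ (k + 1)) ω‖ₑ) ^ q ∂P ≤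
      2 ^ q * (maximalConst p L * ENNReal.ofReal (p / q)) ^ (q / p) *
        ∫⁻ ω, (∑ k ∈ Finset.range n, simpleEnergy ν B p (f k) (τ k) (τ (k + 1)) ω) ^ (q / p) ∂P := by
  have hp0 : 0 < p := by linarith
  set θ : ℝ := q / p with hθ
  have hθ0 : 0 < θ := by positivity
  have hθ1 : θ ≤ 1 := (div_le_one hp0).2 hqp.le
  set β : ℝ := (p - q) / p ^ 2 with hβ
  have hβ0 : 0 ≤ β := div_nonneg (by linarith) (by positivity)
  have hβp : β * p = 1 - θ := by rw [hβ, hθ]; field_simp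
  set En : ℕ → Ω → ℝ≥0∞ := fun k ω => simpleEnergy ν B p (f k) (τ k) (τ (k + 1)) ω with hEn
  have hEnfin : ∀ k ω, En k ω ≠ ∞ := fun k ω =>
    ENNReal.mul_ne_top ENNReal.coe_ne_top (ENNReal.sum_ne_top.2 fun b _ =>
      ENNReal.mul_ne_top (hν b) (ENNReal.rpow_ne_top_of_nonneg hp0.le enorm_ne_top))
  have hEnm : ∀ k, Measurable[𝓕 (τ k)] (En k) := fun k => by
    have : ∀ b, Measurable[𝓕 (τ k)] fun ω => ‖f k b ω‖ₑ ^ p := fun b =>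
      (hf k b).enorm.pow_const p
    exact (Finset.measurable_fun_sum _ fun b _ => (this b).const_mul _).const_mul _
  have hEnm' : ∀ k, Measurable (En k) := fun k => (hEnm k).mono (𝓕.le _) le_rfl
  set a : ℕ → Ω → ℝ := fun k ω => (En k ω).toReal with ha
  have ha0 : ∀ k ω, 0 ≤ a k ω := fun k ω => ENNReal.toReal_nonneg
  have hae : ∀ k ω, ENNReal.ofReal (a k ω) = En k ω := fun k ω => ENNReal.ofReal_toReal (hEnfin k ω)
  have ham : ∀ k, Measurable[𝓕 (τ k)] (a k) := fun k => (hEnm k).ennreal_toReal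
  set A : Ω → ℝ≥0∞ := fun ω => ∑ k ∈ Finset.range n, En k ω with hA
  have hAm : Measurable A := Finset.measurable_fun_sum _ fun k _ => hEnm' k
  have key : ∀ ε : ℝ, 0 < ε → ∫⁻ ω, ((Finset.range (n + 1)).sup fun j => ‖∑ k ∈ Finset.range j,
        simpleIncrement ν η B (f k) (τ k) (τ (k + 1)) ω‖ₑ) ^ q ∂P ≤
      2 ^ q * (maximalConst p L * ENNReal.ofReal (p / q)) ^ θ *
        (∫⁻ ω, A ω ^ θ ∂P + ENNReal.ofReal ε ^ θ) := by
    intro ε hε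
    -- `x k` is the energy accumulated before step `k`, made positive by `ε`; the weight `w k` is a
    -- power of `x (k + 1)`, which is still known at time `τ k`
    set x : ℕ → Ω → ℝ := fun k ω => ∑ j ∈ Finset.range k, a j ω + ε with hx
    have hxε : ∀ k ω, ε ≤ x k ω := fun k ω =>
      le_add_of_nonneg_left (Finset.sum_nonneg fun j _ => ha0 j ω)
    have hx0 : ∀ k ω, 0 < x k ω := fun k ω => hε.trans_le (hxε k ω)
    have hxmono : ∀ ω, Monotone fun k => x k ω := fun ω i j hij =>
      add_le_add_left (Finset.sum_le_sum_of_subset_of_nonneg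
        (Finset.range_subset_range.2 hij) fun k _ _ => ha0 k ω) ε
    set w : ℕ → Ω → ℝ := fun k ω => x (k + 1) ω ^ β with hw
    have hw0 : ∀ k ω, 0 < w k ω := fun k ω => Real.rpow_pos_of_pos (hx0 _ ω) β
    have hwm : ∀ k, Measurable[𝓕 (τ k)] (w k) := fun k => by
      refine Measurable.pow_const (Measurable.add_const (Finset.measurable_fun_sum _ fun j hj => ?_)
        ε) β
      exact (ham j).mono (𝓕.mono (hτ (Nat.lt_succ_iff.1 (Finset.mem_range.1 hj)))) le_rfl
    set f' : ℕ → ι → Ω → E := fun k b ω => (w k ω)⁻¹ • f k b ω with hf'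
    have hf'm : ∀ k b, StronglyMeasurable[𝓕 (τ k)] (f' k b) := fun k b =>
      (hwm k).inv.stronglyMeasurable.smul (hf k b)
    have hf'K : ∀ k b ω, ‖f' k b ω‖ ≤ (((ε ^ β)⁻¹).toNNReal * K : ℝ≥0) := fun k b ω => by
      have hεβ : 0 < ε ^ β := Real.rpow_pos_of_pos hε β
      rw [hf', NNReal.coe_mul, Real.coe_toNNReal _ (by positivity)]
      simp only [norm_smul, norm_inv, Real.norm_of_nonneg (hw0 k ω).le]
      gcongr
      · exact Real.rpow_le_rpow hε.le (hxε _ ω) hβ0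
      · exact hK k b ω
    set M' : Ω → ℝ≥0∞ := fun ω => (Finset.range (n + 1)).sup fun j => ‖∑ k ∈ Finset.range j,
        simpleIncrement ν η B (f' k) (τ k) (τ (k + 1)) ω‖ₑ with hM'
    have hM'm : Measurable M' := by
      refine measurable_finset_sup_apply _ fun j _ => ?_
      refine (Finset.stronglyMeasurable_fun_sum _ fun k _ => ?_).enorm
      exact (H.stronglyMeasurable_simpleIncrement hB (hτ k.le_succ)
        fun b => (hf'm k b).mono (𝓕.mono (hτ k.le_succ))).mono (𝓕.le _)
    have hM'fin : ∀ ω, M' ω ≠ ∞ := fun ω =>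
      ((Finset.sup_lt_iff (by simp)).2 fun j _ => enorm_lt_top).ne
    set V : Ω → ℝ≥0∞ := fun ω => ENNReal.ofReal (x n ω) with hV
    have hVA : ∀ ω, V ω = A ω + ENNReal.ofReal ε := fun ω => by
      simp only [hV, hx, hA]
      rw [ENNReal.ofReal_add (Finset.sum_nonneg fun j _ => ha0 j ω) hε.le,
        ENNReal.ofReal_sum_of_nonneg fun j _ => ha0 j ω]
      simp_rw [hae]
    have hVm : Measurable V := by
      rw [show V = fun ω => A ω + ENNReal.ofReal ε from funext hVA]
      fun_prop
    -- the accumulated energy of the weighted integrand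
    have henergy : ∀ ω, ∑ k ∈ Finset.range n, simpleEnergy ν B p (f' k) (τ k) (τ (k + 1)) ω ≤
        ENNReal.ofReal (p / q) * V ω ^ θ := by
      intro ω
      have h1 : ∀ k, simpleEnergy ν B p (f' k) (τ k) (τ (k + 1)) ω =
          ENNReal.ofReal (a k ω * x (k + 1) ω ^ (θ - 1)) := by
        intro k
        rw [mul_comm, ENNReal.ofReal_mul (Real.rpow_nonneg (hx0 _ ω).le _), hae]
        have h2 : ENNReal.ofReal (x (k + 1) ω ^ (θ - 1)) = ‖(w k ω)⁻¹‖ₑ ^ p := by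
          rw [Real.enorm_of_nonneg (by have := hw0 k ω; positivity),
            ENNReal.ofReal_rpow_of_nonneg (by have := hw0 k ω; positivity) hp0.le,
            ← Real.rpow_neg (hx0 _ ω).le, ← Real.rpow_mul (hx0 _ ω).le]
          congr 2
          linarith
        rw [h2]
        simp only [hEn, simpleEnergy, hf', enorm_smul, ENNReal.mul_rpow_of_nonneg _ _ hp0.le]
        rw [mul_left_comm]
        congr 1
        rw [Finset.mul_sum]
        refine Finset.sum_congr rfl fun b _ => ?_
        ring
      simp_rw [h1]
      rw [← ENNReal.ofReal_sum_of_nonneg fun k _ =>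
        mul_nonneg (ha0 k ω) (Real.rpow_nonneg (hx0 _ ω).le _)]
      have h3 := sum_mul_rpow_sub_one_le (fun k => ha0 k ω) hε hθ0 hθ1 n
      refine (ENNReal.ofReal_le_ofReal h3).trans (le_of_eq ?_)
      rw [ENNReal.ofReal_mul (by positivity), hθ, inv_div, ENNReal.ofReal_rpow_of_nonneg
        (hx0 n ω).le hθ0.le]
    have hpM' : ∫⁻ ω, M' ω ^ p ∂P ≤
        maximalConst p L * ENNReal.ofReal (p / q) * ∫⁻ ω, V ω ^ θ ∂P := by
      refine (H.lintegral_sup_sum_simpleIncrement_rpow_le hp hp2 hL hB hν hd hτ hf'm hf'K n).trans ?_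
      rw [mul_assoc (maximalConst p L), ← lintegral_const_mul _ (hVm.pow_const θ)]
      exact mul_le_mul' le_rfl (lintegral_mono henergy)
    have hinc : ∀ k ω, simpleIncrement ν η B (f k) (τ k) (τ (k + 1)) ω =
        w k ω • simpleIncrement ν η B (f' k) (τ k) (τ (k + 1)) ω := fun k ω => by
      simp only [simpleIncrement, Finset.smul_sum, hf']
      refine Finset.sum_congr rfl fun b _ => ?_
      rw [smul_comm (w k ω), smul_smul (w k ω), mul_inv_cancel₀ (hw0 k ω).ne', one_smul]
    have hsup : ∀ ω, ((Finset.range (n + 1)).sup fun j => ‖∑ k ∈ Finset.range j,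
        simpleIncrement ν η B (f k) (τ k) (τ (k + 1)) ω‖ₑ) ≤ 2 * (V ω ^ β * M' ω) := by
      intro ω
      refine Finset.sup_le fun j hj => ?_
      have hjn : j ≤ n := Nat.lt_succ_iff.1 (Finset.mem_range.1 hj)
      simp_rw [hinc]
      have := norm_sum_smul_le_of_monotone (w := fun k => w k ω) (n := j) (R := (M' ω).toReal)
        (W := x n ω ^ β)
        (D := fun k => simpleIncrement ν η B (f' k) (τ k) (τ (k + 1)) ω)
        (fun i j hij => Real.rpow_le_rpow (hx0 _ ω).le (hxmono ω (Nat.succ_le_succ hij)) hβ0)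
        (fun k => (hw0 k ω).le) (fun i hi => ?_)
        (fun k hk => Real.rpow_le_rpow (hx0 _ ω).le (hxmono ω (by lia)) hβ0)
        (Real.rpow_nonneg (hx0 _ ω).le _)
      · rw [← ofReal_norm]
        refine (ENNReal.ofReal_le_ofReal this).trans (le_of_eq ?_)
        rw [ENNReal.ofReal_mul (by have := Real.rpow_nonneg (hx0 n ω).le β; positivity),
          ENNReal.ofReal_toReal (hM'fin ω), ENNReal.ofReal_mul zero_le_two,
          ← ENNReal.ofReal_rpow_of_nonneg (hx0 n ω).le hβ0, ENNReal.ofReal_ofNat, mul_assoc]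
      · rw [← toReal_enorm]
        refine ENNReal.toReal_mono (hM'fin ω) ?_
        exact Finset.le_sup (f := fun j => ‖∑ k ∈ Finset.range j,
          simpleIncrement ν η B (f' k) (τ k) (τ (k + 1)) ω‖ₑ)
          (Finset.mem_range.2 (by lia))
    have hconj : (p / (p - q)).HolderConjugate (p / q) := by
      have h1 : 0 < p - q := by linarith
      refine Real.holderConjugate_iff.2 ⟨(one_lt_div h1).2 (by linarith), ?_⟩
      field_simp
      ring
    have hholder := ENNReal.lintegral_mul_le_Lp_mul_Lq P hconj
      (f := fun ω => V ω ^ (β * q)) (g := fun ω => M' ω ^ q) (by fun_prop) (by fun_prop)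
    have hpq : p - q ≠ 0 := by linarith
    have e1 : ∀ ω, (V ω ^ (β * q)) ^ (p / (p - q)) = V ω ^ θ := fun ω => by
      rw [← ENNReal.rpow_mul]
      congr 1
      rw [hβ, hθ]
      field_simp
    have e2 : ∀ ω, (M' ω ^ q) ^ (p / q) = M' ω ^ p := fun ω => by
      rw [← ENNReal.rpow_mul]
      congr 1
      field_simp
    have e3 : 1 / (p / (p - q)) = 1 - θ := by rw [hθ]; field_simp
    have e4 : 1 / (p / q) = θ := by rw [hθ]; field_simp
    simp_rw [e1, e2, e3, e4] at hholder
    calc ∫⁻ ω, ((Finset.range (n + 1)).sup fun j => ‖∑ k ∈ Finset.range j,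
        simpleIncrement ν η B (f k) (τ k) (τ (k + 1)) ω‖ₑ) ^ q ∂P
        ≤ ∫⁻ ω, 2 ^ q * (V ω ^ (β * q) * M' ω ^ q) ∂P := by
          refine lintegral_mono fun ω => (ENNReal.rpow_le_rpow (hsup ω) hq.le).trans (le_of_eq ?_)
          rw [ENNReal.mul_rpow_of_nonneg _ _ hq.le, ENNReal.mul_rpow_of_nonneg _ _ hq.le,
            ENNReal.rpow_mul]
      _ = 2 ^ q * ∫⁻ ω, V ω ^ (β * q) * M' ω ^ q ∂P := lintegral_const_mul _ (by fun_prop)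
      _ ≤ 2 ^ q * ((∫⁻ ω, V ω ^ θ ∂P) ^ (1 - θ) * (maximalConst p L * ENNReal.ofReal (p / q) *
            ∫⁻ ω, V ω ^ θ ∂P) ^ θ) := by
          refine mul_le_mul' le_rfl (hholder.trans ?_)
          gcongr
      _ = 2 ^ q * (maximalConst p L * ENNReal.ofReal (p / q)) ^ θ * ∫⁻ ω, V ω ^ θ ∂P := by
          rw [ENNReal.mul_rpow_of_nonneg _ _ hθ0.le]
          have : (∫⁻ ω, V ω ^ θ ∂P) = (∫⁻ ω, V ω ^ θ ∂P) ^ (1 - θ) * (∫⁻ ω, V ω ^ θ ∂P) ^ θ := by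
            rw [← ENNReal.rpow_add_of_nonneg _ _ (by linarith) hθ0.le]
            simp
          conv_rhs => rw [this]
          ring
      _ ≤ _ := by
          refine mul_le_mul' le_rfl ?_
          calc ∫⁻ ω, V ω ^ θ ∂P ≤ ∫⁻ ω, (A ω ^ θ + ENNReal.ofReal ε ^ θ) ∂P := by
                refine lintegral_mono fun ω => ?_
                rw [hVA]
                exact ENNReal.rpow_add_le_add_rpow _ _ hθ0.le hθ1
            _ = _ := by
                rw [lintegral_add_right _ measurable_const]
                simp
  have hlim : Tendsto (fun ε : ℝ => 2 ^ q * (maximalConst p L * ENNReal.ofReal (p / q)) ^ θ *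
        (∫⁻ ω, A ω ^ θ ∂P + ENNReal.ofReal ε ^ θ)) (𝓝[>] 0)
      (𝓝 (2 ^ q * (maximalConst p L * ENNReal.ofReal (p / q)) ^ θ *
        (∫⁻ ω, A ω ^ θ ∂P + 0))) := by
    refine ENNReal.Tendsto.const_mul (tendsto_const_nhds.add ?_) (Or.inr ?_)
    · have h1 : Tendsto (fun ε : ℝ => ENNReal.ofReal ε ^ θ) (𝓝 0) (𝓝 (ENNReal.ofReal 0 ^ θ)) :=
        ((ENNReal.continuous_rpow_const (y := θ)).comp ENNReal.continuous_ofReal).tendsto 0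
      rw [ENNReal.ofReal_zero, ENNReal.zero_rpow_of_pos hθ0] at h1
      exact h1.mono_left nhdsWithin_le_nhds
    · exact ENNReal.mul_ne_top (ENNReal.rpow_ne_top_of_nonneg hq.le (by simp))
        (ENNReal.rpow_ne_top_of_nonneg hθ0.le
          (ENNReal.mul_ne_top (maximalConst_lt_top hp L).ne ENNReal.ofReal_ne_top))
  rw [add_zero] at hlim
  exact ge_of_tendsto hlim (eventually_nhdsWithin_of_forall fun ε hε => key ε hε)

/-- The maximal inequality for simple step processes, with an exponent `q ≤ p`. -/
theorem lintegral_sup_sum_simpleIncrement_rpow_le_of_le {p q : ℝ} (hp : 1 < p) (hp2 : p ≤ 2)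
    (hq : 0 < q) (hqp : q ≤ p) {L : ℝ≥0}
    (hL : MartingaleIncrementBound.{u, w} E p L) (H : IsPoissonRandomMeasure 𝓕 P ν η)
    (hB : ∀ b, MeasurableSet (B b)) (hν : ∀ b, ν (B b) ≠ ∞)
    (hd : Pairwise (Function.onFun Disjoint B)) {τ : ℕ → ℝ≥0} (hτ : Monotone τ)
    {f : ℕ → ι → Ω → E} (hf : ∀ k b, StronglyMeasurable[𝓕 (τ k)] (f k b)) {K : ℝ≥0}
    (hK : ∀ k b ω, ‖f k b ω‖ ≤ K) (n : ℕ) :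
    ∫⁻ ω, ((Finset.range (n + 1)).sup fun j => ‖∑ k ∈ Finset.range j,
        simpleIncrement ν η B (f k) (τ k) (τ (k + 1)) ω‖ₑ) ^ q ∂P ≤
      lowerMaximalConst p q L *
        ∫⁻ ω, (∑ k ∈ Finset.range n, simpleEnergy ν B p (f k) (τ k) (τ (k + 1)) ω) ^ (q / p) ∂P := by
  rcases hqp.eq_or_lt with rfl | hlt
  · refine (H.lintegral_sup_sum_simpleIncrement_rpow_le hp hp2 hL hB hν hd hτ hf hK n).trans ?_
    rw [div_self hq.ne']
    simp only [ENNReal.rpow_one]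
    exact mul_le_mul' le_self_add le_rfl
  · refine (H.lintegral_sup_sum_simpleIncrement_rpow_le_of_lt hp hp2 hq hlt hL hB hν hd hτ hf hK
      n).trans ?_
    exact mul_le_mul' le_add_self le_rfl

end IsPoissonRandomMeasure

end

/-! ### Grids and atoms -/

/-- A finite set of times is contained in a finite grid. -/
theorem exists_monotone_grid (s : Finset ℝ≥0) :
    ∃ (τ : ℕ → ℝ≥0) (n : ℕ), Monotone τ ∧ ∀ x ∈ s, ∃ j ≤ n, τ j = x := by
  refine ⟨fun k => if h : k < s.card then s.orderEmbOfFin rfl ⟨k, h⟩ else s.sup id, s.card,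
    fun i j hij => ?_, fun x hx => ?_⟩
  · by_cases hj : j < s.card
    · simp only [hj, hij.trans_lt hj, dif_pos]
      exact (s.orderEmbOfFin rfl).monotone hij
    · simp only [hj, dif_neg, not_false_eq_true]
      by_cases hi : i < s.card
      · simp only [hi, dif_pos]
        exact Finset.le_sup (f := id) (s.orderEmbOfFin_mem rfl _)
      · simp [hi]
  · have : x ∈ Set.range (s.orderEmbOfFin rfl) := by
      rw [Finset.range_orderEmbOfFin]
      exact hx
    obtain ⟨⟨j, hj⟩, rfl⟩ := this
    exact ⟨j, hj.le, by simp [hj]⟩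

theorem sum_setLIntegral_Ioc_le {τ : ℕ → ℝ≥0} (hτ : Monotone τ) (g : ℝ≥0 → ℝ≥0∞)
    (μ : Measure ℝ≥0) (n : ℕ) :
    ∑ k ∈ Finset.range n, ∫⁻ r in Set.Ioc (τ k) (τ (k + 1)), g r ∂μ ≤ ∫⁻ r, g r ∂μ := by
  have : ∑ k ∈ Finset.range n, ∫⁻ r in Set.Ioc (τ k) (τ (k + 1)), g r ∂μ =
      ∫⁻ r in Set.Ioc (τ 0) (τ n), g r ∂μ := by
    induction n with
    | zero => simp
    | succ n ih =>
      rw [Finset.sum_range_succ, ih, ← Set.Ioc_union_Ioc_eq_Ioc (hτ n.zero_le) (hτ n.le_succ),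
        lintegral_union measurableSet_Ioc (Set.Ioc_disjoint_Ioc_of_le le_rfl)]
  rw [this]
  exact setLIntegral_le_lintegral _ _

theorem Lp_enorm_rpow {α F : Type*} [MeasurableSpace α] {μ : Measure α} [NormedAddCommGroup F]
    {p : ℝ≥0} (hp : 0 < p) (f : Lp F (p : ℝ≥0∞) μ) :
    ‖f‖ₑ ^ (p : ℝ) = ∫⁻ x, ‖f x‖ₑ ^ (p : ℝ) ∂μ := by
  rw [Lp.enorm_def, eLpNorm_nnreal_pow_eq_lintegral hp.ne']

section Atoms

variable {S ι : Type*}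

/-- The atoms of the ring of sets generated by the sets `B i`: the points of `⋃ i, B i` that lie in
`B i` for exactly the indices `i ∈ b`. -/
def setAtom (B : ι → Set S) (b : Finset ι) : Set S :=
  {x | (∃ i, x ∈ B i) ∧ ∀ i, x ∈ B i ↔ i ∈ b}

theorem setAtom_pairwise_disjoint (B : ι → Set S) :
    Pairwise (Function.onFun Disjoint (setAtom B)) := by
  intro b b' hbb'
  refine Set.disjoint_left.2 fun x hx hx' => hbb' ?_
  ext i
  rw [← hx.2 i, hx'.2 i]

variable [Fintype ι]

theorem sum_indicator_setAtom [DecidableEq ι] {M : Type*} [AddCommMonoid M] (B : ι → Set S)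
    (g : Finset ι → M) (hg : g ∅ = 0) (x : S) {b : Finset ι} (hb : ∀ i, x ∈ B i ↔ i ∈ b) :
    ∑ b, (setAtom B b).indicator (fun _ => g b) x = g b := by
  by_cases hx : ∃ i, x ∈ B i
  · rw [Finset.sum_eq_single b]
    · rw [Set.indicator_of_mem (show x ∈ setAtom B b from ⟨hx, hb⟩)]
    · intro b' _ hb'
      refine Set.indicator_of_notMem (fun h => hb' ?_) _
      ext i
      rw [← h.2 i, hb i]
    · simp
  · have hb0 : b = ∅ := by
      refine Finset.eq_empty_of_forall_notMem fun i hi => hx ⟨i, (hb i).2 hi⟩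
    rw [hb0, hg]
    exact Finset.sum_eq_zero fun b' _ => Set.indicator_of_notMem (fun h => hx h.1) _

variable [MeasurableSpace S] {B : ι → Set S}

theorem measurableSet_setAtom (hB : ∀ i, MeasurableSet (B i)) (b : Finset ι) :
    MeasurableSet (setAtom B b) := by
  have h1 : MeasurableSet {x | ∃ i, x ∈ B i} := by
    simp only [Set.ofPred_exists]
    exact MeasurableSet.iUnion hB
  have h2 : MeasurableSet {x | ∀ i, x ∈ B i ↔ i ∈ b} := by
    simp only [Set.ofPred_forall]
    refine MeasurableSet.iInter fun i => ?_
    by_cases hi : i ∈ b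
    · convert hB i using 1
      ext x
      simp [hi]
    · convert (hB i).compl using 1
      ext x
      simp [hi]
  exact h1.inter h2

theorem measure_setAtom_ne_top {ν : Measure S} (hν : ∀ i, ν (B i) ≠ ∞) (b : Finset ι) :
    ν (setAtom B b) ≠ ∞ := by
  have h : setAtom B b ⊆ ⋃ i, B i := fun x hx => Set.mem_iUnion.2 hx.1
  refine ((measure_mono h).trans_lt ((measure_iUnion_le _).trans_lt ?_)).ne
  rw [tsum_fintype]
  exact ENNReal.sum_lt_top.2 fun i _ => (hν i).lt_top

theorem measure_eq_sum_setAtom [DecidableEq ι] (μ : Measure S) (hB : ∀ i, MeasurableSet (B i))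
    (i : ι) : μ (B i) = ∑ b with i ∈ b, μ (setAtom B b) := by
  have h : B i = ⋃ b ∈ Finset.univ.filter (fun b : Finset ι => i ∈ b), setAtom B b := by
    classical
    ext x
    simp only [Set.mem_iUnion, Finset.mem_filter, Finset.mem_univ, true_and, exists_prop]
    constructor
    · intro hx
      exact ⟨Finset.univ.filter fun j => x ∈ B j, by simpa using hx, ⟨i, hx⟩, by simp⟩
    · rintro ⟨b, hib, hx⟩
      exact (hx.2 i).2 hib
  conv_lhs => rw [h]
  exact measure_biUnion_finset (fun b _ b' _ hbb' => setAtom_pairwise_disjoint B hbb')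
    fun b _ => measurableSet_setAtom hB b

/-- The norm in `L^p` of a simple function, computed on the atoms. -/
theorem enorm_sum_indicatorConstLp_rpow [DecidableEq ι] {ν : Measure S} {E : Type*}
    [NormedAddCommGroup E] {p : ℝ≥0} (hp : 0 < p) (hB : ∀ i, MeasurableSet (B i))
    (hν : ∀ i, ν (B i) ≠ ∞) (d : ι → E) :
    ‖∑ i, indicatorConstLp (p : ℝ≥0∞) (hB i) (hν i) (d i)‖ₑ ^ (p : ℝ) =
      ∑ b, ν (setAtom B b) * ‖∑ i ∈ b, d i‖ₑ ^ (p : ℝ) := by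
  classical
  have hp' : (0 : ℝ) < p := hp
  rw [Lp_enorm_rpow hp]
  have hae : (fun x => ‖(∑ i, indicatorConstLp (p : ℝ≥0∞) (hB i) (hν i) (d i) :
      Lp E (p : ℝ≥0∞) ν) x‖ₑ ^ (p : ℝ)) =ᵐ[ν]
      fun x => ∑ b, (setAtom B b).indicator (fun _ => ‖∑ i ∈ b, d i‖ₑ ^ (p : ℝ)) x := by
    filter_upwards [Lp.coeFn_finsetSum Finset.univ fun i =>
        indicatorConstLp (p : ℝ≥0∞) (hB i) (hν i) (d i),
      ae_all_iff.2 fun i => indicatorConstLp_coeFn (p := (p : ℝ≥0∞)) (hs := hB i) (hμs := hν i)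
        (c := d i)] with x h1 h2
    have hb : ∀ i, x ∈ B i ↔ i ∈ Finset.univ.filter fun j => x ∈ B j := by simp
    rw [sum_indicator_setAtom B (fun b => ‖∑ i ∈ b, d i‖ₑ ^ (p : ℝ))
      (by simp [ENNReal.zero_rpow_of_pos hp']) x hb, h1]
    simp only [Finset.sum_apply, h2, Finset.sum_filter, Set.indicator_apply]
  rw [lintegral_congr_ae hae, lintegral_finsetSum]
  · refine Finset.sum_congr rfl fun b _ => ?_
    rw [lintegral_indicator_const (measurableSet_setAtom hB b), mul_comm]
  · exact fun b _ => measurable_const.indicator (measurableSet_setAtom hB b)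

theorem compPoisson_eq_sum_setAtom [DecidableEq ι] {Ω : Type*} [MeasurableSpace Ω] {ν : Measure S}
    {η : Ω → Measure (S × ℝ≥0)} (hB : ∀ i, MeasurableSet (B i)) (hν : ∀ i, ν (B i) ≠ ∞) {ω : Ω}
    (hω : ∀ i, ∀ t : ℝ≥0, η ω (B i ×ˢ Set.Ioc 0 t) < ∞) (i : ι) (t : ℝ≥0) :
    compPoisson ν η (B i) t ω = ∑ b with i ∈ b, compPoisson ν η (setAtom B b) t ω := by
  -- the additivity of `U ↦ η ω (U × (0, t])` is that of a measure on `S`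
  set μ : Measure S := ((η ω).restrict (Set.univ ×ˢ Set.Ioc 0 t)).map Prod.fst with hμ
  have hμU : ∀ U : Set S, MeasurableSet U → η ω (U ×ˢ Set.Ioc 0 t) = μ U := fun U hU => by
    rw [hμ, Measure.map_apply measurable_fst hU, Measure.restrict_apply (measurable_fst hU)]
    congr 1
    ext x
    simp
  have hμf : ∀ i, μ (B i) ≠ ∞ := fun i => by
    rw [← hμU _ (hB i)]
    exact (hω i t).ne
  simp only [compPoisson]
  rw [Finset.sum_sub_distrib, ← Finset.mul_sum, hμU _ (hB i), measure_eq_sum_setAtom μ hB i,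
    measure_eq_sum_setAtom ν hB i, ENNReal.toReal_sum fun b _ => measure_setAtom_ne_top hμf b,
    ENNReal.toReal_sum fun b _ => measure_setAtom_ne_top hν b]
  congr 1
  refine Finset.sum_congr rfl fun b _ => ?_
  rw [hμU _ (measurableSet_setAtom hB b)]

end Atoms

/-! ### Integral processes of elementary integrands -/

namespace IsCadlagPath

variable {E : Type*} [NormedAddCommGroup E] {f g : ℝ≥0 → E}

theorem sum {ι : Type*} {f : ι → ℝ≥0 → E} (s : Finset ι) (hf : ∀ i ∈ s, IsCadlagPath (f i)) :
    IsCadlagPath fun t => ∑ i ∈ s, f i t := by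
  intro t
  choose! l hl using fun i hi => (hf i hi t).2
  exact ⟨tendsto_finsetSum s fun i hi => (hf i hi t).1, ∑ i ∈ s, l i, tendsto_finsetSum _ hl⟩

theorem comp_min (hf : IsCadlagPath f) (c : ℝ≥0) : IsCadlagPath fun t => f (min c t) := by
  intro t
  constructor
  · exact (hf (min c t)).1.comp (f := fun t => min c t) (by fun_prop)
      fun s hs => min_le_min_left c hs
  · rcases le_or_gt t c with h | h
    · obtain ⟨l, hl⟩ := (hf t).2
      refine ⟨l, hl.congr' ?_⟩
      filter_upwards [self_mem_nhdsWithin] with s hs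
      rw [min_eq_right (le_of_lt (lt_of_lt_of_le hs h))]
    · refine ⟨f c, tendsto_const_nhds.congr' ?_⟩
      filter_upwards [mem_nhdsWithin_of_mem_nhds (Ioi_mem_nhds h)] with s hs
      rw [min_eq_left (le_of_lt hs)]

theorem smul_const [NormedSpace ℝ E] {f : ℝ≥0 → ℝ} (hf : IsCadlagPath f) (c : E) :
    IsCadlagPath fun t => f t • c := by
  intro t
  obtain ⟨l, hl⟩ := (hf t).2
  exact ⟨(hf t).1.smul continuousWithinAt_const, l • c, hl.smul_const c⟩

theorem sub (hf : IsCadlagPath f) (hg : IsCadlagPath g) : IsCadlagPath fun t => f t - g t := by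
  intro t
  obtain ⟨l, hl⟩ := (hf t).2
  obtain ⟨l', hl'⟩ := (hg t).2
  exact ⟨(hf t).1.sub (hg t).1, l - l', hl.sub hl'⟩

end IsCadlagPath

/-- A time after which an elementary integrand vanishes. -/
noncomputable def ElementaryIntegrand.horizon {S Ω E : Type*} [MeasurableSpace S]
    {mΩ : MeasurableSpace Ω} {𝓕 : Filtration ℝ≥0 mΩ} {ν : Measure S}
    (e : ElementaryIntegrand E 𝓕 ν) : ℝ≥0 :=
  Finset.univ.sup e.hi

theorem ElementaryIntegrand.hi_le_horizon {S Ω E : Type*} [MeasurableSpace S]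
    {mΩ : MeasurableSpace Ω} {𝓕 : Filtration ℝ≥0 mΩ} {ν : Measure S}
    (e : ElementaryIntegrand E 𝓕 ν) (i : Fin e.n) : e.hi i ≤ e.horizon :=
  Finset.le_sup (f := e.hi) (Finset.mem_univ i)

namespace ElementaryIntegrand

section Algebra

variable {S : Type*} [MeasurableSpace S] {Ω : Type*} [mΩ : MeasurableSpace Ω]
  {E : Type*} [NormedAddCommGroup E]
  {𝓕 : Filtration ℝ≥0 mΩ} {ν : Measure S}

/-- The sum of two elementary integrands, by concatenation. -/
def add (e e' : ElementaryIntegrand E 𝓕 ν) : ElementaryIntegrand E 𝓕 ν where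
  n := e.n + e'.n
  lo := Fin.append e.lo e'.lo
  hi := Fin.append e.hi e'.hi
  lo_le_hi i := by
    refine Fin.addCases (fun i => ?_) (fun i => ?_) i
    · simpa using e.lo_le_hi i
    · simpa using e'.lo_le_hi i
  A := Fin.append e.A e'.A
  measurable_A i := by
    refine Fin.addCases (fun i => ?_) (fun i => ?_) i
    · rw [Fin.append_left, Fin.append_left]
      exact e.measurable_A i
    · rw [Fin.append_right, Fin.append_right]
      exact e'.measurable_A i
  B := Fin.append e.B e'.B
  measurable_B i := by
    refine Fin.addCases (fun i => ?_) (fun i => ?_) i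
    · simpa using e.measurable_B i
    · simpa using e'.measurable_B i
  finite_B i := by
    refine Fin.addCases (fun i => ?_) (fun i => ?_) i
    · simpa using e.finite_B i
    · simpa using e'.finite_B i
  c := Fin.append e.c e'.c

/-- The negative of an elementary integrand. -/
def neg (e : ElementaryIntegrand E 𝓕 ν) : ElementaryIntegrand E 𝓕 ν :=
  { e with c := fun i => -e.c i }

/-- The restriction of an elementary integrand to the times in `(0, T]`.  The maximum with `lo`
makes the intervals that start after `T` empty. -/
def trunc (e : ElementaryIntegrand E 𝓕 ν) (T : ℝ≥0) : ElementaryIntegrand E 𝓕 ν :=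
  { e with
    hi := fun i => max (e.lo i) (min (e.hi i) T)
    lo_le_hi := fun _ => le_max_left _ _ }

/-- The elementary integrand without summands. -/
def zero : ElementaryIntegrand E 𝓕 ν where
  n := 0
  lo := Fin.elim0
  hi := Fin.elim0
  lo_le_hi i := i.elim0
  A := Fin.elim0
  measurable_A i := i.elim0
  B := Fin.elim0
  measurable_B i := i.elim0
  finite_B i := i.elim0
  c := Fin.elim0

/-- The elementary integrand `1_{(l, h]} 1_A 1_B c`. -/
def single {l h : ℝ≥0} (hlh : l ≤ h) {A : Set Ω} (hA : MeasurableSet[𝓕 l] A) {B : Set S}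
    (hB : MeasurableSet B) (hν : ν B ≠ ∞) (c : E) : ElementaryIntegrand E 𝓕 ν where
  n := 1
  lo _ := l
  hi _ := h
  lo_le_hi _ := hlh
  A _ := A
  measurable_A _ := hA
  B _ := B
  measurable_B _ := hB
  finite_B _ := hν
  c _ := c

theorem toIntegrand_add (e e' : ElementaryIntegrand E 𝓕 ν) (p : ℝ≥0∞) (r : ℝ≥0) (ω : Ω) :
    (e.add e').toIntegrand p r ω = e.toIntegrand p r ω + e'.toIntegrand p r ω := by
  refine (Fin.sum_univ_add _).trans (congrArg₂ _ (Finset.sum_congr rfl fun i _ => ?_)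
    (Finset.sum_congr rfl fun i _ => ?_))
  · simp only [add, Fin.append_left]
  · simp only [add, Fin.append_right]

theorem toIntegrand_neg (e : ElementaryIntegrand E 𝓕 ν) (p : ℝ≥0∞) (r : ℝ≥0) (ω : Ω) :
    e.neg.toIntegrand p r ω = -e.toIntegrand p r ω := by
  simp only [toIntegrand, neg]
  rw [← Finset.sum_neg_distrib]
  refine Finset.sum_congr rfl fun i _ => ?_
  have h : indicatorConstLp p (e.measurable_B i) (e.finite_B i) (-e.c i) =
      -indicatorConstLp p (e.measurable_B i) (e.finite_B i) (e.c i) := by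
    ext
    filter_upwards [indicatorConstLp_coeFn (p := p) (hs := e.measurable_B i)
      (hμs := e.finite_B i) (c := e.c i), indicatorConstLp_coeFn (p := p)
      (hs := e.measurable_B i) (hμs := e.finite_B i) (c := -e.c i),
      Lp.coeFn_neg (indicatorConstLp p (e.measurable_B i) (e.finite_B i) (e.c i))] with x h1 h2 h3
    rw [h2, h3, Pi.neg_apply, h1]
    by_cases hx : x ∈ e.B i <;> simp [hx]
  by_cases hz : (r, ω) ∈ Set.Ioc (e.lo i) (e.hi i) ×ˢ e.A i
  · rw [Set.indicator_of_mem hz, Set.indicator_of_mem hz, h]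
  · rw [Set.indicator_of_notMem hz, Set.indicator_of_notMem hz, neg_zero]

theorem toIntegrand_trunc (e : ElementaryIntegrand E 𝓕 ν) (T : ℝ≥0) (p : ℝ≥0∞) (r : ℝ≥0)
    (ω : Ω) : (e.trunc T).toIntegrand p r ω =
      (Set.Ioc 0 T).indicator (fun r' => e.toIntegrand p r' ω) r := by
  classical
  have hset : ∀ i, r ∈ Set.Ioc (e.lo i) (max (e.lo i) (min (e.hi i) T)) ↔
      r ∈ Set.Ioc (e.lo i) (e.hi i) ∧ r ∈ Set.Ioc 0 T := fun i => by
    simp only [Set.mem_Ioc, le_max_iff, le_min_iff]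
    constructor
    · rintro ⟨h1, h2 | h2⟩
      · exact absurd h1 (not_lt.2 h2)
      · exact ⟨⟨h1, h2.1⟩, lt_of_le_of_lt zero_le h1, h2.2⟩
    · rintro ⟨⟨h1, h2⟩, h3, h4⟩
      exact ⟨h1, Or.inr ⟨h2, h4⟩⟩
  simp only [toIntegrand, trunc]
  by_cases hr : r ∈ Set.Ioc 0 T
  · rw [Set.indicator_of_mem hr]
    refine Finset.sum_congr rfl fun i _ => ?_
    simp only [Set.indicator_apply, Set.mem_prod, hset i, hr, and_true]
  · rw [Set.indicator_of_notMem hr]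
    refine Finset.sum_eq_zero fun i _ => ?_
    exact Set.indicator_of_notMem (fun h => hr ((hset i).1 h.1).2) _

theorem toIntegrand_single {l h : ℝ≥0} (hlh : l ≤ h) {A : Set Ω} (hA : MeasurableSet[𝓕 l] A)
    {B : Set S} (hB : MeasurableSet B) (hν : ν B ≠ ∞) (c : E) (p : ℝ≥0∞) (r : ℝ≥0) (ω : Ω) :
    (single hlh hA hB hν c).toIntegrand p r ω =
      (Set.Ioc l h ×ˢ A).indicator (fun _ => indicatorConstLp p hB hν c) (r, ω) := by
  exact Fin.sum_univ_one _

theorem toIntegrand_zero (p : ℝ≥0∞) (r : ℝ≥0) (ω : Ω) :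
    (zero : ElementaryIntegrand E 𝓕 ν).toIntegrand p r ω = 0 := by
  exact Fin.sum_univ_zero _

theorem stronglyMeasurable_toIntegrand (e : ElementaryIntegrand E 𝓕 ν) (p : ℝ≥0∞)
    [Fact (1 ≤ p)] : StronglyMeasurable fun z : ℝ≥0 × Ω => e.toIntegrand p z.1 z.2 := by
  refine Finset.stronglyMeasurable_fun_sum _ fun i _ => ?_
  exact stronglyMeasurable_const.indicator
    (measurableSet_Ioc.prod (𝓕.le _ _ (e.measurable_A i)))

end Algebra

variable {S : Type v} [MeasurableSpace S] {Ω : Type w} [mΩ : MeasurableSpace Ω]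
  {E : Type u} [NormedAddCommGroup E] [NormedSpace ℝ E]
  {𝓕 : Filtration ℝ≥0 mΩ} {ν : Measure S}

/-- The process `t ↦ I(1_{(0, t]} e)` of integrals of an elementary integrand, written with
compensated Poisson processes; this version is adapted without completing the filtration. -/
noncomputable def process (e : ElementaryIntegrand E 𝓕 ν) (η : Ω → Measure (S × ℝ≥0)) (t : ℝ≥0)
    (ω : Ω) : E :=
  ∑ i, (e.A i).indicator (fun ω' => (compPoisson ν η (e.B i) (min (e.hi i) t) ω' -
    compPoisson ν η (e.B i) (min (e.lo i) t) ω') • e.c i) ω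

theorem process_add (e e' : ElementaryIntegrand E 𝓕 ν) (η : Ω → Measure (S × ℝ≥0)) (t : ℝ≥0)
    (ω : Ω) : (e.add e').process η t ω = e.process η t ω + e'.process η t ω := by
  refine (Fin.sum_univ_add _).trans (congrArg₂ _ (Finset.sum_congr rfl fun i _ => ?_)
    (Finset.sum_congr rfl fun i _ => ?_))
  · simp only [add, Fin.append_left]
  · simp only [add, Fin.append_right]

theorem process_neg (e : ElementaryIntegrand E 𝓕 ν) (η : Ω → Measure (S × ℝ≥0)) (t : ℝ≥0)
    (ω : Ω) : e.neg.process η t ω = -e.process η t ω := by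
  simp only [process, neg]
  rw [← Finset.sum_neg_distrib]
  refine Finset.sum_congr rfl fun i _ => ?_
  by_cases hA : ω ∈ e.A i <;> simp [hA]

theorem process_trunc (e : ElementaryIntegrand E 𝓕 ν) (η : Ω → Measure (S × ℝ≥0)) {t T : ℝ≥0}
    (htT : t ≤ T) (ω : Ω) : (e.trunc T).process η t ω = e.process η t ω := by
  simp only [process, trunc]
  refine Finset.sum_congr rfl fun i _ => ?_
  have hi := e.lo_le_hi i
  rcases le_or_gt t (e.lo i) with h | h
  · rw [min_eq_right h, min_eq_right (h.trans (le_max_left _ _)), min_eq_right (h.trans hi)]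
  · rw [max_eq_right (le_min hi (h.le.trans htT)), min_assoc, min_eq_right htT]

theorem stronglyMeasurable_process {P : Measure Ω} {η : Ω → Measure (S × ℝ≥0)}
    (H : IsPoissonRandomMeasure 𝓕 P ν η) (e : ElementaryIntegrand E 𝓕 ν) (t : ℝ≥0) :
    StronglyMeasurable[𝓕 t] (e.process η t) := by
  refine Finset.stronglyMeasurable_fun_sum _ fun i _ => ?_
  rcases le_or_gt t (e.lo i) with h | h
  · rw [min_eq_right h, min_eq_right (h.trans (e.lo_le_hi i))]
    simpa using stronglyMeasurable_const
  · refine StronglyMeasurable.indicator ?_ (𝓕.mono h.le _ (e.measurable_A i))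
    refine StronglyMeasurable.smul_const (Measurable.stronglyMeasurable (Measurable.sub ?_ ?_)) _
    · exact (H.measurable_compPoisson (e.measurable_B i) _).mono (𝓕.mono (min_le_right _ _)) le_rfl
    · exact (H.measurable_compPoisson (e.measurable_B i) _).mono (𝓕.mono (min_le_right _ _)) le_rfl

/-- After the last time of the integrand, `process` is the integral. -/
theorem ae_process_eq_integral {P : Measure Ω} {η : Ω → Measure (S × ℝ≥0)}
    (H : IsPoissonRandomMeasure 𝓕 P ν η) (e : ElementaryIntegrand E 𝓕 ν) :
    ∀ᵐ ω ∂P, ∀ T, (∀ i, e.hi i ≤ T) → e.integral P η ω = e.process η T ω := by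
  filter_upwards [ae_all_iff.2 fun i => H.compPoisson_sub_ae (e.measurable_B i) (e.finite_B i)]
    with ω hω T hT
  classical
  simp only [integral, process]
  refine Finset.sum_congr rfl fun i _ => ?_
  rw [min_eq_left (hT i), min_eq_left ((e.lo_le_hi i).trans (hT i))]
  simp only [Set.indicator_apply]
  split_ifs with hA
  · rw [hω i _ _ (e.lo_le_hi i), compensated, H.lintegral_Ioc (e.measurable_B i)]
    congr 2
    rw [ENNReal.toReal_mul, ENNReal.coe_toReal, NNReal.coe_sub (e.lo_le_hi i), mul_comm]
  · rfl

theorem ae_integral_trunc {P : Measure Ω} {η : Ω → Measure (S × ℝ≥0)}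
    (H : IsPoissonRandomMeasure 𝓕 P ν η) (e : ElementaryIntegrand E 𝓕 ν) (t : ℝ≥0) :
    (e.trunc t).integral P η =ᵐ[P] e.process η t := by
  filter_upwards [(e.trunc t).ae_process_eq_integral H] with ω hω
  rw [hω (max t e.horizon) fun i => ?_]
  · simp only [process, trunc]
    refine Finset.sum_congr rfl fun i _ => ?_
    have h1 := e.lo_le_hi i
    have h2 := e.hi_le_horizon i
    have h3 : e.lo i ≤ max t e.horizon := (h1.trans h2).trans (le_max_right _ _)
    rw [min_eq_left h3]
    rcases le_or_gt t (e.lo i) with h | h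
    · rw [max_eq_left ((min_le_right _ _).trans h), min_eq_left h3, min_eq_right h,
        min_eq_right (h.trans h1)]
      simp
    · rw [max_eq_right (le_min h1 h.le), min_eq_left h.le, min_eq_left]
      exact (min_le_right _ _).trans (le_max_left _ _)
  · simp only [trunc]
    exact max_le (((e.lo_le_hi i).trans (e.hi_le_horizon i)).trans (le_max_right _ _))
      ((min_le_right _ _).trans (le_max_left _ _))

theorem ae_isCadlagPath_process {P : Measure Ω} {η : Ω → Measure (S × ℝ≥0)}
    (H : IsPoissonRandomMeasure 𝓕 P ν η) (e : ElementaryIntegrand E 𝓕 ν) :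
    ∀ᵐ ω ∂P, IsCadlagPath fun t => e.process η t ω := by
  filter_upwards [ae_all_iff.2 fun i =>
    H.ae_isCadlagPath_compPoisson (e.measurable_B i) (e.finite_B i)] with ω hω
  refine IsCadlagPath.sum _ fun i _ => ?_
  by_cases hA : ω ∈ e.A i
  · simp only [Set.indicator_of_mem hA]
    exact (((hω i).comp_min _).sub ((hω i).comp_min _)).smul_const _
  · simp only [Set.indicator_of_notMem hA]
    exact fun t => ⟨continuousWithinAt_const, 0, tendsto_const_nhds⟩

/-- The maximal inequality for elementary integrands.  On the intervals of a grid that contains all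
times of the integrand and of `F`, and on the atoms of its sets `B i`, the integrand is a simple
step process. -/
theorem lintegral_sup_process_rpow_le [CompleteSpace E] {P : Measure Ω} [IsProbabilityMeasure P]
    {η : Ω → Measure (S × ℝ≥0)} (H : IsPoissonRandomMeasure 𝓕 P ν η) {p q : ℝ≥0}
    (hp : 1 < p) (hp2 : p ≤ 2) (hq : 0 < q) (hqp : q ≤ p) {L : ℝ≥0}
    (hL : MartingaleIncrementBound.{u, w} E p L) (e : ElementaryIntegrand E 𝓕 ν) (F : Finset ℝ≥0) :
    ∫⁻ ω, (F.sup fun t => ‖e.process η t ω‖ₑ) ^ (q : ℝ) ∂P ≤ lowerMaximalConst p q L *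
      ∫⁻ ω, (∫⁻ r, ‖e.toIntegrand (p : ℝ≥0∞) r ω‖ₑ ^ (p : ℝ) ∂lebesgueNN) ^ ((q : ℝ) / p) ∂P := by
  classical
  have hp0 : 0 < p := zero_lt_one.trans hp
  obtain ⟨τ, n, hτ, hgrid⟩ := exists_monotone_grid
    (insert 0 (F ∪ (Finset.univ.image e.lo ∪ Finset.univ.image e.hi)))
  have hF : ∀ t ∈ F, ∃ j ≤ n, τ j = t := fun t ht => hgrid t (by simp [ht])
  have hτ0 : τ 0 = 0 := by
    obtain ⟨j, -, hj⟩ := hgrid 0 (by simp)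
    exact le_antisymm (hj ▸ hτ j.zero_le) zero_le
  have hsep : ∀ x, (∃ j ≤ n, τ j = x) → ∀ k, x ≤ τ k ∨ τ (k + 1) ≤ x := by
    rintro x ⟨j, -, rfl⟩ k
    rcases le_or_gt j k with h | h
    · exact Or.inl (hτ h)
    · exact Or.inr (hτ h)
  have hlo : ∀ i k, e.lo i ≤ τ k ∨ τ (k + 1) ≤ e.lo i := fun i => hsep _ (hgrid _ (by simp))
  have hhi : ∀ i k, e.hi i ≤ τ k ∨ τ (k + 1) ≤ e.hi i := fun i => hsep _ (hgrid _ (by simp))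
  -- the coefficients of the integrand on `(τ k, τ (k + 1)]` and the atom of `b`
  set d : ℕ → Fin e.n → Ω → E := fun k i ω =>
    if e.lo i ≤ τ k ∧ τ k < e.hi i then (e.A i).indicator (fun _ => e.c i) ω else 0 with hd
  set f : ℕ → Finset (Fin e.n) → Ω → E := fun k b ω => ∑ i ∈ b, d k i ω with hf
  have hdm : ∀ k i, StronglyMeasurable[𝓕 (τ k)] (d k i) := fun k i => by
    by_cases h : e.lo i ≤ τ k ∧ τ k < e.hi i
    · simp only [hd, h, and_self, if_true]
      exact stronglyMeasurable_const.indicator (𝓕.mono h.1 _ (e.measurable_A i))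
    · simp only [hd, h, if_false]
      exact stronglyMeasurable_const
  have hfm : ∀ k b, StronglyMeasurable[𝓕 (τ k)] (f k b) := fun k b =>
    Finset.stronglyMeasurable_fun_sum _ fun i _ => hdm k i
  have hfK : ∀ k b ω, ‖f k b ω‖ ≤ (∑ i, ‖e.c i‖₊ : ℝ≥0) := fun k b ω => by
    rw [NNReal.coe_sum]
    refine (norm_sum_le _ _).trans (le_trans (Finset.sum_le_sum fun i _ => ?_)
      (Finset.sum_le_univ_sum_of_nonneg fun i => norm_nonneg (e.c i)))
    simp only [hd]
    split_ifs
    · exact norm_indicator_le_norm_self _ _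
    · simp
  have hint : ∀ k ω, ∀ r ∈ Set.Ioc (τ k) (τ (k + 1)), e.toIntegrand (p : ℝ≥0∞) r ω =
      ∑ i, indicatorConstLp (p : ℝ≥0∞) (e.measurable_B i) (e.finite_B i) (d k i ω) := by
    intro k ω r hr
    refine Finset.sum_congr rfl fun i _ => ?_
    have hiff : r ∈ Set.Ioc (e.lo i) (e.hi i) ↔ e.lo i ≤ τ k ∧ τ k < e.hi i := by
      constructor
      · intro h
        refine ⟨(hlo i k).resolve_right fun h' => ?_, hr.1.trans_le h.2⟩
        exact absurd (hr.2.trans h') (not_le.2 h.1)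
      · intro h
        refine ⟨h.1.trans_lt hr.1, hr.2.trans ((hhi i k).resolve_left (not_le.2 h.2))⟩
    have hz : indicatorConstLp (p : ℝ≥0∞) (e.measurable_B i) (e.finite_B i) (0 : E) = 0 := by
      ext
      filter_upwards [indicatorConstLp_coeFn (p := (p : ℝ≥0∞)) (hs := e.measurable_B i)
        (hμs := e.finite_B i) (c := (0 : E)), Lp.coeFn_zero E (p : ℝ≥0∞) ν] with x h1 h2
      rw [h1, h2]
      simp
    by_cases hA : ω ∈ e.A i
    · by_cases hr' : e.lo i ≤ τ k ∧ τ k < e.hi i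
      · rw [Set.indicator_of_mem (Set.mk_mem_prod (hiff.2 hr') hA)]
        simp [hd, hr', hA]
      · rw [Set.indicator_of_notMem (fun h => hr' (hiff.1 h.1))]
        simp only [hd, hr', if_false, hz]
    · rw [Set.indicator_of_notMem (fun h => hA h.2)]
      simp only [hd, Set.indicator_of_notMem hA, ite_self, hz]
  have henergy : ∀ ω, ∑ k ∈ Finset.range n,
      simpleEnergy ν (setAtom e.B) p (f k) (τ k) (τ (k + 1)) ω ≤
      ∫⁻ r, ‖e.toIntegrand (p : ℝ≥0∞) r ω‖ₑ ^ (p : ℝ) ∂lebesgueNN := by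
    intro ω
    refine le_trans (le_of_eq (Finset.sum_congr rfl fun k _ => ?_))
      (sum_setLIntegral_Ioc_le hτ _ lebesgueNN n)
    rw [setLIntegral_congr_fun (g := fun _ => ∑ b, ν (setAtom e.B b) * ‖f k b ω‖ₑ ^ (p : ℝ))
      measurableSet_Ioc]
    · rw [setLIntegral_const, lebesgueNN_Ioc, simpleEnergy, mul_comm]
    · intro r hr
      simp only []
      rw [hint k ω r hr, enorm_sum_indicatorConstLp_rpow hp0]
  have hproc : ∀ᵐ ω ∂P, ∀ j, e.process η (τ j) ω = ∑ k ∈ Finset.range j,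
      simpleIncrement ν η (setAtom e.B) (f k) (τ k) (τ (k + 1)) ω := by
    filter_upwards [ae_all_iff.2 fun i => H.ae_lt_top (e.measurable_B i) (e.finite_B i)] with ω hω j
    have hstep : ∀ k, e.process η (τ (k + 1)) ω - e.process η (τ k) ω =
        simpleIncrement ν η (setAtom e.B) (f k) (τ k) (τ (k + 1)) ω := by
      intro k
      have h1 : simpleIncrement ν η (setAtom e.B) (f k) (τ k) (τ (k + 1)) ω =
          ∑ i, (compPoisson ν η (e.B i) (τ (k + 1)) ω - compPoisson ν η (e.B i) (τ k) ω) •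
            d k i ω := by
        simp only [simpleIncrement, hf, Finset.smul_sum]
        simp_rw [compPoisson_eq_sum_setAtom e.measurable_B e.finite_B hω, ← Finset.sum_sub_distrib,
          Finset.sum_smul]
        exact Finset.sum_comm' (by simp)
      rw [h1, process, process, ← Finset.sum_sub_distrib]
      refine Finset.sum_congr rfl fun i _ => ?_
      by_cases hA : ω ∈ e.A i
      · simp only [hd, Set.indicator_of_mem hA, ← sub_smul]
        have h2 := hτ k.le_succ
        have h3 := e.lo_le_hi i
        rcases hlo i k with h | h
        · rw [min_eq_left h, min_eq_left (h.trans h2)]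
          rcases hhi i k with h' | h'
          · rw [min_eq_left h', min_eq_left (h'.trans h2), if_neg (fun hh => not_lt.2 h' hh.2)]
            simp
          · rw [min_eq_right h', min_eq_right (h2.trans h')]
            by_cases h4 : τ k < e.hi i
            · rw [if_pos ⟨h, h4⟩]
              congr 1
              ring
            · have h5 : τ k = τ (k + 1) := le_antisymm h2 (h'.trans (not_lt.1 h4))
              rw [← h5]
              simp
        · rw [min_eq_right h, min_eq_right (h2.trans h), min_eq_right (h.trans h3),
            min_eq_right ((h2.trans h).trans h3)]
          rcases h2.eq_or_lt with h4 | h4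
          · rw [← h4]; simp
          · rw [if_neg (fun hh => absurd (h4.trans_le h) (not_lt.2 hh.1))]
            simp
      · simp only [hd, Set.indicator_of_notMem hA, ite_self, smul_zero, sub_zero]
    simp_rw [← hstep]
    rw [Finset.sum_range_sub (fun k => e.process η (τ k) ω), hτ0]
    simp [process]
  refine le_trans ?_ ((H.lintegral_sup_sum_simpleIncrement_rpow_le_of_le (p := p) (q := q)
    (by exact_mod_cast hp) (by exact_mod_cast hp2) (by exact_mod_cast hq) (by exact_mod_cast hqp) hL
    (measurableSet_setAtom e.measurable_B) (measure_setAtom_ne_top e.finite_B)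
    (setAtom_pairwise_disjoint e.B) hτ hfm hfK n).trans ?_)
  · refine lintegral_mono_ae ?_
    filter_upwards [hproc] with ω hω
    gcongr
    refine Finset.sup_le fun t ht => ?_
    obtain ⟨j, hj, rfl⟩ := hF t ht
    rw [hω j]
    exact Finset.le_sup (f := fun j => ‖∑ k ∈ Finset.range j,
      simpleIncrement ν η (setAtom e.B) (f k) (τ k) (τ (k + 1)) ω‖ₑ)
      (Finset.mem_range.2 (Nat.lt_succ_of_le hj))
  · gcongr with ω
    exact henergy ω

end ElementaryIntegrand

/-! ### Density of elementary integrands -/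

section Density

variable {S : Type*} [MeasurableSpace S] {Ω : Type*} [mΩ : MeasurableSpace Ω]
  {E : Type*} [NormedAddCommGroup E] {𝓕 : Filtration ℝ≥0 mΩ} {ν : Measure S} {p : ℝ≥0∞}
  [hp : Fact (1 ≤ p)] {μ : Measure (ℝ≥0 × Ω)}

theorem predictable_le_prod (𝓕 : Filtration ℝ≥0 mΩ) :
    𝓕.predictable ≤ (Prod.instMeasurableSpace : MeasurableSpace (ℝ≥0 × Ω)) :=
  measurableSpace_le_predictable_of_measurableSet
    (fun _ hA => (measurableSet_singleton _).prod (𝓕.le _ _ hA))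
    (fun i _ hA => measurableSet_Ioi.prod (𝓕.le i _ hA))

/-- The generators of the predictable `σ`-algebra are closed under intersection. -/
theorem isPiSystem_predictable (𝓕 : Filtration ℝ≥0 mΩ) :
    IsPiSystem ({s : Set (ℝ≥0 × Ω) | ∃ A, MeasurableSet[𝓕 ⊥] A ∧ s = {⊥} ×ˢ A} ∪
      {s | ∃ i A, MeasurableSet[𝓕 i] A ∧ s = Set.Ioi i ×ˢ A}) := by
  have h0 : ∀ i A A', ({⊥} ×ˢ A : Set (ℝ≥0 × Ω)) ∩ (Set.Ioi i ×ˢ A') = {⊥} ×ˢ ∅ := by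
    intro i A A'
    rw [Set.prod_inter_prod, Set.singleton_inter_eq_empty.2 (by simp)]
    simp
  rintro s (⟨A, hA, rfl⟩ | ⟨i, A, hA, rfl⟩) t (⟨A', hA', rfl⟩ | ⟨j, A', hA', rfl⟩) -
  · exact Or.inl ⟨A ∩ A', @MeasurableSet.inter _ (𝓕 ⊥) _ _ hA hA',
      by rw [Set.prod_inter_prod, Set.inter_self]⟩
  · exact Or.inl ⟨∅, @MeasurableSet.empty _ (𝓕 ⊥), h0 _ _ _⟩
  · exact Or.inl ⟨∅, @MeasurableSet.empty _ (𝓕 ⊥), by rw [Set.inter_comm, h0]⟩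
  · refine Or.inr ⟨i ⊔ j, A ∩ A', ?_, by rw [Set.prod_inter_prod, Set.Ioi_inter_Ioi]⟩
    exact (𝓕.mono le_sup_left _ hA).inter (𝓕.mono le_sup_right _ hA')

variable (𝓕 μ) in
/-- `f` is a limit of elementary integrands in `L^p(μ; L^p(S, ν; E))`. -/
def ElementaryApproximable (f : ℝ≥0 × Ω → Lp E p ν) : Prop :=
  AEStronglyMeasurable f μ ∧ ∀ ε : ℝ≥0∞, ε ≠ 0 → ∃ e : ElementaryIntegrand E 𝓕 ν,
    eLpNorm (fun z => e.toIntegrand p z.1 z.2 - f z) p μ ≤ ε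

namespace ElementaryApproximable

variable {f g : ℝ≥0 × Ω → Lp E p ν}

theorem congr_ae (hf : ElementaryApproximable 𝓕 μ f) (hfg : f =ᵐ[μ] g) :
    ElementaryApproximable 𝓕 μ g := by
  refine ⟨hf.1.congr hfg, fun ε hε => ?_⟩
  obtain ⟨e, he⟩ := hf.2 ε hε
  refine ⟨e, (eLpNorm_congr_ae ?_).trans_le he⟩
  filter_upwards [hfg] with z hz
  rw [hz]

theorem of_toIntegrand (e : ElementaryIntegrand E 𝓕 ν) :
    ElementaryApproximable 𝓕 μ fun z => e.toIntegrand p z.1 z.2 :=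
  ⟨(e.stronglyMeasurable_toIntegrand p).aestronglyMeasurable, fun ε _ => ⟨e, by simp⟩⟩

theorem add (hf : ElementaryApproximable 𝓕 μ f) (hg : ElementaryApproximable 𝓕 μ g) :
    ElementaryApproximable 𝓕 μ (f + g) := by
  refine ⟨hf.1.add hg.1, fun ε hε => ?_⟩
  obtain ⟨e, he⟩ := hf.2 (ε / 2) (by simpa using hε)
  obtain ⟨e', he'⟩ := hg.2 (ε / 2) (by simpa using hε)
  refine ⟨e.add e', ?_⟩
  have h : (fun z : ℝ≥0 × Ω => (e.add e').toIntegrand p z.1 z.2 - (f + g) z) =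
      (fun z => e.toIntegrand p z.1 z.2 - f z) + fun z => e'.toIntegrand p z.1 z.2 - g z := by
    ext1 z
    rw [e.toIntegrand_add]
    simp only [Pi.add_apply]
    abel
  rw [h]
  refine (eLpNorm_add_le ((e.stronglyMeasurable_toIntegrand p).aestronglyMeasurable.sub hf.1)
    ((e'.stronglyMeasurable_toIntegrand p).aestronglyMeasurable.sub hg.1) hp.out).trans ?_
  rw [← ENNReal.add_halves ε]
  exact add_le_add he he'

theorem neg (hf : ElementaryApproximable 𝓕 μ f) : ElementaryApproximable 𝓕 μ (-f) := by
  refine ⟨hf.1.neg, fun ε hε => ?_⟩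
  obtain ⟨e, he⟩ := hf.2 ε hε
  refine ⟨e.neg, ?_⟩
  have h : (fun z : ℝ≥0 × Ω => e.neg.toIntegrand p z.1 z.2 - (-f) z) =
      -(fun z => e.toIntegrand p z.1 z.2 - f z) := by
    ext1 z
    rw [e.toIntegrand_neg]
    simp only [Pi.neg_apply]
    abel
  rw [h, eLpNorm_neg]
  exact he

/-- Approximability passes to limits. -/
theorem of_forall_eLpNorm_le (hf : AEStronglyMeasurable f μ)
    (h : ∀ ε : ℝ≥0∞, ε ≠ 0 → ∃ g, ElementaryApproximable 𝓕 μ g ∧ eLpNorm (g - f) p μ ≤ ε) :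
    ElementaryApproximable 𝓕 μ f := by
  refine ⟨hf, fun ε hε => ?_⟩
  obtain ⟨g, hg, hgf⟩ := h (ε / 2) (by simpa using hε)
  obtain ⟨e, he⟩ := hg.2 (ε / 2) (by simpa using hε)
  refine ⟨e, ?_⟩
  have h : (fun z : ℝ≥0 × Ω => e.toIntegrand p z.1 z.2 - f z) =
      (fun z => e.toIntegrand p z.1 z.2 - g z) + (g - f) := by
    ext1 z
    simp
  rw [h]
  refine (eLpNorm_add_le ((e.stronglyMeasurable_toIntegrand p).aestronglyMeasurable.sub hg.1)
    (hg.1.sub hf) hp.out).trans ?_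
  rw [← ENNReal.add_halves ε]
  exact add_le_add he hgf

/-- A constant function is approximable, because `μ` lives on a bounded time interval. -/
theorem const {T : ℝ≥0} (hμ : ∀ᵐ z ∂μ, z.1 ∈ Set.Ioc 0 T) {B : Set S} (hB : MeasurableSet B)
    (hν : ν B ≠ ∞) (x : E) :
    ElementaryApproximable 𝓕 μ fun _ => indicatorConstLp p hB hν x := by
  refine (of_toIntegrand (p := p) (𝓕 := 𝓕) (.single (zero_le : 0 ≤ T) MeasurableSet.univ hB hν
    x)).congr_ae ?_
  filter_upwards [hμ] with z hz
  rw [ElementaryIntegrand.toIntegrand_single,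
    Set.indicator_of_mem (Set.mk_mem_prod hz (Set.mem_univ _))]

theorem indicator_indicatorConstLp (hp' : p ≠ ∞) [IsFiniteMeasure μ] {T : ℝ≥0}
    (hμ : ∀ᵐ z ∂μ, z.1 ∈ Set.Ioc 0 T) {s : Set (ℝ≥0 × Ω)} (hs : MeasurableSet[𝓕.predictable] s)
    {B : Set S} (hB : MeasurableSet B) (hν : ν B ≠ ∞) (x : E) :
    ElementaryApproximable 𝓕 μ (s.indicator fun _ => indicatorConstLp p hB hν x) := by
  have hp0 : 0 < p := zero_lt_one.trans_le hp.out
  have hle := predictable_le_prod 𝓕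
  have hempty : ElementaryApproximable 𝓕 μ
      ((∅ : Set (ℝ≥0 × Ω)).indicator fun _ => indicatorConstLp p hB hν x) := by
    refine (of_toIntegrand (p := p) (ElementaryIntegrand.zero (𝓕 := 𝓕))).congr_ae
      (ae_of_all _ fun z => ?_)
    simp [ElementaryIntegrand.toIntegrand_zero]
  induction s, hs using MeasurableSpace.induction_on_inter (m := 𝓕.predictable) rfl
    (isPiSystem_predictable 𝓕) with
  | empty => exact hempty
  | basic t ht =>
    rcases ht with ⟨A, hA, rfl⟩ | ⟨i, A, hA, rfl⟩
    -- sets at time `0` are null, and `(i, ∞)` is cut off at a time after `T`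
    · refine hempty.congr_ae ?_
      filter_upwards [hμ] with z hz
      rw [Set.indicator_of_notMem (Set.notMem_empty z), Set.indicator_of_notMem]
      rintro ⟨h, -⟩
      exact hz.1.ne' h
    · refine (of_toIntegrand (p := p) (𝓕 := 𝓕) (.single (le_max_left i T) hA hB hν
        x)).congr_ae ?_
      filter_upwards [hμ] with z hz
      rw [ElementaryIntegrand.toIntegrand_single]
      have : z ∈ Set.Ioc i (max i T) ×ˢ A ↔ z ∈ Set.Ioi i ×ˢ A := by
        simp only [Set.mem_prod, Set.mem_Ioc, Set.mem_Ioi, le_max_iff, hz.2, or_true, and_true]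
      by_cases h : z ∈ Set.Ioi i ×ˢ A
      · rw [Set.indicator_of_mem h, Set.indicator_of_mem (this.2 h)]
      · rw [Set.indicator_of_notMem h, Set.indicator_of_notMem (fun h' => h (this.1 h'))]
  | compl t ht ih =>
    refine ((const hμ hB hν x).add ih.neg).congr_ae (ae_of_all _ fun z => ?_)
    by_cases h : z ∈ t <;> simp [h]
  | iUnion t hd hm ih =>
    set c := indicatorConstLp p hB hν x with hc
    have hacc : ∀ n, ElementaryApproximable 𝓕 μ ((Set.accumulate t n).indicator fun _ => c) := by
      intro n
      induction n with
      | zero =>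
        have : Set.accumulate t 0 = t 0 := by
          simp [Set.accumulate_def]
        rw [this]
        exact ih 0
      | succ n ihn =>
        rw [Set.accumulate_succ, Set.indicator_union_of_disjoint]
        · exact ihn.add (ih (n + 1))
        · exact Set.disjoint_accumulate hd n.lt_succ_self
    have hmU : MeasurableSet (⋃ n, t n) := MeasurableSet.iUnion fun n => hle _ (hm n)
    have hmacc : ∀ n, MeasurableSet (Set.accumulate t n) := fun n =>
      MeasurableSet.biUnion (Set.to_countable _) fun i _ => hle _ (hm i)
    refine of_forall_eLpNorm_le
      ((stronglyMeasurable_const.indicator hmU).aestronglyMeasurable) fun ε hε => ?_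
    have hlim : Tendsto (fun n => ‖c‖ₑ * (μ (⋃ n, t n) - μ (Set.accumulate t n)) ^ (1 / p.toReal))
        atTop (𝓝 (‖c‖ₑ * (μ (⋃ n, t n) - μ (⋃ n, t n)) ^ (1 / p.toReal))) := by
      refine ENNReal.Tendsto.const_mul (Tendsto.ennrpow_const _ ?_) (Or.inr enorm_ne_top)
      exact ENNReal.Tendsto.sub tendsto_const_nhds tendsto_measure_iUnion_accumulate
        (Or.inl (measure_ne_top _ _))
    rw [tsub_self, ENNReal.zero_rpow_of_pos (by
      have := ENNReal.toReal_pos hp0.ne' hp'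
      positivity), mul_zero] at hlim
    obtain ⟨n, hn⟩ := (hlim.eventually (ge_mem_nhds (pos_iff_ne_zero.2 hε))).exists
    refine ⟨_, hacc n, le_trans (le_of_eq ?_) hn⟩
    have hsub : Set.accumulate t n ⊆ ⋃ n, t n := Set.accumulate_subset_iUnion n
    have h : (Set.accumulate t n).indicator (fun _ => c) - (⋃ n, t n).indicator (fun _ => c) =
        -((⋃ n, t n) \ Set.accumulate t n).indicator fun _ => c := by
      rw [Set.indicator_sdiff hsub]
      abel
    rw [h, eLpNorm_neg, eLpNorm_indicator_const (hmU.diff (hmacc n)) hp0.ne' hp',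
      measure_sdiff hsub (hmacc n).nullMeasurableSet (measure_ne_top _ _)]

theorem indicator_const (hp' : p ≠ ∞) [IsFiniteMeasure μ] {T : ℝ≥0}
    (hμ : ∀ᵐ z ∂μ, z.1 ∈ Set.Ioc 0 T) {s : Set (ℝ≥0 × Ω)} (hs : MeasurableSet[𝓕.predictable] s)
    (c : Lp E p ν) : ElementaryApproximable 𝓕 μ (s.indicator fun _ => c) := by
  have hp0 : 0 < p := zero_lt_one.trans_le hp.out
  have hms : MeasurableSet s := predictable_le_prod 𝓕 _ hs
  refine Lp.induction hp' (motive := fun c => ElementaryApproximable 𝓕 μ (s.indicator fun _ => c))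
    ?_ ?_ ?_ c
  · intro x B hB hν
    rw [Lp.simpleFunc.coe_indicatorConst]
    exact indicator_indicatorConstLp hp' hμ hs hB hν.ne x
  · intro f g hf hg _ h1 h2
    rw [show (fun _ : ℝ≥0 × Ω => hf.toLp f + hg.toLp g) =
      (fun _ => hf.toLp f) + fun _ => hg.toLp g from rfl, Set.indicator_add']
    exact h1.add h2
  · refine isClosed_of_closure_subset fun c hc => ?_
    refine of_forall_eLpNorm_le
      ((stronglyMeasurable_const.indicator hms).aestronglyMeasurable) fun ε hε => ?_
    have hlim : Tendsto (fun c' : Lp E p ν => ‖c' - c‖ₑ * μ s ^ (1 / p.toReal)) (𝓝 c)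
        (𝓝 (‖c - c‖ₑ * μ s ^ (1 / p.toReal))) := by
      refine ENNReal.Tendsto.mul_const ?_ (Or.inr (ENNReal.rpow_ne_top_of_nonneg (by positivity)
        (measure_ne_top _ _)))
      exact (Continuous.tendsto (by fun_prop) c)
    rw [sub_self, enorm_zero, zero_mul] at hlim
    obtain ⟨c', hc', hc''⟩ := (mem_closure_iff_frequently.1 hc).and_eventually
      (hlim.eventually (ge_mem_nhds (pos_iff_ne_zero.2 hε))) |>.exists
    refine ⟨_, hc', le_trans (le_of_eq ?_) hc''⟩
    rw [← Set.indicator_sub', ← eLpNorm_indicator_const hms hp0.ne' hp']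
    rfl

theorem isClosed_setOf_Lp :
    IsClosed {f : Lp (Lp E p ν) p μ | ElementaryApproximable 𝓕 μ f} := by
  refine isClosed_of_closure_subset fun f hf => ?_
  refine of_forall_eLpNorm_le (Lp.aestronglyMeasurable f) fun ε hε => ?_
  obtain ⟨g, hg, hgf⟩ := EMetric.mem_closure_iff.1 hf ε (pos_iff_ne_zero.2 hε)
  refine ⟨g, hg, ?_⟩
  rw [edist_comm, Lp.edist_def] at hgf
  exact hgf.le

/-- Every predictable process in `L^p` is a limit of elementary integrands. -/
theorem of_memLp [NormedSpace ℝ E] (hp' : p ≠ ∞) [IsFiniteMeasure μ] {T : ℝ≥0}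
    (hμ : ∀ᵐ z ∂μ, z.1 ∈ Set.Ioc 0 T) (hf : MemLp f p μ)
    (hfm : StronglyMeasurable[𝓕.predictable] f) : ElementaryApproximable 𝓕 μ f := by
  refine MemLp.induction_stronglyMeasurable (predictable_le_prod 𝓕) hp'
    (ElementaryApproximable 𝓕 μ) ?_ ?_ ?_ ?_ hf hfm.aestronglyMeasurable
  · intro c s hs _
    exact indicator_const hp' hμ hs c
  · intro f g _ _ _ _ _ h1 h2
    exact h1.add h2
  · exact isClosed_setOf_Lp.preimage continuous_subtype_val
  · intro f g hfg _ h
    exact h.congr_ae hfg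

end ElementaryApproximable

end Density

/-- Density of elementary integrands in `𝓜^p`, for integrands that vanish after time `T`. -/
theorem IsMpLoc.exists_elementaryIntegrand {S : Type*} [MeasurableSpace S] {Ω : Type*}
    [mΩ : MeasurableSpace Ω] {E : Type*} [NormedAddCommGroup E] [NormedSpace ℝ E]
    {𝓕 : Filtration ℝ≥0 mΩ} {P : Measure Ω} [IsProbabilityMeasure P] {ν : Measure S} {p : ℝ≥0}
    [hp : Fact (1 ≤ (p : ℝ≥0∞))] {ξ : ℝ≥0 → Ω → Lp E (p : ℝ≥0∞) ν} (hξ : IsMpLoc p 𝓕 P ν ξ)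
    (T : ℝ≥0) {ε : ℝ≥0∞} (hε : ε ≠ 0) :
    ∃ e : ElementaryIntegrand E 𝓕 ν,
      ∫⁻ ω, ∫⁻ r, ‖e.toIntegrand (p : ℝ≥0∞) r ω -
        (Set.Ioc 0 T).indicator (fun r' => ξ r' ω) r‖ₑ ^ (p : ℝ) ∂lebesgueNN ∂P ≤ ε := by
  have hp1 : 1 ≤ p := by exact_mod_cast hp.out
  have hp0 : 0 < p := zero_lt_one.trans_le hp1
  set μ : Measure (ℝ≥0 × Ω) := (lebesgueNN.restrict (Set.Ioc 0 T)).prod P with hμdef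
  have : IsFiniteMeasure (lebesgueNN.restrict (Set.Ioc 0 T)) := ⟨by
    rw [Measure.restrict_apply_univ, lebesgueNN_Ioc]
    exact ENNReal.coe_lt_top⟩
  have hμ : ∀ᵐ z ∂μ, z.1 ∈ Set.Ioc 0 T :=
    Measure.quasiMeasurePreserving_fst.ae (ae_restrict_mem measurableSet_Ioc)
  have hξm : StronglyMeasurable (Function.uncurry ξ) := hξ.predictable.mono (predictable_le_prod 𝓕)
  have hnorm : ∀ f : ℝ≥0 × Ω → Lp E (p : ℝ≥0∞) ν, StronglyMeasurable f →
      eLpNorm f p μ ^ (p : ℝ) = ∫⁻ ω, ∫⁻ r in Set.Ioc 0 T, ‖f (r, ω)‖ₑ ^ (p : ℝ) ∂lebesgueNN ∂P := by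
    intro f hf
    rw [eLpNorm_nnreal_pow_eq_lintegral hp0.ne', hμdef, lintegral_prod_symm]
    exact (hf.enorm.pow_const _).aemeasurable
  have hmem : MemLp (Function.uncurry ξ) p μ := by
    refine ⟨hξm.aestronglyMeasurable, ?_⟩
    have h := hξ.moment T
    simp_rw [← Lp_enorm_rpow hp0] at h
    rw [← ENNReal.rpow_lt_top_iff_of_pos (show (0 : ℝ) < p from hp0), hnorm _ hξm]
    exact h
  obtain ⟨e, he⟩ := (ElementaryApproximable.of_memLp (𝓕 := 𝓕) ENNReal.coe_ne_top hμ hmem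
    hξ.predictable).2 (ε ^ (1 / (p : ℝ))) (by
      have : (0 : ℝ) < p := hp0
      simp [ENNReal.rpow_eq_zero_iff, hε, this])
  refine ⟨e.trunc T, ?_⟩
  calc ∫⁻ ω, ∫⁻ r, ‖(e.trunc T).toIntegrand (p : ℝ≥0∞) r ω -
        (Set.Ioc 0 T).indicator (fun r' => ξ r' ω) r‖ₑ ^ (p : ℝ) ∂lebesgueNN ∂P
      = ∫⁻ ω, ∫⁻ r in Set.Ioc 0 T, ‖e.toIntegrand (p : ℝ≥0∞) r ω - ξ r ω‖ₑ ^ (p : ℝ)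
          ∂lebesgueNN ∂P := by
        refine lintegral_congr fun ω => ?_
        rw [← lintegral_indicator measurableSet_Ioc]
        refine lintegral_congr fun r => ?_
        rw [e.toIntegrand_trunc]
        by_cases hr : r ∈ Set.Ioc 0 T
        · simp only [Set.indicator_of_mem hr]
        · simp only [Set.indicator_of_notMem hr, sub_zero, enorm_zero]
          exact ENNReal.zero_rpow_of_pos hp0
    _ = eLpNorm (fun z : ℝ≥0 × Ω => e.toIntegrand (p : ℝ≥0∞) z.1 z.2 - Function.uncurry ξ z) p μ
          ^ (p : ℝ) := by
        exact (hnorm _ ((e.stronglyMeasurable_toIntegrand _).sub hξm)).symm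
    _ ≤ (ε ^ (1 / (p : ℝ))) ^ (p : ℝ) := by gcongr
    _ = ε := by
        rw [← ENNReal.rpow_mul, one_div, inv_mul_cancel₀ (by exact_mod_cast hp0.ne'),
          ENNReal.rpow_one]

/-! ### Paths -/

/-- Locally uniform limits of càdlàg functions are càdlàg. -/
theorem IsCadlagPath.of_tendstoUniformlyOn {E : Type*} [NormedAddCommGroup E] [CompleteSpace E]
    {f : ℕ → ℝ≥0 → E} {g : ℝ≥0 → E} (hf : ∀ k, IsCadlagPath (f k))
    (hu : ∀ N : ℕ, TendstoUniformlyOn f g atTop (Set.Iic (N : ℝ≥0))) : IsCadlagPath g := by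
  intro t
  obtain ⟨N, hN⟩ := exists_nat_gt t
  have hN' : Set.Iic (N : ℝ≥0) ∈ 𝓝 t := Iic_mem_nhds hN
  constructor
  · refine continuousWithinAt_of_locally_uniform_approx_of_continuousWithinAt Set.self_mem_Ici
      fun u hu' => ?_
    obtain ⟨k, hk⟩ := (hu N u hu').exists
    exact ⟨_, mem_nhdsWithin_of_mem_nhds hN', f k, (hf k t).1, hk⟩
  · rcases (𝓝[<] t).eq_or_neBot with h | h
    · exact ⟨0, by rw [h]; exact tendsto_bot⟩
    · refine cauchy_map_iff_exists_tendsto.1 (Metric.cauchy_iff.2 ⟨inferInstance, fun ε hε => ?_⟩)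
      obtain ⟨k, hk⟩ := (Metric.tendstoUniformlyOn_iff.1 (hu N) (ε / 3) (by positivity)).exists
      obtain ⟨l, hl⟩ := (hf k t).2
      obtain ⟨s, hs, hs'⟩ := (Metric.cauchy_iff.1 hl.cauchy_map).2 (ε / 3) (by positivity)
      refine ⟨g '' ((f k ⁻¹' s) ∩ Set.Iic (N : ℝ≥0)),
        image_mem_map (inter_mem hs (mem_nhdsWithin_of_mem_nhds hN')), ?_⟩
      rintro _ ⟨x, ⟨hx, hxN⟩, rfl⟩ _ ⟨y, ⟨hy, hyN⟩, rfl⟩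
      have h1 := hk x hxN
      have h2 := hk y hyN
      have h3 := hs' _ hx _ hy
      have h4 := dist_triangle4 (g x) (f k x) (f k y) (g y)
      rw [dist_comm (f k y)] at h4
      linarith

/-- Times that are dense in `[0, T]` and include `T`. -/
noncomputable def denseTimes (T : ℝ≥0) : ℕ → ℝ≥0
  | 0 => T
  | n + 1 => min (TopologicalSpace.denseSeq ℝ≥0 n) T

theorem denseTimes_le (T : ℝ≥0) (n : ℕ) : denseTimes T n ≤ T := by
  cases n
  · exact le_rfl
  · exact min_le_right _ _

theorem IsCadlagPath.enorm_le_iSup_denseTimes {E : Type*} [NormedAddCommGroup E] {f : ℝ≥0 → E}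
    (hf : IsCadlagPath f) {t T : ℝ≥0} (htT : t ≤ T) : ‖f t‖ₑ ≤ ⨆ n, ‖f (denseTimes T n)‖ₑ := by
  set M := ⨆ n, ‖f (denseTimes T n)‖ₑ with hM
  have hle : ∀ n, ‖f (denseTimes T n)‖ₑ ≤ M := fun n => le_iSup (fun n => ‖f (denseTimes T n)‖ₑ) n
  rcases htT.eq_or_lt with rfl | hlt
  · exact hle 0
  have hcl : IsClosed {x : E | ‖x‖ₑ ≤ M} := isClosed_le continuous_enorm continuous_const
  have htend : Tendsto f (𝓝[>] t) (𝓝 (f t)) := continuousWithinAt_Ioi_iff_Ici.2 (hf t).1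
  refine hcl.mem_of_frequently_of_tendsto ?_ htend
  intro hev
  obtain ⟨u, hu, hsub⟩ := (mem_nhdsGT_iff_exists_Ioo_subset' hlt).1 hev
  obtain ⟨x, ⟨n, rfl⟩, hx⟩ := (TopologicalSpace.denseRange_denseSeq ℝ≥0).exists_between
    (lt_min (Set.mem_Ioi.1 hu) hlt)
  refine hsub ⟨hx.1, hx.2.trans_le (min_le_left _ _)⟩ ?_
  have : denseTimes T (n + 1) = TopologicalSpace.denseSeq ℝ≥0 n :=
    min_eq_left (hx.2.le.trans (min_le_right _ _))
  rw [← this]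
  exact hle (n + 1)

/-- Bounds for suprema over finite sets of times pass to the supremum over `[0, T]`. -/
theorem lintegral_iSup_Icc_rpow_le {Ω : Type*} [MeasurableSpace Ω] {P : Measure Ω} {E : Type*}
    [NormedAddCommGroup E] {X : ℝ≥0 → Ω → E} (hX : ∀ t, AEStronglyMeasurable (X t) P)
    (hc : ∀ᵐ ω ∂P, IsCadlagPath fun t => X t ω) {T : ℝ≥0} {q : ℝ} (hq : 0 < q) {K : ℝ≥0∞}
    (hK : ∀ F : Finset ℝ≥0, (∀ t ∈ F, t ≤ T) → ∫⁻ ω, (F.sup fun t => ‖X t ω‖ₑ) ^ q ∂P ≤ K) :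
    ∫⁻ ω, (⨆ t ∈ Set.Icc 0 T, ‖X t ω‖ₑ) ^ q ∂P ≤ K := by
  classical
  set F : ℕ → Finset ℝ≥0 := fun n => (Finset.range n).image (denseTimes T) with hF
  have hFmono : Monotone F := fun i j hij => Finset.image_subset_image
    (Finset.range_subset_range.2 hij)
  calc ∫⁻ ω, (⨆ t ∈ Set.Icc 0 T, ‖X t ω‖ₑ) ^ q ∂P
      ≤ ∫⁻ ω, ⨆ n, ((F n).sup fun t => ‖X t ω‖ₑ) ^ q ∂P := by
        refine lintegral_mono_ae ?_
        filter_upwards [hc] with ω hω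
        have h1 : ⨆ t ∈ Set.Icc 0 T, ‖X t ω‖ₑ ≤ ⨆ n, (F n).sup fun t => ‖X t ω‖ₑ := by
          refine iSup₂_le fun t ht => (hω.enorm_le_iSup_denseTimes ht.2).trans ?_
          refine iSup_le fun n => le_iSup_of_le (n + 1) ?_
          exact Finset.le_sup (f := fun t => ‖X t ω‖ₑ)
            (Finset.mem_image_of_mem _ (Finset.mem_range.2 n.lt_succ_self))
        refine (ENNReal.rpow_le_rpow h1 hq.le).trans (le_of_eq ?_)
        exact (ENNReal.orderIsoRpow q hq).map_iSup _
    _ = ⨆ n, ∫⁻ ω, ((F n).sup fun t => ‖X t ω‖ₑ) ^ q ∂P := by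
        refine lintegral_iSup' (fun n => AEMeasurable.pow_const ?_ q) (ae_of_all _ fun ω i j hij =>
          ENNReal.rpow_le_rpow (Finset.sup_mono (hFmono hij)) hq.le)
        simp_rw [Finset.sup_eq_iSup]
        exact AEMeasurable.biSup _ (F n).countable_toSet fun t _ => (hX t).enorm
    _ ≤ K := by
        refine iSup_le fun n => hK (F n) fun t ht => ?_
        obtain ⟨m, -, rfl⟩ := Finset.mem_image.1 ht
        exact denseTimes_le T m

/-! ### The energy of an integrand -/

section Energy

variable {Ω : Type*} {G : Type*} [NormedAddCommGroup G]

/-- The integrand `1_{(0, t]} ξ`. -/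
noncomputable def timeCut (ξ : ℝ≥0 → Ω → G) (t r : ℝ≥0) (ω : Ω) : G :=
  (Set.Ioc 0 t).indicator (fun r' => ξ r' ω) r

theorem lintegral_timeCut {p : ℝ≥0} (hp : 0 < p) (ξ : ℝ≥0 → Ω → G) (t : ℝ≥0) (ω : Ω) :
    ∫⁻ r, ‖timeCut ξ t r ω‖ₑ ^ (p : ℝ) ∂lebesgueNN =
      ∫⁻ r in Set.Ioc 0 t, ‖ξ r ω‖ₑ ^ (p : ℝ) ∂lebesgueNN := by
  rw [← lintegral_indicator measurableSet_Ioc]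
  refine lintegral_congr fun r => ?_
  by_cases hr : r ∈ Set.Ioc 0 t
  · simp only [timeCut, Set.indicator_of_mem hr]
  · simp only [timeCut, Set.indicator_of_notMem hr, enorm_zero]
    exact ENNReal.zero_rpow_of_pos hp

variable [mΩ : MeasurableSpace Ω]

/-- The `p`-th power `𝔼 ∫_0^∞ ‖ζ(r)‖^p dr` of the norm of an integrand. -/
noncomputable def energy (p : ℝ≥0) (P : Measure Ω) (ζ : ℝ≥0 → Ω → G) : ℝ≥0∞ :=
  ∫⁻ ω, ∫⁻ r, ‖ζ r ω‖ₑ ^ (p : ℝ) ∂lebesgueNN ∂P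

theorem energy_mono {p : ℝ≥0} {P : Measure Ω} {f g : ℝ≥0 → Ω → G}
    (h : ∀ r ω, ‖f r ω‖ₑ ≤ ‖g r ω‖ₑ) : energy p P f ≤ energy p P g :=
  lintegral_mono fun ω => lintegral_mono fun r => ENNReal.rpow_le_rpow (h r ω) p.coe_nonneg

theorem lintegral_enorm_rpow_le_add {p : ℝ≥0} (hp : 1 ≤ p) {f g h : ℝ≥0 → Ω → G}
    (hg : StronglyMeasurable (Function.uncurry g)) {ω : Ω}
    (hle : ∀ r, ‖f r ω‖ₑ ≤ ‖g r ω‖ₑ + ‖h r ω‖ₑ) :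
    ∫⁻ r, ‖f r ω‖ₑ ^ (p : ℝ) ∂lebesgueNN ≤ 2 ^ ((p : ℝ) - 1) *
      (∫⁻ r, ‖g r ω‖ₑ ^ (p : ℝ) ∂lebesgueNN + ∫⁻ r, ‖h r ω‖ₑ ^ (p : ℝ) ∂lebesgueNN) := by
  have hp' : (1 : ℝ) ≤ p := by exact_mod_cast hp
  have hgm : Measurable fun r => ‖g r ω‖ₑ ^ (p : ℝ) :=
    ((hg.comp_measurable (measurable_id.prodMk measurable_const)).enorm).pow_const _
  rw [← lintegral_add_left hgm, ← lintegral_const_mul' _ _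
    (ENNReal.rpow_ne_top_of_nonneg (by linarith) (by simp))]
  refine lintegral_mono fun r => ?_
  exact (ENNReal.rpow_le_rpow (hle r) p.coe_nonneg).trans
    (ENNReal.rpow_add_le_mul_rpow_add_rpow _ _ hp')

theorem measurable_lintegral_enorm_rpow {p : ℝ≥0} {g : ℝ≥0 → Ω → G}
    (hg : StronglyMeasurable (Function.uncurry g)) :
    Measurable fun ω => ∫⁻ r, ‖g r ω‖ₑ ^ (p : ℝ) ∂lebesgueNN :=
  Measurable.lintegral_prod_left' (f := fun z : ℝ≥0 × Ω => ‖g z.1 z.2‖ₑ ^ (p : ℝ))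
    (hg.enorm.pow_const _)

theorem energy_le_add {p : ℝ≥0} (hp : 1 ≤ p) {P : Measure Ω} {f g h : ℝ≥0 → Ω → G}
    (hg : StronglyMeasurable (Function.uncurry g))
    (hle : ∀ r ω, ‖f r ω‖ₑ ≤ ‖g r ω‖ₑ + ‖h r ω‖ₑ) :
    energy p P f ≤ 2 ^ ((p : ℝ) - 1) * (energy p P g + energy p P h) := by
  have hp' : (1 : ℝ) ≤ p := by exact_mod_cast hp
  rw [energy, energy, energy, ← lintegral_add_left (measurable_lintegral_enorm_rpow hg),
    ← lintegral_const_mul' _ _ (ENNReal.rpow_ne_top_of_nonneg (by linarith) (by simp))]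
  exact lintegral_mono fun ω => lintegral_enorm_rpow_le_add hp hg fun r => hle r ω

theorem stronglyMeasurable_timeCut {ξ : ℝ≥0 → Ω → G}
    (hξ : StronglyMeasurable (Function.uncurry ξ)) (t : ℝ≥0) :
    StronglyMeasurable (Function.uncurry (timeCut ξ t)) := by
  have : Function.uncurry (timeCut ξ t) =
      (Prod.fst ⁻¹' Set.Ioc 0 t).indicator (Function.uncurry ξ) := by
    ext1 z
    obtain ⟨r, ω⟩ := z
    by_cases hr : r ∈ Set.Ioc 0 t
    · rw [Set.indicator_of_mem (show (r, ω) ∈ Prod.fst ⁻¹' Set.Ioc 0 t from hr)]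
      exact Set.indicator_of_mem hr (fun r' => ξ r' ω)
    · rw [Set.indicator_of_notMem (show (r, ω) ∉ Prod.fst ⁻¹' Set.Ioc 0 t from hr)]
      exact Set.indicator_of_notMem hr (fun r' => ξ r' ω)
  rw [this]
  exact hξ.indicator (measurable_fst measurableSet_Ioc)

end Energy

section

variable {S : Type v} [MeasurableSpace S] {Ω : Type w} [mΩ : MeasurableSpace Ω]
  {E : Type u} [NormedAddCommGroup E]
  {𝓕 : Filtration ℝ≥0 mΩ} {P : Measure Ω} {ν : Measure S} {η : Ω → Measure (S × ℝ≥0)} {p : ℝ≥0}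
  [hp : Fact (1 ≤ (p : ℝ≥0∞))] {ξ : ℝ≥0 → Ω → Lp E (p : ℝ≥0∞) ν}

theorem IsMpLoc.stronglyMeasurable (hξ : IsMpLoc p 𝓕 P ν ξ) :
    StronglyMeasurable (Function.uncurry ξ) :=
  hξ.predictable.mono (predictable_le_prod 𝓕)

theorem IsMpLoc.energy_timeCut_lt_top (hp0 : 0 < p) (hξ : IsMpLoc p 𝓕 P ν ξ) (t : ℝ≥0) :
    energy p P (timeCut ξ t) < ∞ := by
  have h := hξ.moment t
  simp_rw [← Lp_enorm_rpow hp0] at h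
  rw [energy]
  simp_rw [lintegral_timeCut hp0]
  exact h

theorem ElementaryIntegrand.stronglyMeasurable_uncurry_toIntegrand
    (e : ElementaryIntegrand E 𝓕 ν) :
    StronglyMeasurable (Function.uncurry (e.toIntegrand (p : ℝ≥0∞))) :=
  e.stronglyMeasurable_toIntegrand p

variable [NormedSpace ℝ E] [CompleteSpace E] [IsProbabilityMeasure P]

/-- The maximal inequality with exponent `p` for a difference of elementary integrands. -/
theorem lintegral_sup_process_sub_rpow_le (H : IsPoissonRandomMeasure 𝓕 P ν η)
    (hp1 : 1 < p) (hp2 : p ≤ 2) {L : ℝ≥0} (hL : MartingaleIncrementBound.{u, w} E p L)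
    (e e' : ElementaryIntegrand E 𝓕 ν) (T : ℝ≥0) (F : Finset ℝ≥0) (hF : ∀ t ∈ F, t ≤ T) :
    ∫⁻ ω, (F.sup fun t => ‖e.process η t ω - e'.process η t ω‖ₑ) ^ (p : ℝ) ∂P ≤
      lowerMaximalConst p p L * energy p P (timeCut (fun r ω => e.toIntegrand (p : ℝ≥0∞) r ω -
        e'.toIntegrand (p : ℝ≥0∞) r ω) T) := by
  have hp0 : 0 < p := zero_lt_one.trans hp1
  have h := ((e.add e'.neg).trunc T).lintegral_sup_process_rpow_le H hp1 hp2 hp0 le_rfl hL F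
  rw [div_self (by exact_mod_cast hp0.ne')] at h
  simp only [ENNReal.rpow_one] at h
  refine le_trans (le_of_eq (lintegral_congr fun ω => ?_)) (h.trans (le_of_eq ?_))
  · congr 1
    refine Finset.sup_congr rfl fun t ht => ?_
    rw [ElementaryIntegrand.process_trunc _ _ (hF t ht), ElementaryIntegrand.process_add,
      ElementaryIntegrand.process_neg, sub_eq_add_neg]
  · congr 1
    refine lintegral_congr fun ω => lintegral_congr fun r => ?_
    rw [ElementaryIntegrand.toIntegrand_trunc, timeCut]
    simp_rw [ElementaryIntegrand.toIntegrand_add, ElementaryIntegrand.toIntegrand_neg,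
      sub_eq_add_neg]

/-- The integral of elementary integrands is continuous from `𝓜^p` to `L^p`. -/
theorem lintegral_integral_sub_rpow_le (H : IsPoissonRandomMeasure 𝓕 P ν η)
    (hp1 : 1 < p) (hp2 : p ≤ 2) {L : ℝ≥0} (hL : MartingaleIncrementBound.{u, w} E p L)
    (e e' : ElementaryIntegrand E 𝓕 ν) :
    ∫⁻ ω, ‖e.integral P η ω - e'.integral P η ω‖ₑ ^ (p : ℝ) ∂P ≤
      lowerMaximalConst p p L * energy p P (fun r ω => e.toIntegrand (p : ℝ≥0∞) r ω -
        e'.toIntegrand (p : ℝ≥0∞) r ω) := by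
  set T := max e.horizon e'.horizon
  refine le_trans (lintegral_mono_ae ?_) ((lintegral_sup_process_sub_rpow_le H hp1 hp2 hL e e' T {T}
    (by simp)).trans (mul_le_mul' le_rfl (energy_mono fun r ω => ?_)))
  · filter_upwards [e.ae_process_eq_integral H, e'.ae_process_eq_integral H] with ω h h'
    rw [h T fun i => (e.hi_le_horizon i).trans (le_max_left _ _),
      h' T fun i => (e'.hi_le_horizon i).trans (le_max_right _ _), Finset.sup_singleton]
  · exact enorm_indicator_le_enorm_self _ _

end

/-! ### The maximal inequality for all versions of the integral process -/

/-- Jensen's inequality for the power functions with exponent at most one. -/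
theorem lintegral_rpow_le_rpow_lintegral {Ω : Type*} [MeasurableSpace Ω] {P : Measure Ω}
    [IsProbabilityMeasure P] {q p : ℝ} (hq : 0 < q) (hqp : q ≤ p) {g : Ω → ℝ≥0∞}
    (hg : AEMeasurable g P) : ∫⁻ ω, g ω ^ q ∂P ≤ (∫⁻ ω, g ω ^ p ∂P) ^ (q / p) := by
  have h := eLpNorm'_le_eLpNorm'_of_exponent_le hq hqp P hg.aestronglyMeasurable
  rw [eLpNorm'_eq_lintegral_enorm, eLpNorm'_eq_lintegral_enorm] at h
  simp only [enorm_eq_self] at h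
  have h2 := ENNReal.rpow_le_rpow h hq.le
  rwa [← ENNReal.rpow_mul, ← ENNReal.rpow_mul, one_div_mul_cancel hq.ne', ENNReal.rpow_one,
    one_div_mul_eq_div] at h2

theorem tendsto_eLpNorm_zero_iff {Ω E : Type*} [MeasurableSpace Ω] [NormedAddCommGroup E]
    {P : Measure Ω} {p : ℝ≥0} (hp : 0 < p) {f : ℕ → Ω → E} :
    Tendsto (fun m => eLpNorm (f m) p P) atTop (𝓝 0) ↔
      Tendsto (fun m => ∫⁻ ω, ‖f m ω‖ₑ ^ (p : ℝ) ∂P) atTop (𝓝 0) := by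
  have hp' : (0 : ℝ) < p := by exact_mod_cast hp
  constructor
  · intro h
    have := h.ennrpow_const (p : ℝ)
    rw [ENNReal.zero_rpow_of_pos hp'] at this
    exact this.congr fun m => eLpNorm_nnreal_pow_eq_lintegral hp.ne'
  · intro h
    have := h.ennrpow_const (1 / (p : ℝ))
    rw [ENNReal.zero_rpow_of_pos (by positivity)] at this
    exact this.congr fun m => (eLpNorm_nnreal_eq_lintegral hp.ne').symm

theorem lintegral_rpow_le_add {Ω : Type*} [MeasurableSpace Ω] {P : Measure Ω} {p : ℝ}
    (hp : 1 ≤ p) {f g h : Ω → ℝ≥0∞} (hg : AEMeasurable g P) (hle : ∀ᵐ ω ∂P, f ω ≤ g ω + h ω) :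
    ∫⁻ ω, f ω ^ p ∂P ≤ 2 ^ (p - 1) * (∫⁻ ω, g ω ^ p ∂P + ∫⁻ ω, h ω ^ p ∂P) := by
  rw [← lintegral_add_left' (hg.pow_const p), ← lintegral_const_mul' _ _
    (ENNReal.rpow_ne_top_of_nonneg (by linarith) (by simp))]
  refine lintegral_mono_ae ?_
  filter_upwards [hle] with ω hω
  exact (ENNReal.rpow_le_rpow hω (by linarith)).trans
    (ENNReal.rpow_add_le_mul_rpow_add_rpow _ _ hp)

theorem IsPoissonRandomMeasure.aestronglyMeasurable_process {S : Type*} [MeasurableSpace S]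
    {Ω : Type*} [mΩ : MeasurableSpace Ω] {E : Type*} [NormedAddCommGroup E] [NormedSpace ℝ E]
    {𝓕 : Filtration ℝ≥0 mΩ} {P : Measure Ω} {ν : Measure S} {η : Ω → Measure (S × ℝ≥0)}
    (H : IsPoissonRandomMeasure 𝓕 P ν η) (e : ElementaryIntegrand E 𝓕 ν) (t : ℝ≥0) :
    AEStronglyMeasurable (e.process η t) P :=
  ((e.stronglyMeasurable_process H t).mono (𝓕.le t)).aestronglyMeasurable

section

variable {S : Type v} [MeasurableSpace S] {Ω : Type w} [mΩ : MeasurableSpace Ω]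
  {E : Type u} [NormedAddCommGroup E] [NormedSpace ℝ E] [CompleteSpace E]
  {𝓕 : Filtration ℝ≥0 mΩ} {P : Measure Ω} [IsProbabilityMeasure P] {ν : Measure S}
  {η : Ω → Measure (S × ℝ≥0)} {p : ℝ≥0}
  [hp : Fact (1 ≤ (p : ℝ≥0∞))] {ξ : ℝ≥0 → Ω → Lp E (p : ℝ≥0∞) ν}

/-- Integral processes of integrands that approximate `1_{(0, T]} ξ` converge in `L^p` at each
time `t ≤ T` to the integral of `1_{(0, t]} ξ`. -/
theorem IsPoissonIntegral.tendsto_lintegral_process_sub (H : IsPoissonRandomMeasure 𝓕 P ν η)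
    (hp1 : 1 < p) (hp2 : p ≤ 2) {L : ℝ≥0} (hL : MartingaleIncrementBound.{u, w} E p L)
    (hξ : IsMpLoc p 𝓕 P ν ξ) {t T : ℝ≥0} (htT : t ≤ T) {Y : Ω → E}
    (hY : IsPoissonIntegral p 𝓕 P ν η (timeCut ξ t) Y) {e : ℕ → ElementaryIntegrand E 𝓕 ν}
    (he : Tendsto (fun m => energy p P (fun r ω => (e m).toIntegrand (p : ℝ≥0∞) r ω -
      timeCut ξ T r ω)) atTop (𝓝 0)) :
    Tendsto (fun m => ∫⁻ ω, ‖(e m).process η t ω - Y ω‖ₑ ^ (p : ℝ) ∂P) atTop (𝓝 0) := by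
  have hp0 : 0 < p := zero_lt_one.trans hp1
  have hp' : (1 : ℝ) < p := by exact_mod_cast hp1
  obtain ⟨-, e', he', hI⟩ := hY
  have hI' := (tendsto_eLpNorm_zero_iff hp0).1 hI
  simp_rw [← Lp_enorm_rpow hp0] at he'
  change Tendsto (fun m => energy p P (fun r ω => (e' m).toIntegrand (p : ℝ≥0∞) r ω -
    timeCut ξ t r ω)) atTop (𝓝 0) at he'
  have h2 : (2 : ℝ≥0∞) ^ ((p : ℝ) - 1) ≠ ∞ := ENNReal.rpow_ne_top_of_nonneg (by linarith) (by simp)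
  have hc : lowerMaximalConst p p L ≠ ∞ := (lowerMaximalConst_lt_top hp' (by linarith) L).ne
  have hlim : Tendsto (fun m => (2 : ℝ≥0∞) ^ ((p : ℝ) - 1) *
      (lowerMaximalConst p p L * (2 ^ ((p : ℝ) - 1) *
        (energy p P (fun r ω => (e m).toIntegrand (p : ℝ≥0∞) r ω - timeCut ξ T r ω) +
          energy p P (fun r ω => (e' m).toIntegrand (p : ℝ≥0∞) r ω - timeCut ξ t r ω))) +
        ∫⁻ ω, ‖((e' m).integral P η - Y) ω‖ₑ ^ (p : ℝ) ∂P)) atTop (𝓝 0) := by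
    have := ENNReal.Tendsto.const_mul (a := (2 : ℝ≥0∞) ^ ((p : ℝ) - 1)) ((ENNReal.Tendsto.const_mul
      (a := lowerMaximalConst p p L) (ENNReal.Tendsto.const_mul (a := (2 : ℝ≥0∞) ^ ((p : ℝ) - 1))
      (he.add he') (Or.inr h2)) (Or.inr hc)).add hI') (Or.inr h2)
    simpa only [add_zero, mul_zero] using this
  refine tendsto_of_tendsto_of_tendsto_of_le_of_le tendsto_const_nhds hlim (fun _ => zero_le)
    fun m => ?_
  have hpr := (e m).ae_integral_trunc H t
  have hpr' := (e' m).ae_process_eq_integral H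
  have hm : AEStronglyMeasurable ((e' m).integral P η) P :=
    (H.aestronglyMeasurable_process (e' m) (e' m).horizon).congr (by
      filter_upwards [hpr'] with ω hω
      exact (hω _ (e' m).hi_le_horizon).symm)
  have h1 := lintegral_rpow_le_add (P := P) hp'.le
    (f := fun ω => ‖(e m).process η t ω - Y ω‖ₑ)
    (g := fun ω => ‖((e m).trunc t).integral P η ω - (e' m).integral P η ω‖ₑ)
    (h := fun ω => ‖((e' m).integral P η - Y) ω‖ₑ)
    ((((H.aestronglyMeasurable_process (e m) t).congr hpr.symm).sub hm).enorm) (by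
      filter_upwards [hpr] with ω hω
      rw [← hω]
      refine le_trans (le_of_eq ?_) (enorm_add_le _ _)
      rw [Pi.sub_apply, sub_add_sub_cancel])
  refine h1.trans ?_
  gcongr
  refine (lintegral_integral_sub_rpow_le H hp1 hp2 hL _ _).trans ?_
  gcongr
  refine energy_le_add hp1.le ((e m).stronglyMeasurable_uncurry_toIntegrand.sub
    (stronglyMeasurable_timeCut hξ.stronglyMeasurable T)) fun r ω => ?_
  rw [ElementaryIntegrand.toIntegrand_trunc]
  by_cases hr : r ∈ Set.Ioc 0 t
  · have hr' : r ∈ Set.Ioc 0 T := ⟨hr.1, hr.2.trans htT⟩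
    simp only [timeCut, Set.indicator_of_mem hr, Set.indicator_of_mem hr']
    refine le_trans (le_of_eq ?_) enorm_sub_le
    rw [sub_sub_sub_cancel_right]
  · simp only [timeCut, Set.indicator_of_notMem hr, zero_sub, enorm_neg, sub_zero]
    exact le_add_self

/-- The maximal inequality, for every version of the integral process with càdlàg paths. -/
theorem IsStochIntegral.lintegral_iSup_rpow_le (H : IsPoissonRandomMeasure 𝓕 P ν η)
    (hp1 : 1 < p) (hp2 : p ≤ 2) {q : ℝ≥0} (hq : 1 ≤ q) (hqp : q ≤ p) {L : ℝ≥0}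
    (hL : MartingaleIncrementBound.{u, w} E p L) (hξ : IsMpLoc p 𝓕 P ν ξ) {X : ℝ≥0 → Ω → E}
    (hX : IsStochIntegral p 𝓕 P ν η ξ X) (T : ℝ≥0) :
    ∫⁻ ω, (⨆ t ∈ Set.Icc 0 T, ‖X t ω‖ₑ) ^ (q : ℝ) ∂P ≤
      2 ^ ((q : ℝ) - 1) * (lowerMaximalConst p q L * (2 ^ ((p : ℝ) - 1)) ^ ((q : ℝ) / p)) *
        ∫⁻ ω, (∫⁻ r in Set.Ioc 0 T, ‖ξ r ω‖ₑ ^ (p : ℝ) ∂lebesgueNN) ^ ((q : ℝ) / p) ∂P := by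
  have hp0 : 0 < p := zero_lt_one.trans hp1
  have hp' : (1 : ℝ) < p := by exact_mod_cast hp1
  have hq' : (1 : ℝ) ≤ q := by exact_mod_cast hq
  have hqp' : (q : ℝ) ≤ p := by exact_mod_cast hqp
  have hq0 : (0 : ℝ) < q := by linarith
  have hθ0 : 0 < (q : ℝ) / p := by positivity
  have hθ1 : (q : ℝ) / p ≤ 1 := (div_le_one (by linarith)).2 hqp'
  have hXm : ∀ t, AEStronglyMeasurable (X t) P := fun t => (hX.eq_integral t).1.1
  refine lintegral_iSup_Icc_rpow_le hXm hX.cadlag hq0 fun F hF => ?_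
  choose e he using fun m : ℕ => hξ.exists_elementaryIntegrand T (ε := ((m : ℝ≥0∞) + 1)⁻¹)
    (by simp)
  have hε : Tendsto (fun m : ℕ => ((m : ℝ≥0∞) + 1)⁻¹) atTop (𝓝 0) := by
    have := (tendsto_add_atTop_iff_nat 1).2 ENNReal.tendsto_inv_nat_nhds_zero
    simpa using this
  have he0 : Tendsto (fun m => energy p P (fun r ω => (e m).toIntegrand (p : ℝ≥0∞) r ω -
      timeCut ξ T r ω)) atTop (𝓝 0) :=
    tendsto_of_tendsto_of_tendsto_of_le_of_le tendsto_const_nhds hε (fun _ => zero_le) he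
  have hd : Tendsto (fun m => ∑ t ∈ F, ∫⁻ ω, ‖(e m).process η t ω - X t ω‖ₑ ^ (p : ℝ) ∂P) atTop
      (𝓝 0) := by
    have := tendsto_finsetSum F fun t ht => (hX.eq_integral t).tendsto_lintegral_process_sub H hp1
      hp2 hL hξ (hF t ht) he0
    simpa using this
  set J := ∫⁻ ω, (∫⁻ r in Set.Ioc 0 T, ‖ξ r ω‖ₑ ^ (p : ℝ) ∂lebesgueNN) ^ ((q : ℝ) / p) ∂P with hJ
  have h2p : ((2 : ℝ≥0∞) ^ ((p : ℝ) - 1)) ^ ((q : ℝ) / p) ≠ ∞ :=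
    ENNReal.rpow_ne_top_of_nonneg hθ0.le (ENNReal.rpow_ne_top_of_nonneg (by linarith) (by simp))
  have h2q : (2 : ℝ≥0∞) ^ ((q : ℝ) - 1) ≠ ∞ := ENNReal.rpow_ne_top_of_nonneg (by linarith) (by simp)
  have hc : lowerMaximalConst p q L ≠ ∞ := (lowerMaximalConst_lt_top hp' hq0 L).ne
  have hlim : Tendsto (fun m => (2 : ℝ≥0∞) ^ ((q : ℝ) - 1) * (lowerMaximalConst p q L *
      ((2 ^ ((p : ℝ) - 1)) ^ ((q : ℝ) / p) * (J + (energy p P (fun r ω =>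
        (e m).toIntegrand (p : ℝ≥0∞) r ω - timeCut ξ T r ω)) ^ ((q : ℝ) / p))) +
      (∑ t ∈ F, ∫⁻ ω, ‖(e m).process η t ω - X t ω‖ₑ ^ (p : ℝ) ∂P) ^ ((q : ℝ) / p))) atTop
      (𝓝 (2 ^ ((q : ℝ) - 1) * (lowerMaximalConst p q L * (2 ^ ((p : ℝ) - 1)) ^ ((q : ℝ) / p)) *
        J)) := by
    have h1 := he0.ennrpow_const ((q : ℝ) / p)
    have h2 := hd.ennrpow_const ((q : ℝ) / p)
    rw [ENNReal.zero_rpow_of_pos hθ0] at h1 h2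
    have := ENNReal.Tendsto.const_mul (a := (2 : ℝ≥0∞) ^ ((q : ℝ) - 1)) ((ENNReal.Tendsto.const_mul
      (a := lowerMaximalConst p q L) (ENNReal.Tendsto.const_mul
      (a := ((2 : ℝ≥0∞) ^ ((p : ℝ) - 1)) ^ ((q : ℝ) / p))
      ((tendsto_const_nhds (x := J)).add h1) (Or.inr h2p)) (Or.inr hc)).add h2) (Or.inr h2q)
    simpa only [add_zero, mul_assoc] using this
  refine ge_of_tendsto' hlim fun m => ?_
  have hpm : ∀ t, AEStronglyMeasurable ((e m).process η t) P := fun t =>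
    H.aestronglyMeasurable_process (e m) t
  have hD : AEMeasurable (fun ω => F.sup fun t => ‖(e m).process η t ω - X t ω‖ₑ) P := by
    simp_rw [Finset.sup_eq_iSup]
    exact AEMeasurable.biSup _ F.countable_toSet fun t _ => ((hpm t).sub (hXm t)).enorm
  have hD' : AEMeasurable (fun ω => F.sup fun t => ‖(e m).process η t ω‖ₑ) P := by
    simp_rw [Finset.sup_eq_iSup]
    exact AEMeasurable.biSup _ F.countable_toSet fun t _ => (hpm t).enorm
  refine (lintegral_rpow_le_add (P := P) hq' hD'
    (h := fun ω => F.sup fun t => ‖(e m).process η t ω - X t ω‖ₑ) (ae_of_all _ fun ω => ?_)).trans ?_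
  · refine Finset.sup_le fun t ht => ?_
    have h1 : ‖X t ω‖ₑ ≤ ‖(e m).process η t ω‖ₑ + ‖(e m).process η t ω - X t ω‖ₑ := by
      simpa using enorm_sub_le (a := (e m).process η t ω) (b := (e m).process η t ω - X t ω)
    refine h1.trans (add_le_add ?_ ?_)
    · exact Finset.le_sup (f := fun t => ‖(e m).process η t ω‖ₑ) ht
    · exact Finset.le_sup (f := fun t => ‖(e m).process η t ω - X t ω‖ₑ) ht
  gcongr
  · -- the elementary integrand is compared with `1_{(0, T]} ξ`
    have hq00 : 0 < q := zero_lt_one.trans_le hq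
    have h1 := ((e m).trunc T).lintegral_sup_process_rpow_le H hp1 hp2 hq00 hqp hL F
    refine le_trans (le_of_eq (lintegral_congr fun ω => ?_)) (h1.trans ?_)
    · congr 1
      exact Finset.sup_congr rfl fun t ht =>
        congrArg _ (ElementaryIntegrand.process_trunc _ _ (hF t ht) ω).symm
    gcongr
    have hm1 : StronglyMeasurable (Function.uncurry (timeCut ξ T)) :=
      stronglyMeasurable_timeCut hξ.stronglyMeasurable T
    have hm2 : StronglyMeasurable (Function.uncurry fun r ω =>
        (e m).toIntegrand (p : ℝ≥0∞) r ω - timeCut ξ T r ω) :=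
      (e m).stronglyMeasurable_uncurry_toIntegrand.sub hm1
    calc ∫⁻ ω, (∫⁻ r, ‖((e m).trunc T).toIntegrand (p : ℝ≥0∞) r ω‖ₑ ^ (p : ℝ) ∂lebesgueNN)
          ^ ((q : ℝ) / p) ∂P
        ≤ ∫⁻ ω, (2 ^ ((p : ℝ) - 1)) ^ ((q : ℝ) / p) *
          ((∫⁻ r in Set.Ioc 0 T, ‖ξ r ω‖ₑ ^ (p : ℝ) ∂lebesgueNN) ^ ((q : ℝ) / p) +
          (∫⁻ r, ‖(e m).toIntegrand (p : ℝ≥0∞) r ω - timeCut ξ T r ω‖ₑ ^ (p : ℝ) ∂lebesgueNN)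
            ^ ((q : ℝ) / p)) ∂P := by
          refine lintegral_mono fun ω => ?_
          refine (ENNReal.rpow_le_rpow (lintegral_enorm_rpow_le_add hp1.le (g := timeCut ξ T)
            (h := fun r ω => (e m).toIntegrand (p : ℝ≥0∞) r ω - timeCut ξ T r ω) hm1
            fun r => ?_) hθ0.le).trans ?_
          · rw [ElementaryIntegrand.toIntegrand_trunc]
            refine (enorm_indicator_le_enorm_self _ _).trans ?_
            refine le_trans (le_of_eq ?_) (enorm_add_le _ _)
            rw [add_sub_cancel]
          · rw [ENNReal.mul_rpow_of_nonneg _ _ hθ0.le, lintegral_timeCut hp0]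
            gcongr
            exact ENNReal.rpow_add_le_add_rpow _ _ hθ0.le hθ1
      _ ≤ (2 ^ ((p : ℝ) - 1)) ^ ((q : ℝ) / p) * (J + (energy p P (fun r ω =>
          (e m).toIntegrand (p : ℝ≥0∞) r ω - timeCut ξ T r ω)) ^ ((q : ℝ) / p)) := by
          rw [lintegral_const_mul' _ _ h2p, lintegral_add_right _
            ((measurable_lintegral_enorm_rpow hm2).pow_const _)]
          gcongr
          have := lintegral_rpow_le_rpow_lintegral (P := P) hθ0 hθ1
            (measurable_lintegral_enorm_rpow (p := p) hm2).aemeasurable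
          simp only [ENNReal.rpow_one, div_one] at this
          exact this
  · refine (lintegral_rpow_le_rpow_lintegral hq0 hqp' hD).trans ?_
    gcongr
    refine le_trans (lintegral_mono fun ω => ?_) (lintegral_finsetSum' F
      (f := fun t ω => ‖(e m).process η t ω - X t ω‖ₑ ^ (p : ℝ))
      fun t _ => (((hpm t).sub (hXm t)).enorm).pow_const _).le
    rcases F.eq_empty_or_nonempty with rfl | hne
    · simp [hp0]
    · obtain ⟨t, ht, hmax⟩ := F.exists_mem_eq_sup hne fun t => ‖(e m).process η t ω - X t ω‖ₑ
      simp only [hmax]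
      exact Finset.single_le_sum (f := fun t => ‖(e m).process η t ω - X t ω‖ₑ ^ (p : ℝ))
        (fun _ _ => zero_le) ht

end

/-! ### Existence of the integral process -/

theorem memLp_of_lintegral_enorm_rpow_lt_top {Ω E : Type*} [MeasurableSpace Ω]
    [NormedAddCommGroup E] {P : Measure Ω} {p : ℝ≥0} (hp : 0 < p) {f : Ω → E}
    (hf : AEStronglyMeasurable f P) (h : ∫⁻ ω, ‖f ω‖ₑ ^ (p : ℝ) ∂P < ∞) : MemLp f p P :=
  ⟨hf, (eLpNorm_lt_top_iff_lintegral_rpow_enorm_lt_top (by exact_mod_cast hp.ne')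
    ENNReal.coe_ne_top).2 (by simpa using h)⟩

/-- A sequence whose consecutive members have, from the `N`-th one on, summable distances on
`[0, N]` for each `N` converges uniformly on bounded intervals. -/
theorem exists_tendstoUniformlyOn_of_tsum_ne_top {E : Type*} [NormedAddCommGroup E]
    [CompleteSpace E] {f : ℕ → ℝ≥0 → E} {D : ℕ → ℕ → ℝ≥0∞}
    (hD : ∀ N : ℕ, ∀ k, ∀ t ≤ (N : ℝ≥0), ‖f (k + N) t - f (k + N + 1) t‖ₑ ≤ D N k)
    (hsum : ∀ N, ∑' k, D N k ≠ ∞) :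
    (∀ t, Tendsto (fun k => f k t) atTop (𝓝 (limUnder atTop fun k => f k t))) ∧
      ∀ N : ℕ, TendstoUniformlyOn f (fun t => limUnder atTop fun k => f k t) atTop
        (Set.Iic (N : ℝ≥0)) := by
  have hstep : ∀ N : ℕ, ∀ t ≤ (N : ℝ≥0), ∀ k, edist (f (k + N) t) (f (k.succ + N) t) ≤ D N k := by
    intro N t ht k
    rw [edist_eq_enorm_sub, Nat.succ_add]
    exact hD N k t ht
  have hlim : ∀ t, Tendsto (fun k => f k t) atTop (𝓝 (limUnder atTop fun k => f k t)) := by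
    intro t
    obtain ⟨N, hN⟩ := exists_nat_ge t
    have hc : CauchySeq fun k => f (k + N) t :=
      cauchySeq_of_edist_le_of_tsum_ne_top _ (hstep N t hN) (hsum N)
    obtain ⟨a, ha⟩ := cauchySeq_tendsto_of_complete hc
    exact tendsto_nhds_limUnder ⟨a, (tendsto_add_atTop_iff_nat N).1 ha⟩
  refine ⟨hlim, fun N => EMetric.tendstoUniformlyOn_iff.2 fun ε hε => ?_⟩
  have h0 := ((ENNReal.tendsto_sum_nat_add (D N) (hsum N)).eventually (gt_mem_nhds hε))
  obtain ⟨n, hn⟩ := eventually_atTop.1 h0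
  refine eventually_atTop.2 ⟨n + N, fun k hk t ht => ?_⟩
  obtain ⟨m, rfl⟩ : ∃ m, k = m + N := ⟨k - N, by omega⟩
  rw [edist_comm]
  refine (edist_le_tsum_of_edist_le_of_tendsto (D N) (hstep N t ht)
    ((tendsto_add_atTop_iff_nat N).2 (hlim t)) m).trans_lt ?_
  simp_rw [add_comm m]
  exact hn m (by omega)

section

variable {S : Type v} [MeasurableSpace S] {Ω : Type w} [mΩ : MeasurableSpace Ω]
  {E : Type u} [NormedAddCommGroup E] [NormedSpace ℝ E] [CompleteSpace E]
  {𝓕 : Filtration ℝ≥0 mΩ} {P : Measure Ω} [IsProbabilityMeasure P] {ν : Measure S}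
  {η : Ω → Measure (S × ℝ≥0)} {p : ℝ≥0}
  [hp : Fact (1 ≤ (p : ℝ≥0∞))] {ξ : ℝ≥0 → Ω → Lp E (p : ℝ≥0∞) ν}

/-- Integrands that approximate `ξ` on `[0, k]` up to `2⁻ᵏ` give integral processes that converge
uniformly on bounded intervals, almost surely. -/
theorem IsMpLoc.exists_stochIntegral (H : IsPoissonRandomMeasure 𝓕 P ν η)
    (hp1 : 1 < p) (hp2 : p ≤ 2) {L : ℝ≥0} (hL : MartingaleIncrementBound.{u, w} E p L)
    (hξ : IsMpLoc p 𝓕 P ν ξ) :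
    ∃ X : ℝ≥0 → Ω → E, StronglyAdapted 𝓕 X ∧ IsStochIntegral p 𝓕 P ν η ξ X := by
  have hp0 : 0 < p := zero_lt_one.trans hp1
  have hp' : (1 : ℝ) < p := by exact_mod_cast hp1
  have hp0' : (0 : ℝ) < p := by linarith
  set δ : ℕ → ℝ≥0∞ := fun k => ((2 : ℝ≥0∞)⁻¹ ^ k) ^ (p : ℝ) with hδ
  have hδ0 : ∀ k, δ k ≠ 0 := fun k => by simp [hδ, ENNReal.rpow_eq_zero_iff, hp0]
  have hδtop : ∀ k, δ k ≠ ∞ := fun k => ENNReal.rpow_ne_top_of_nonneg hp0'.le (by simp)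
  have hδanti : ∀ k j, k ≤ j → δ j ≤ δ k := fun k j hkj => ENNReal.rpow_le_rpow
    (pow_le_pow_right_of_le_one' (by simp) hkj) hp0'.le
  have hδlim : Tendsto δ atTop (𝓝 0) := by
    have := (ENNReal.tendsto_pow_atTop_nhds_zero_of_lt_one (r := (2 : ℝ≥0∞)⁻¹)
      (by simp)).ennrpow_const (p : ℝ)
    rwa [ENNReal.zero_rpow_of_pos hp0'] at this
  choose e he using fun k : ℕ => hξ.exists_elementaryIntegrand k (hδ0 k)
  change ∀ k : ℕ, energy p P (fun r ω => (e k).toIntegrand (p : ℝ≥0∞) r ω - timeCut ξ k r ω) ≤ δ k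
    at he
  set C : ℝ≥0∞ := lowerMaximalConst p p L * (2 ^ ((p : ℝ) - 1) * 2) with hC
  have h2 : (2 : ℝ≥0∞) ^ ((p : ℝ) - 1) ≠ ∞ := ENNReal.rpow_ne_top_of_nonneg (by linarith) (by simp)
  have hcL : lowerMaximalConst p p L ≠ ∞ := (lowerMaximalConst_lt_top hp' hp0' L).ne
  have hCtop : C ≠ ∞ := ENNReal.mul_ne_top hcL (ENNReal.mul_ne_top h2 (by simp))
  have hXm : ∀ k t, StronglyMeasurable ((e k).process η t) := fun k t =>
    ((e k).stronglyMeasurable_process H t).mono (𝓕.le t)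
  have hdist : ∀ N k j : ℕ, N ≤ k → k ≤ j → ∀ F : Finset ℝ≥0, (∀ t ∈ F, t ≤ (N : ℝ≥0)) →
      ∫⁻ ω, (F.sup fun t => ‖(e k).process η t ω - (e j).process η t ω‖ₑ) ^ (p : ℝ) ∂P ≤
        C * δ k := by
    intro N k j hNk hkj F hF
    refine (lintegral_sup_process_sub_rpow_le H hp1 hp2 hL (e k) (e j) N F hF).trans ?_
    rw [hC, mul_assoc, mul_assoc]
    gcongr
    refine (energy_le_add hp1.le (g := fun r ω => (e k).toIntegrand (p : ℝ≥0∞) r ω -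
      timeCut ξ k r ω) (h := fun r ω => (e j).toIntegrand (p : ℝ≥0∞) r ω - timeCut ξ j r ω)
      ((e k).stronglyMeasurable_uncurry_toIntegrand.sub
      (stronglyMeasurable_timeCut hξ.stronglyMeasurable k)) fun r ω => ?_).trans ?_
    · by_cases hr : r ∈ Set.Ioc 0 (N : ℝ≥0)
      · have hrk : r ∈ Set.Ioc 0 (k : ℝ≥0) := ⟨hr.1, hr.2.trans (by exact_mod_cast hNk)⟩
        have hrj : r ∈ Set.Ioc 0 (j : ℝ≥0) := ⟨hr.1, hrk.2.trans (by exact_mod_cast hkj)⟩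
        simp only [timeCut, Set.indicator_of_mem hr, Set.indicator_of_mem hrk,
          Set.indicator_of_mem hrj]
        refine le_trans (le_of_eq ?_) enorm_sub_le
        rw [sub_sub_sub_cancel_right]
      · rw [timeCut, Set.indicator_of_notMem hr, enorm_zero]
        exact zero_le
    · rw [two_mul]
      gcongr
      · exact he k
      · exact (he j).trans (hδanti k j hkj)
  -- the suprema over dense times are measurable and control the suprema over intervals
  set D : ℕ → ℕ → Ω → ℝ≥0∞ := fun N k ω => ⨆ n, ‖(e (k + N)).process η (denseTimes N n) ω -
    (e (k + N + 1)).process η (denseTimes N n) ω‖ₑ with hDdef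
  have hDm : ∀ N k, Measurable (D N k) := fun N k =>
    Measurable.iSup fun n => ((hXm _ _).sub (hXm _ _)).enorm
  have hcad : ∀ᵐ ω ∂P, ∀ k, IsCadlagPath fun t => (e k).process η t ω :=
    ae_all_iff.2 fun k => (e k).ae_isCadlagPath_process H
  have hDp : ∀ N k, ∫⁻ ω, D N k ω ∂P ≤ C ^ (1 / (p : ℝ)) * (2 : ℝ≥0∞)⁻¹ ^ k := by
    intro N k
    have h1 : ∫⁻ ω, D N k ω ^ (p : ℝ) ∂P ≤ C * δ (k + N) := by
      refine le_trans (lintegral_mono fun ω => ?_) (lintegral_iSup_Icc_rpow_le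
        (X := fun t ω => (e (k + N)).process η t ω - (e (k + N + 1)).process η t ω)
        (fun t => ((hXm _ _).sub (hXm _ _)).aestronglyMeasurable) (T := (N : ℝ≥0)) ?_ hp0'
        (hdist N (k + N) (k + N + 1) (by omega) (by omega)))
      · refine ENNReal.rpow_le_rpow (iSup_le fun n => ?_) hp0'.le
        exact le_iSup₂ (f := fun t (_ : t ∈ Set.Icc 0 (N : ℝ≥0)) =>
          ‖(e (k + N)).process η t ω - (e (k + N + 1)).process η t ω‖ₑ) (denseTimes N n)
          ⟨zero_le, denseTimes_le _ _⟩
      · filter_upwards [hcad] with ω hω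
        exact (hω _).sub (hω _)
    have h3 := lintegral_rpow_le_rpow_lintegral (P := P) zero_lt_one hp'.le
      (hDm N k).aemeasurable
    simp only [ENNReal.rpow_one] at h3
    calc ∫⁻ ω, D N k ω ∂P ≤ (C * δ (k + N)) ^ (1 / (p : ℝ)) :=
          h3.trans (ENNReal.rpow_le_rpow h1 (by positivity))
      _ ≤ (C * δ k) ^ (1 / (p : ℝ)) :=
          ENNReal.rpow_le_rpow (mul_le_mul' le_rfl (hδanti _ _ (by omega))) (by positivity)
      _ = C ^ (1 / (p : ℝ)) * (2 : ℝ≥0∞)⁻¹ ^ k := by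
          rw [ENNReal.mul_rpow_of_nonneg _ _ (by positivity), hδ, ← ENNReal.rpow_mul,
            mul_one_div_cancel hp0'.ne', ENNReal.rpow_one]
  have hDsum : ∀ᵐ ω ∂P, ∀ N, ∑' k, D N k ω ≠ ∞ := by
    refine ae_all_iff.2 fun N => ?_
    have : ∫⁻ ω, ∑' k, D N k ω ∂P ≠ ∞ := by
      rw [lintegral_tsum fun k => (hDm N k).aemeasurable]
      refine ne_top_of_le_ne_top ?_ (ENNReal.tsum_le_tsum (hDp N))
      rw [ENNReal.tsum_mul_left, ENNReal.tsum_geometric]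
      refine ENNReal.mul_ne_top (ENNReal.rpow_ne_top_of_nonneg (by positivity) hCtop) ?_
      simp
    filter_upwards [ae_lt_top (Measurable.tsum (hDm N)) this] with ω hω
    exact hω.ne
  have hconv : ∀ᵐ ω ∂P, (∀ t, Tendsto (fun k => (e k).process η t ω) atTop
      (𝓝 (limUnder atTop fun k => (e k).process η t ω))) ∧
      IsCadlagPath fun t => limUnder atTop fun k => (e k).process η t ω := by
    filter_upwards [hcad, hDsum] with ω hω hsum
    have := exists_tendstoUniformlyOn_of_tsum_ne_top (f := fun k t => (e k).process η t ω)
      (D := fun N k => D N k ω) (fun N k t ht =>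
        ((hω (k + N)).sub (hω (k + N + 1))).enorm_le_iSup_denseTimes ht) hsum
    exact ⟨this.1, IsCadlagPath.of_tendstoUniformlyOn hω this.2⟩
  have hXlim : ∀ t, StronglyMeasurable[𝓕 t] fun ω =>
      limUnder atTop fun k => (e k).process η t ω := fun t =>
    @StronglyMeasurable.limUnder ℕ Ω E (𝓕 t) _ _ atTop _ _ _ _
      fun k => (e k).stronglyMeasurable_process H t
  refine ⟨fun t ω => limUnder atTop fun k => (e k).process η t ω, hXlim,
    hconv.mono fun ω h => h.2, fun t => ?_⟩
  set X : Ω → E := fun ω => limUnder atTop fun k => (e k).process η t ω with hX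
  obtain ⟨N, hN⟩ := exists_nat_ge t
  have hXm' : StronglyMeasurable X := (hXlim t).mono (𝓕.le t)
  have hfatou : ∀ k, N ≤ k → ∫⁻ ω, ‖(e k).process η t ω - X ω‖ₑ ^ (p : ℝ) ∂P ≤ C * δ k := by
    intro k hk
    calc ∫⁻ ω, ‖(e k).process η t ω - X ω‖ₑ ^ (p : ℝ) ∂P
        = ∫⁻ ω, liminf (fun j => ‖(e k).process η t ω - (e j).process η t ω‖ₑ ^ (p : ℝ)) atTop
          ∂P := by
          refine lintegral_congr_ae ?_
          filter_upwards [hconv] with ω hω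
          exact (((tendsto_const_nhds.sub (hω.1 t)).enorm).ennrpow_const _).liminf_eq.symm
      _ ≤ liminf (fun j => ∫⁻ ω, ‖(e k).process η t ω - (e j).process η t ω‖ₑ ^ (p : ℝ) ∂P)
          atTop := lintegral_liminf_le fun j => (((hXm k t).sub (hXm j t)).enorm).pow_const _
      _ ≤ C * δ k := by
          refine (liminf_le_liminf (v := fun _ => C * δ k) ?_).trans_eq (liminf_const _)
          filter_upwards [eventually_ge_atTop k] with j hj
          simpa using hdist N k j hk hj {t} (by simpa using hN)
  have hmem : MemLp X p P := by
    have h1 : MemLp ((e N).process η t) p P := by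
      refine memLp_of_lintegral_enorm_rpow_lt_top hp0 (hXm N t).aestronglyMeasurable ?_
      have h3 := (e N).lintegral_sup_process_rpow_le H hp1 hp2 hp0 le_rfl hL {t}
      rw [div_self hp0'.ne'] at h3
      simp only [ENNReal.rpow_one, Finset.sup_singleton] at h3
      refine h3.trans_lt (ENNReal.mul_lt_top hcL.lt_top ?_)
      refine (energy_le_add hp1.le (f := (e N).toIntegrand (p : ℝ≥0∞)) (g := timeCut ξ N)
        (h := fun r ω => (e N).toIntegrand (p : ℝ≥0∞) r ω - timeCut ξ N r ω)
        (stronglyMeasurable_timeCut hξ.stronglyMeasurable N) fun r ω => ?_).trans_lt ?_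
      · refine le_trans (le_of_eq ?_) (enorm_add_le _ _)
        rw [add_sub_cancel]
      · exact ENNReal.mul_lt_top h2.lt_top (ENNReal.add_lt_top.2
          ⟨hξ.energy_timeCut_lt_top hp0 N, (he N).trans_lt (hδtop N).lt_top⟩)
    have h4 : MemLp ((e N).process η t - X) p P :=
      memLp_of_lintegral_enorm_rpow_lt_top hp0 ((hXm N t).sub hXm').aestronglyMeasurable
        ((hfatou N le_rfl).trans_lt (ENNReal.mul_lt_top hCtop.lt_top (hδtop N).lt_top))
    simpa using h1.sub h4
  have hδN : Tendsto (fun m => δ (m + N)) atTop (𝓝 0) := (tendsto_add_atTop_iff_nat N).2 hδlim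
  refine ⟨hmem, fun m => (e (m + N)).trunc t, ?_, ?_⟩
  · simp_rw [← Lp_enorm_rpow hp0]
    refine tendsto_of_tendsto_of_tendsto_of_le_of_le tendsto_const_nhds hδN (fun _ => zero_le)
      fun m => le_trans (energy_mono fun r ω => ?_) (he (m + N))
    rw [ElementaryIntegrand.toIntegrand_trunc]
    by_cases hr : r ∈ Set.Ioc 0 t
    · have hr' : r ∈ Set.Ioc 0 ((m + N : ℕ) : ℝ≥0) :=
        ⟨hr.1, hr.2.trans (hN.trans (by exact_mod_cast Nat.le_add_left N m))⟩
      simp only [timeCut, Set.indicator_of_mem hr, Set.indicator_of_mem hr']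
      exact le_rfl
    · simp only [Set.indicator_of_notMem hr, sub_zero, enorm_zero]
      exact zero_le
  · refine (tendsto_eLpNorm_zero_iff hp0).2 ?_
    have hlim := ENNReal.Tendsto.const_mul (a := C) hδN (Or.inr hCtop)
    rw [mul_zero] at hlim
    refine tendsto_of_tendsto_of_tendsto_of_le_of_le tendsto_const_nhds hlim (fun _ => zero_le)
      fun m => le_trans (le_of_eq (lintegral_congr_ae ?_)) (hfatou (m + N) (Nat.le_add_left N m))
    filter_upwards [(e (m + N)).ae_integral_trunc H t] with ω hω
    rw [Pi.sub_apply, hω]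

end

/-- Maximal inequality for stochastic integrals with respect to a compensated Poisson random
measure in a Banach space of martingale type `p`.  The constant depends on `E`, `p`, `q` only.
The integral process exists (adapted, with càdlàg paths), and every version of it satisfies the
inequality. -/
theorem corollaryB2 {E : Type u} [NormedAddCommGroup E] [NormedSpace ℝ E]
    [CompleteSpace E] (p q : ℝ≥0) [Fact (1 ≤ (p : ℝ≥0∞))] (hq : 1 < q) (hqp : q ≤ p) (hp : p < 2)
    (hE : HasMartingaleType.{u, w} E p) :
    ∃ C : ℝ≥0, 0 < C ∧
      ∀ (S : Type v) [MeasurableSpace S] (ν : Measure S)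
        (Ω : Type w) [mΩ : MeasurableSpace Ω] (P : Measure Ω) [IsProbabilityMeasure P]
        (𝓕 : Filtration ℝ≥0 mΩ) (η : Ω → Measure (S × ℝ≥0)),
        IsPoissonRandomMeasure 𝓕 P ν η →
        ∀ ξ : ℝ≥0 → Ω → Lp E (p : ℝ≥0∞) ν, IsMpLoc p 𝓕 P ν ξ →
          (∃ X : ℝ≥0 → Ω → E, StronglyAdapted 𝓕 X ∧ IsStochIntegral p 𝓕 P ν η ξ X) ∧
          ∀ X : ℝ≥0 → Ω → E, IsStochIntegral p 𝓕 P ν η ξ X →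
            ∀ T : ℝ≥0, 0 < T →
              ∫⁻ ω, (⨆ t ∈ Set.Icc 0 T, ‖X t ω‖ₑ) ^ (q : ℝ) ∂P ≤
                C * ∫⁻ ω, (∫⁻ r in Set.Ioc 0 T, ∫⁻ x, ‖ξ r ω x‖ₑ ^ (p : ℝ) ∂ν ∂lebesgueNN)
                  ^ ((q : ℝ) / p) ∂P := by
  have hp1 : 1 < p := hq.trans_le hqp
  have hp0 : 0 < p := zero_lt_one.trans hp1
  have hp' : (1 : ℝ) < p := by exact_mod_cast hp1
  have hq' : (1 : ℝ) < q := by exact_mod_cast hq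
  obtain ⟨L, hL⟩ := hE.exists_martingaleIncrementBound (by linarith : (0 : ℝ) < p)
  set K : ℝ≥0∞ := 2 ^ ((q : ℝ) - 1) *
    (lowerMaximalConst p q L * (2 ^ ((p : ℝ) - 1)) ^ ((q : ℝ) / p)) with hK
  have hKtop : K ≠ ∞ := ENNReal.mul_ne_top
    (ENNReal.rpow_ne_top_of_nonneg (by linarith) (by simp))
    (ENNReal.mul_ne_top (lowerMaximalConst_lt_top hp' (by linarith) L).ne
      (ENNReal.rpow_ne_top_of_nonneg (by positivity)
        (ENNReal.rpow_ne_top_of_nonneg (by linarith) (by simp))))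
  refine ⟨K.toNNReal + 1, by positivity, fun S _ ν Ω mΩ P _ 𝓕 η H ξ hξ =>
    ⟨hξ.exists_stochIntegral H hp1 hp.le hL, fun X hX T _ => ?_⟩⟩
  simp_rw [← Lp_enorm_rpow hp0]
  refine (hX.lintegral_iSup_rpow_le H hp1 hp.le hq.le hqp hL hξ T).trans ?_
  gcongr
  rw [ENNReal.coe_add, ENNReal.coe_toNNReal hKtop]
  exact le_self_add
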